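/- Let $n\ge 2$ and let $\Omega\subset\mathbb R^n$ be a bounded domain. Let $\phi\in C^2([0,\infty))$ be a Young function (convex, nonnegative, nonconstant, $\phi(0)=0$) with $$1<i_\phi:=\inf_{t>0}\frac{t\phi''(t)}{\phi'(t)}+1\;\le\; s_\phi:=\sup_{t>0}\frac{t\phi''(t)}{\phi'(t)}+1<\infty ,$$ and let $\phi^*(t)=\sup_{s\ge0}(st-\phi(s))$. On matrices use the scalar product $\langle P,Q\rangle=\sum_{i,j}P_{ij}Q_{ij}$ and its norm. Let $A:\Omega\times\mathbb R^{n\times n}_{\rm sym}\to\mathbb R^{n\times n}_{\rm sym}$ be continuous in $x$, with $A(x,\cdot)\in C^1(\mathbb R^{n\times n}_{\rm sym}\setminus\{0\})\cap C^0(\mathbb R^{n\times n}_{\rm sym})$, and such that, with positive constants $\nu,L_1,L_2,K$, for a.e. $x,y\in\Omega$ and all $P,Q\in\mathbb R^{n\times n}_{\rm sym}$, $$\langle A(x,P)-A(x,Q),P-Q\rangle\ge\nu\,\phi''(|P|+|Q|)|P-Q|^2,\qquad |A(x,P)-A(x,Q)|\le L_1\phi''(|P|+|Q|)|P-Q|,$$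 $$|A(x,P)|\le L_2\phi'(|P|),\qquad |A(x,P)-A(y,P)|\le K|x-y|\phi'(|P|).$$ Put $\mathcal E v=\frac12(Dv+(Dv)^T)$ and $V(P)=\sqrt{\phi'(|P|)/|P|}\,P$ for $P\ne0$, $V(0)=0$. Let $f\in W^{1,\phi^*}_{\rm loc}(\Omega,\mathbb R^n)$ and $u\in W^{1,\phi}(\Omega,\mathbb R^n)$, let $B_R\Subset\Omega$ be a ball, and let $u_\varepsilon,f_\varepsilon$ be the mollifications of $u,f$ at scale $\varepsilon$, $0<\varepsilon<\mathrm{dist}(B_R,\partial\Omega)$. Let $k\in\mathbb N$ be such that $W^{k,2}(B_R,\mathbb R^n)\hookrightarrow C^2(B_R,\mathbb R^n)$, i.e. $2k>n+4$, and let $\tilde\varepsilon>0$. Let $u_{k,\varepsilon}\in u_\varepsilon+W^{k,2}_0(B_R,\mathbb R^n)$ satisfy $$\tilde\varepsilon\int_{B_R}\langle D^ku_{k,\varepsilon},D^k\psi\rangle\,dx=-\int_{B_R}\langle A(x,\mathcal E u_{k,\varepsilon}),\mathcal E\psi\rangle\,dx+\int_{B_R}\langle f_\varepsilon,\psi\rangle\,dx\qquad\text{for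 all }\psi\in W^{k,2}_0(B_R,\mathbb R^n).$$ Then $V(\mathcal E u_{k,\varepsilon})\in W^{1,2}_{\rm loc}(B_R,\mathbb R^{n\times n}_{\rm sym})$ and, for every pair of concentric balls $B_\rho\subset B_r\Subset B_R$ with $0<\rho<r$, all integrals below are finite and $$\int_{B_\rho}|D(V(\mathcal E u_{k,\varepsilon}))|^2dx\le c\Big(1+\frac{k^2}{(r-\rho)^2}\Big)\int_{B_r}\phi(|Du_{k,\varepsilon}|)\,dx+c\int_{B_r}\phi^*(|Df_\varepsilon|)\,dx+\frac{c_k\tilde\varepsilon}{(r-\rho)^{2k}}\int_{B_r}\sum_{i=0}^{k-1}|D^iDu_{k,\varepsilon}|^2dx .$$ Here $c=c(\nu,L_1,L_2,K,i_\phi,s_\phi,n)$ does not depend on $k$, and $c_k$ depends only on the same quantities and on $k$; in particular neither depends on $\varepsilon$ or $\tilde\varepsilon$. -/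

import Mathlib

open MeasureTheory Set Metric
open scoped ContDiff ENNReal

noncomputable section

namespace OrliczSym

/-! ### Points, matrices, symmetric matrices -/

/-- Points of `ℝⁿ`, with the Euclidean norm. -/
abbrev Pt (n : ℕ) : Type := EuclideanSpace ℝ (Fin n)

/-- Real `n × n` matrices, with the standard scalar product `∑ Pᵢⱼ Qᵢⱼ` and its norm. -/
abbrev Mat (n : ℕ) : Type := EuclideanSpace ℝ (Fin n × Fin n)

/-- The space of symmetric matrices, with the scalar product inherited from `Mat n`. -/
def SymMat (n : ℕ) : Submodule ℝ (Mat n) where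
  carrier := {P | ∀ i j, P (i, j) = P (j, i)}
  zero_mem' := by intro i j; simp
  add_mem' := by
    intro P Q hP hQ i j
    simp [hP i j, hQ i j]
  smul_mem' := by
    intro c P hP i j
    simp [hP i j]

/-! ### Young functions

Functions on `[0, ∞)` are represented by functions `ℝ → ℝ` of which only the values on `[0, ∞)`
matter; derivatives are taken within `[0, ∞)`, hence one-sided at `0`. -/

/-- Left-continuous convex functions `[0, ∞) → [0, ∞)` that vanish at `0` and are not constant. -/
structure IsYoung (φ : ℝ → ℝ) : Prop where
  nonneg : ∀ t, 0 ≤ t → 0 ≤ φ t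
  zero : φ 0 = 0
  convex : ConvexOn ℝ (Ici 0) φ
  left_cont : ∀ t, 0 < t → ContinuousWithinAt φ (Icc 0 t) t
  not_const : ∃ t, 0 ≤ t ∧ φ t ≠ 0

/-- `φ'` on `[0, ∞)`. -/
def d1 (φ : ℝ → ℝ) : ℝ → ℝ := derivWithin φ (Ici 0)

/-- `φ''` on `[0, ∞)`. -/
def d2 (φ : ℝ → ℝ) : ℝ → ℝ := derivWithin (d1 φ) (Ici 0)

/-- The set of all values `t φ''(t) / φ'(t) + 1`, `t > 0`. -/
def indexSet (φ : ℝ → ℝ) : Set ℝ := (fun t => t * d2 φ t / d1 φ t + 1) '' Ioi 0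

/-- `φ` is a Young function of class `C²([0, ∞))` whose indices
`i = inf_{t>0} t φ''(t)/φ'(t) + 1` and `s = sup_{t>0} t φ''(t)/φ'(t) + 1` are finite, with `1 < i`.
(If `φ'(t) = 0` for some `t > 0`, then `1` belongs to `indexSet φ`, which contradicts `1 < i`; so
the quotients are genuine.) -/
structure IsRegularYoung (φ : ℝ → ℝ) (i s : ℝ) : Prop where
  young : IsYoung φ
  smooth : ContDiffOn ℝ 2 φ (Ici 0)
  lower : IsGLB (indexSet φ) i
  upper : IsLUB (indexSet φ) s
  one_lt : 1 < i

/-- The conjugate `φ*(t) = sup_{s ≥ 0} (s t - φ(s))`; the supremum is finite under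
`IsRegularYoung`, where `φ` grows superlinearly. -/
def conj (φ : ℝ → ℝ) (t : ℝ) : ℝ := ⨆ s : Ici (0 : ℝ), ((s : ℝ) * t - φ s)

/-- `V(P) = √(φ'(|P|)/|P|) P`, which is `0` for `P = 0`. -/
def V {n : ℕ} (φ : ℝ → ℝ) (P : SymMat n) : SymMat n := √(d1 φ ‖P‖ / ‖P‖) • P

/-! ### The operator -/

/-- The assumptions on `A : Ω × SymMat → SymMat`: continuity in `x`, class `C⁰` in `P` and `C¹` in
`P ≠ 0`, and the ellipticity, growth and Lipschitz conditions governed by `φ`. -/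
structure IsOrliczOperator {n : ℕ} (Ω : Set (Pt n)) (φ : ℝ → ℝ) (ν L₁ L₂ K : ℝ)
    (A : Pt n → SymMat n → SymMat n) : Prop where
  cont_x : ∀ P, ContinuousOn (fun x => A x P) Ω
  cont_P : ∀ᵐ x ∂(volume.restrict Ω), Continuous (A x)
  contDiff_P : ∀ᵐ x ∂(volume.restrict Ω), ContDiffOn ℝ 1 (A x) {0}ᶜ
  elliptic : ∀ᵐ x ∂(volume.restrict Ω), ∀ P Q : SymMat n,
    ν * d2 φ (‖P‖ + ‖Q‖) * ‖P - Q‖ ^ 2 ≤ inner ℝ (A x P - A x Q) (P - Q)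
  lipschitz_P : ∀ᵐ x ∂(volume.restrict Ω), ∀ P Q : SymMat n,
    ‖A x P - A x Q‖ ≤ L₁ * d2 φ (‖P‖ + ‖Q‖) * ‖P - Q‖
  growth : ∀ᵐ x ∂(volume.restrict Ω), ∀ P : SymMat n, ‖A x P‖ ≤ L₂ * d1 φ ‖P‖
  lipschitz_x : ∀ᵐ x ∂(volume.restrict Ω), ∀ᵐ y ∂(volume.restrict Ω), ∀ P : SymMat n,
    ‖A x P - A y P‖ ≤ K * ‖x - y‖ * d1 φ ‖P‖

/-! ### Weak derivatives and function spaces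

A partial derivative of order `m` is indexed by a tuple `α : Fin m → Fin n` of directions, so that
the derivatives of order `m` of `v` are the entries of the tensor `D^m v`. -/

/-- Smooth functions with compact support in `U`. -/
def IsTest {n : ℕ} {F : Type*} [NormedAddCommGroup F] [NormedSpace ℝ F]
    (U : Set (Pt n)) (ψ : Pt n → F) : Prop :=
  ContDiff ℝ ∞ ψ ∧ HasCompactSupport ψ ∧ tsupport ψ ⊆ U

/-- The classical partial derivative `∂_{α 0} ⋯ ∂_{α (m-1)} ψ`. -/
def partialDeriv {n m : ℕ} (α : Fin m → Fin n) (ψ : Pt n → ℝ) (x : Pt n) : ℝ :=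
  iteratedFDeriv ℝ m ψ x (fun j => EuclideanSpace.single (α j) 1)

/-- `g` is a weak derivative of `v` in `U`, in the directions `α`. -/
def IsWeakDeriv {n m : ℕ} (U : Set (Pt n)) (α : Fin m → Fin n) (v g : Pt n → ℝ) : Prop :=
  LocallyIntegrableOn v U ∧ LocallyIntegrableOn g U ∧
    ∀ ψ : Pt n → ℝ, IsTest U ψ →
      ∫ x in U, v x * partialDeriv α ψ x = (-1) ^ m * ∫ x in U, g x * ψ x

open Classical in
/-- The weak derivative of `v` in `U` (unique up to null sets when it exists, and `0` otherwise). -/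
def weakDeriv {n m : ℕ} (U : Set (Pt n)) (α : Fin m → Fin n) (v : Pt n → ℝ) : Pt n → ℝ :=
  if h : ∃ g, IsWeakDeriv U α v g then h.choose else 0

/-- `v ∈ W^{k,2}(U)`, for vector-valued `v`. -/
def MemSobolev {n : ℕ} {ι : Type} [Fintype ι] (k : ℕ) (U : Set (Pt n))
    (v : Pt n → EuclideanSpace ℝ ι) : Prop :=
  ∀ p : ι, ∀ m ≤ k, ∀ α : Fin m → Fin n,
    ∃ g, IsWeakDeriv U α (fun x => v x p) g ∧ MemLp g 2 (volume.restrict U)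

/-- `v ∈ W^{k,2}_loc(U)`, for vector-valued `v`. -/
def MemSobolevLoc {n : ℕ} {ι : Type} [Fintype ι] (k : ℕ) (U : Set (Pt n))
    (v : Pt n → EuclideanSpace ℝ ι) : Prop :=
  ∀ p : ι, ∀ m ≤ k, ∀ α : Fin m → Fin n,
    ∃ g, IsWeakDeriv U α (fun x => v x p) g ∧
      ∀ C, IsCompact C → C ⊆ U → MemLp g 2 (volume.restrict C)

/-- `v ∈ W^{k,2}_0(U)`: the closure of the test functions in `W^{k,2}(U)`. -/
def MemSobolevZero {n : ℕ} {ι : Type} [Fintype ι] (k : ℕ) (U : Set (Pt n))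
    (v : Pt n → EuclideanSpace ℝ ι) : Prop :=
  MemSobolev k U v ∧ ∀ δ : ℝ, 0 < δ → ∃ ψ : Pt n → EuclideanSpace ℝ ι, IsTest U ψ ∧
    ∀ p : ι, ∀ m ≤ k, ∀ α : Fin m → Fin n,
      eLpNorm (fun x => weakDeriv U α (fun y => v y p) x - partialDeriv α (fun y => ψ y p) x) 2
        (volume.restrict U) ≤ ENNReal.ofReal δ

/-- `⟨D^m v, D^m w⟩` at the point `x`. -/
def derivInner {n : ℕ} {ι : Type} [Fintype ι] (U : Set (Pt n)) (m : ℕ)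
    (v w : Pt n → EuclideanSpace ℝ ι) (x : Pt n) : ℝ :=
  ∑ p : ι, ∑ α : Fin m → Fin n,
    weakDeriv U α (fun y => v y p) x * weakDeriv U α (fun y => w y p) x

/-- `|D^m v|²` at the point `x`. -/
def derivSq {n : ℕ} {ι : Type} [Fintype ι] (U : Set (Pt n)) (m : ℕ)
    (v : Pt n → EuclideanSpace ℝ ι) (x : Pt n) : ℝ := derivInner U m v v x

/-- The weak gradient `(Du)ᵢⱼ = ∂ⱼ uᵢ`. -/
def weakGrad {n : ℕ} (U : Set (Pt n)) (u : Pt n → Pt n) (x : Pt n) : Mat n :=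
  WithLp.toLp 2 fun p => weakDeriv U (fun _ : Fin 1 => p.2) (fun y => u y p.1) x

/-- The symmetric gradient `ℰu = (Du + (Du)ᵀ) / 2`. -/
def symGrad {n : ℕ} (U : Set (Pt n)) (u : Pt n → Pt n) (x : Pt n) : SymMat n :=
  ⟨WithLp.toLp 2 fun p => (weakGrad U u x (p.1, p.2) + weakGrad U u x (p.2, p.1)) / 2, by
    intro i j; simp [add_comm]⟩

/-- `g ∈ L^φ(U)`. -/
def MemOrlicz {n : ℕ} {F : Type*} [NormedAddCommGroup F] (φ : ℝ → ℝ) (U : Set (Pt n))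
    (g : Pt n → F) : Prop :=
  AEStronglyMeasurable g (volume.restrict U) ∧
    ∃ l : ℝ, 0 < l ∧ IntegrableOn (fun x => φ (‖g x‖ / l)) U

/-- `u` is weakly differentiable in `U`. -/
def WeaklyDifferentiable {n : ℕ} (U : Set (Pt n)) (u : Pt n → Pt n) : Prop :=
  ∀ i j : Fin n, ∃ g, IsWeakDeriv U (fun _ : Fin 1 => j) (fun x => u x i) g

/-- `u ∈ W^{1,φ}(U, ℝⁿ)`. -/
def MemOrliczSobolev {n : ℕ} (φ : ℝ → ℝ) (U : Set (Pt n)) (u : Pt n → Pt n) : Prop :=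
  WeaklyDifferentiable U u ∧ MemOrlicz φ U u ∧ MemOrlicz φ U (weakGrad U u)

/-- `u ∈ W^{1,φ}_loc(U, ℝⁿ)`. -/
def MemOrliczSobolevLoc {n : ℕ} (φ : ℝ → ℝ) (U : Set (Pt n)) (u : Pt n → Pt n) : Prop :=
  WeaklyDifferentiable U u ∧
    ∀ C, IsCompact C → C ⊆ U → MemOrlicz φ C u ∧ MemOrlicz φ C (weakGrad U u)

/-! ### Mollification and the approximating problem -/

/-- A mollification kernel: smooth, nonnegative, supported in the unit ball, of integral one. -/
structure IsMollifier {n : ℕ} (η : Pt n → ℝ) : Prop where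
  smooth : ContDiff ℝ ∞ η
  nonneg : ∀ x, 0 ≤ η x
  supp : ∀ x, 1 ≤ ‖x‖ → η x = 0
  integral : ∫ x, η x = 1

/-- `g_ε(x) = ∫_Ω ε⁻ⁿ η((x - y)/ε) g(y) dy`. -/
def mollify {n : ℕ} (η : Pt n → ℝ) (Ω : Set (Pt n)) (ε : ℝ) (g : Pt n → Pt n) (x : Pt n) : Pt n :=
  ∫ y in Ω, ((ε ^ n)⁻¹ * η (ε⁻¹ • (x - y))) • g y

/-- `w ∈ b + W^{k,2}_0(B)` solves
`τ ∫_B ⟨D^k w, D^k ψ⟩ = - ∫_B ⟨A(x, ℰw), ℰψ⟩ + ∫_B ⟨g, ψ⟩` for every `ψ ∈ W^{k,2}_0(B)`. -/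
structure IsApproxSolution {n : ℕ} (A : Pt n → SymMat n → SymMat n) (B : Set (Pt n)) (k : ℕ)
    (τ : ℝ) (b g w : Pt n → Pt n) : Prop where
  mem : MemSobolev k B w
  boundary : MemSobolevZero k B (fun x => w x - b x)
  equation : ∀ ψ : Pt n → Pt n, MemSobolevZero k B ψ →
    τ * ∫ x in B, derivInner B k w ψ x =
      -(∫ x in B, inner ℝ (A x (symGrad B w x)) (symGrad B ψ x)) + ∫ x in B, inner ℝ (g x) (ψ x)

end OrliczSym

end

open OrliczSym

/-! The equation is differentiated. With a cutoff η one tests, formally, with ∂ₛ(η^{2k} ∂ₛw), for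
every component and every direction s. Ellipticity turns the A-term into ν ∫ η^{2k} φ''(2|ℰw|)|Dℰw|²
up to errors, and |D(V(ℰw))|² is at most a constant times φ''(2|ℰw|)|Dℰw|² (`norm_V_sub_sq_le`,
`norm_fderiv_V_sq_le`). What remains is to make sense of the test function and to control the
errors.

Regularity. Since n < 2(k - 2), w has a C² representative (`exists_sup_bound`,
`SqWeakDerivs.exists_contDiffOn`). Hence ℰw is C¹, while A(x, ℰw) and V(ℰw) are Lipschitz on smaller
balls and differentiable almost everywhere. The formal test function involves too many derivatives
of w, so it is replaced by ∂ₛ(κ * (η^{2k} ∂ₛ(κ * w))) with an even kernel κ. Evenness moves the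
outer convolution onto w, and the term of order k becomes the one of a smooth function
(`energy_identity`). It is bounded below uniformly in κ, and the other terms converge as κ
concentrates (`exists_differentiated_inequality`).

The term of order k. Commuting D^k with η^{2k} produces lower derivatives of g = ∂ₛ(κ * w).
Interpolation with the weights L^{2j} η^{2j}, where L = r - ρ, reduces them to the leading term,
which is absorbed, and to L^{-2k} ∫ g² (`exists_energy_lower_bound`). Thus only |Dw|² is left, with
a constant depending on k.

The cutoff terms. A derivative of A multiplied by Dη^{2k} and ∂ₛw would lead to φ''(2|ℰw|)|Dw|²,
which φ(|Dw|) does not control in general, because |ℰw| may be much smaller than |Dw|. An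
integration by parts takes the derivative off A (`exists_summed_inequality`). Then |A| ≤ L₂
φ'(|ℰw|), second derivatives of w are combinations of first derivatives of ℰw, and φ'(t)² ≤ C
φ''(2t) φ(t) (`d1_sq_le`) permits absorption (`pointwise_estimate`). The squared first derivatives
and the second derivatives of η^{2k} cost k²/(r - ρ)² times constants free of k, so c does not
depend on k. The right-hand side is handled by the Young inequality for φ and its conjugate. -/

namespace OrliczSym

open Filter Topology

/-! ### Inequalities for φ, φ', φ'' and the conjugate function -/

section Young

variable {φ : ℝ → ℝ} {i s : ℝ}

theorem IsRegularYoung.d1_hasDerivWithinAt (h : IsRegularYoung φ i s) {t : ℝ} (ht : 0 ≤ t) :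
    HasDerivWithinAt φ (d1 φ t) (Ici 0) t :=
  ((h.smooth.differentiableOn (by norm_num)) t ht).hasDerivWithinAt

theorem IsRegularYoung.contDiffOn_d1 (h : IsRegularYoung φ i s) : ContDiffOn ℝ 1 (d1 φ) (Ici 0) :=
  h.smooth.derivWithin (uniqueDiffOn_Ici 0) (by norm_num)

theorem IsRegularYoung.continuousOn_d1 (h : IsRegularYoung φ i s) : ContinuousOn (d1 φ) (Ici 0) :=
  h.contDiffOn_d1.continuousOn

theorem IsRegularYoung.continuousOn_d2 (h : IsRegularYoung φ i s) : ContinuousOn (d2 φ) (Ici 0) :=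
  h.contDiffOn_d1.continuousOn_derivWithin (uniqueDiffOn_Ici 0) le_rfl

theorem IsRegularYoung.continuousOn (h : IsRegularYoung φ i s) : ContinuousOn φ (Ici 0) :=
  h.smooth.continuousOn

theorem IsRegularYoung.d2_hasDerivWithinAt (h : IsRegularYoung φ i s) {t : ℝ} (ht : 0 ≤ t) :
    HasDerivWithinAt (d1 φ) (d2 φ t) (Ici 0) t :=
  ((h.contDiffOn_d1.differentiableOn (by norm_num)) t ht).hasDerivWithinAt

theorem IsRegularYoung.d1_hasDerivAt (h : IsRegularYoung φ i s) {t : ℝ} (ht : 0 < t) :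
    HasDerivAt φ (d1 φ t) t :=
  (h.d1_hasDerivWithinAt ht.le).hasDerivAt (Ici_mem_nhds ht)

theorem IsRegularYoung.d2_hasDerivAt (h : IsRegularYoung φ i s) {t : ℝ} (ht : 0 < t) :
    HasDerivAt (d1 φ) (d2 φ t) t :=
  (h.d2_hasDerivWithinAt ht.le).hasDerivAt (Ici_mem_nhds ht)

theorem IsRegularYoung.monotoneOn_d1 (h : IsRegularYoung φ i s) : MonotoneOn (d1 φ) (Ici 0) :=
  h.young.convex.monotoneOn_derivWithin (fun _ ht => (h.d1_hasDerivWithinAt ht).differentiableWithinAt)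

theorem IsRegularYoung.d2_nonneg (h : IsRegularYoung φ i s) (t : ℝ) : 0 ≤ d2 φ t :=
  h.monotoneOn_d1.derivWithin_nonneg

theorem IsRegularYoung.d1_zero_nonneg (h : IsRegularYoung φ i s) : 0 ≤ d1 φ 0 := by
  have h0 := hasDerivWithinAt_iff_tendsto_slope.1 (h.d1_hasDerivWithinAt le_rfl)
  rw [Ici_sdiff_left] at h0
  refine ge_of_tendsto h0 ?_
  filter_upwards [self_mem_nhdsWithin] with t ht
  simp only [slope, vsub_eq_sub, sub_zero, smul_eq_mul, h.young.zero]
  exact mul_nonneg (inv_nonneg.2 (le_of_lt ht)) (h.young.nonneg t (le_of_lt ht))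

theorem IsRegularYoung.d1_nonneg (h : IsRegularYoung φ i s) {t : ℝ} (ht : 0 ≤ t) : 0 ≤ d1 φ t :=
  h.d1_zero_nonneg.trans (h.monotoneOn_d1 (mem_Ici.2 le_rfl) ht ht)

theorem IsRegularYoung.d1_pos (h : IsRegularYoung φ i s) {t : ℝ} (ht : 0 < t) : 0 < d1 φ t := by
  refine (h.d1_nonneg ht.le).lt_of_ne fun h0 => ?_
  have := h.lower.1 ⟨t, ht, rfl⟩
  simp only [← h0, div_zero, zero_add] at this
  linarith [h.one_lt]

theorem IsRegularYoung.i_le_s (h : IsRegularYoung φ i s) : i ≤ s :=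
  (h.lower.1 ⟨1, mem_Ioi.2 one_pos, rfl⟩).trans (h.upper.1 ⟨1, mem_Ioi.2 one_pos, rfl⟩)

theorem IsRegularYoung.mul_d1_le_of_pos (h : IsRegularYoung φ i s) {t : ℝ} (ht : 0 < t) :
    (i - 1) * d1 φ t ≤ t * d2 φ t := by
  have := h.lower.1 ⟨t, ht, rfl⟩
  rw [← le_div_iff₀ (h.d1_pos ht)]
  linarith

/-- Let t → 0⁺ in (i - 1) φ'(t) ≤ t φ''(t). As φ'' is continuous up to 0, the right side tends to 0.
-/
theorem IsRegularYoung.d1_zero (h : IsRegularYoung φ i s) : d1 φ 0 = 0 := by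
  have c1 : Tendsto (fun t => (i - 1) * d1 φ t) (𝓝[>] 0) (𝓝 ((i - 1) * d1 φ 0)) :=
    (((h.continuousOn_d1 0 (mem_Ici.2 le_rfl)).mono_left
      (nhdsWithin_mono _ Ioi_subset_Ici_self))).const_mul _
  have c2 : Tendsto (fun t => t * d2 φ t) (𝓝[>] 0) (𝓝 (0 * d2 φ 0)) :=
    (tendsto_id.mono_left nhdsWithin_le_nhds).mul ((h.continuousOn_d2 0 (mem_Ici.2 le_rfl)).mono_left
      (nhdsWithin_mono _ Ioi_subset_Ici_self))
  have := le_of_tendsto_of_tendsto c1 c2 (by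
    filter_upwards [self_mem_nhdsWithin] with t ht using h.mul_d1_le_of_pos ht)
  have h1 := h.one_lt
  have h2 := h.d1_zero_nonneg
  nlinarith

theorem IsRegularYoung.mul_d1_le (h : IsRegularYoung φ i s) {t : ℝ} (ht : 0 ≤ t) :
    (i - 1) * d1 φ t ≤ t * d2 φ t := by
  rcases ht.eq_or_lt with rfl | ht
  · simp [h.d1_zero]
  · exact h.mul_d1_le_of_pos ht

theorem IsRegularYoung.mul_d2_le (h : IsRegularYoung φ i s) {t : ℝ} (ht : 0 ≤ t) :
    t * d2 φ t ≤ (s - 1) * d1 φ t := by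
  rcases ht.eq_or_lt with rfl | ht
  · simp [h.d1_zero]
  · have := h.upper.1 ⟨t, ht, rfl⟩
    rw [← div_le_iff₀ (h.d1_pos ht)]
    linarith

theorem IsRegularYoung.monotoneOn (h : IsRegularYoung φ i s) : MonotoneOn φ (Ici 0) := by
  refine monotoneOn_of_deriv_nonneg (convex_Ici 0) h.continuousOn ?_ ?_ <;> rw [interior_Ici]
  · exact fun t ht => (h.d1_hasDerivAt ht).differentiableAt.differentiableWithinAt
  · intro t ht
    rw [(h.d1_hasDerivAt ht).deriv]
    exact h.d1_nonneg (le_of_lt ht)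

/-- The function s φ(t) - t φ'(t) vanishes at 0 and has derivative (s - 1) φ' - t φ'' ≥ 0. -/
theorem IsRegularYoung.mul_d1_le_self (h : IsRegularYoung φ i s) {t : ℝ} (ht : 0 ≤ t) :
    t * d1 φ t ≤ s * φ t := by
  have hm : MonotoneOn (fun t => s * φ t - t * d1 φ t) (Ici 0) := by
    refine monotoneOn_of_deriv_nonneg (convex_Ici 0)
      ((h.continuousOn.const_smul s).sub (continuousOn_id.mul h.continuousOn_d1)) ?_ ?_ <;>
      rw [interior_Ici]
    · exact fun t ht => (((h.d1_hasDerivAt ht).const_mul s).sub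
        ((hasDerivAt_id t).mul (h.d2_hasDerivAt ht))).differentiableAt.differentiableWithinAt
    · intro t ht
      have := (((h.d1_hasDerivAt ht).const_mul s).sub
        ((hasDerivAt_id t).mul (h.d2_hasDerivAt ht))).deriv
      erw [this]
      have := h.mul_d2_le (le_of_lt ht)
      simp only [id]
      linarith
  have := hm (mem_Ici.2 le_rfl) ht ht
  simp only [h.young.zero, zero_mul, mul_zero, sub_zero] at this
  linarith

/-- Combines (i - 1) φ'(2t) ≤ 2t φ''(2t) with t φ'(t) ≤ s φ(t). It allows a product φ'(|ℰw|)|Dℰw| to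
be split into the coercive quantity φ''(2|ℰw|)|Dℰw|² and a multiple of φ. The argument 2t is the
limit of |P| + |Q| when P and Q both tend to ℰw. -/
theorem IsRegularYoung.d1_sq_le (h : IsRegularYoung φ i s) {t : ℝ} (ht : 0 ≤ t) :
    d1 φ t ^ 2 ≤ 2 * s / (i - 1) * (d2 φ (2 * t) * φ t) := by
  have hi := h.one_lt
  rcases ht.eq_or_lt with rfl | ht
  · simp [h.d1_zero, h.young.zero]
  · have h1 := h.mul_d1_le (t := 2 * t) (by positivity)
    have h2 := h.mul_d1_le_self ht.le
    have h3 : d1 φ t ≤ d1 φ (2 * t) :=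
      h.monotoneOn_d1 (mem_Ici.2 ht.le) (mem_Ici.2 (by positivity)) (by linarith)
    have h4 := h.d1_pos ht
    rw [div_mul_eq_mul_div, le_div_iff₀ (by linarith)]
    have h5 : (i - 1) * d1 φ t ≤ 2 * t * d2 φ (2 * t) := by nlinarith
    have h6 : (i - 1) * d1 φ t * (t * d1 φ t) ≤ 2 * t * d2 φ (2 * t) * (s * φ t) := by
      have := h.d2_nonneg (2 * t)
      gcongr
    have : t * (d1 φ t ^ 2 * (i - 1)) ≤ t * (2 * s * (d2 φ (2 * t) * φ t)) := by linarith
    exact le_of_mul_le_mul_left this ht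

/-- For t ≥ 1 one has φ''(t) ≥ (i - 1) φ'(1) / t, so φ' grows at least like a multiple of the
logarithm. This superlinear growth of φ makes the conjugate finite. -/
theorem IsRegularYoung.exists_le_d1 (h : IsRegularYoung φ i s) (a : ℝ) : ∃ T, 0 < T ∧ a ≤ d1 φ T := by
  have hi := h.one_lt
  have h1 := h.d1_pos one_pos
  set b := (i - 1) * d1 φ 1 with hb
  have hbpos : 0 < b := mul_pos (by linarith) h1
  have hm : MonotoneOn (fun t => d1 φ t - b * Real.log t) (Ici 1) := by
    refine monotoneOn_of_deriv_nonneg (convex_Ici 1) ?_ ?_ ?_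
    · refine (h.continuousOn_d1.mono (Ici_subset_Ici.2 zero_le_one)).sub
        (continuousOn_const.mul (Real.continuousOn_log.mono ?_))
      intro t ht
      simp only [mem_Ici] at ht
      simp only [mem_compl_iff, mem_singleton_iff]
      linarith
    all_goals rw [interior_Ici]
    · intro t ht
      have ht0 : 0 < t := one_pos.trans ht
      exact ((h.d2_hasDerivAt ht0).sub
        ((Real.hasDerivAt_log ht0.ne').const_mul b)).differentiableAt.differentiableWithinAt
    · intro t ht
      have ht0 : 0 < t := one_pos.trans ht
      have := ((h.d2_hasDerivAt ht0).sub ((Real.hasDerivAt_log ht0.ne').const_mul b)).deriv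
      erw [this]
      have h3 := h.mul_d1_le ht0.le
      have h4 : d1 φ 1 ≤ d1 φ t :=
        h.monotoneOn_d1 (mem_Ici.2 zero_le_one) (mem_Ici.2 ht0.le) (le_of_lt ht)
      rw [sub_nonneg, ← div_eq_mul_inv, div_le_iff₀ ht0]
      nlinarith
  refine ⟨max 1 (Real.exp (a / b)), by positivity, ?_⟩
  have := hm (mem_Ici.2 le_rfl) (mem_Ici.2 (le_max_left 1 (Real.exp (a / b)))) (le_max_left _ _)
  simp only [Real.log_one, mul_zero, sub_zero] at this
  have h5 : a / b ≤ Real.log (max 1 (Real.exp (a / b))) := by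
    rw [Real.le_log_iff_exp_le (by positivity)]; exact le_max_right _ _
  have h6 : b * (a / b) = a := by field_simp
  nlinarith

theorem IsRegularYoung.tangent_le (h : IsRegularYoung φ i s) {T t : ℝ} (hT : 0 < T) (ht : 0 ≤ t) :
    φ T + d1 φ T * (t - T) ≤ φ t := by
  rcases lt_trichotomy t T with hlt | rfl | hlt
  · have := h.young.convex.slope_le_of_hasDerivAt (mem_Ici.2 ht) (mem_Ici.2 hT.le) hlt (h.d1_hasDerivAt hT)
    rw [slope_def_field, div_le_iff₀ (by linarith)] at this
    linarith
  · simp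
  · have := h.young.convex.le_slope_of_hasDerivAt (mem_Ici.2 hT.le) (mem_Ici.2 ht) hlt (h.d1_hasDerivAt hT)
    rw [slope_def_field, le_div_iff₀ (by linarith)] at this
    linarith

/-- The tangent of φ at a point T with φ'(T) ≥ t lies below φ and has slope at least t, so every
competitor is at most T φ'(T). -/
theorem IsRegularYoung.bddAbove_conj (h : IsRegularYoung φ i s) (t : ℝ) :
    BddAbove (range fun r : Ici (0 : ℝ) => (r : ℝ) * t - φ r) := by
  obtain ⟨T, hT, hle⟩ := h.exists_le_d1 t
  refine ⟨T * d1 φ T, ?_⟩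
  rintro _ ⟨⟨r, hr⟩, rfl⟩
  simp only [mem_Ici] at hr
  have h1 := h.tangent_le hT hr
  have h2 := h.young.nonneg T hT.le
  dsimp only
  nlinarith

theorem IsRegularYoung.monotone_conj (h : IsRegularYoung φ i s) : Monotone (conj φ) := by
  intro a b hab
  refine ciSup_mono (h.bddAbove_conj b) fun r => ?_
  have := mul_le_mul_of_nonneg_left hab r.2
  linarith

theorem IsRegularYoung.conj_nonneg (h : IsRegularYoung φ i s) (t : ℝ) : 0 ≤ conj φ t := by
  have := le_ciSup (h.bddAbove_conj t) ⟨0, mem_Ici.2 le_rfl⟩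
  dsimp only at this
  rw [h.young.zero, zero_mul, sub_zero] at this
  exact this

theorem IsRegularYoung.mul_le_conj_add (h : IsRegularYoung φ i s) (a : ℝ) {b : ℝ} (hb : 0 ≤ b) :
    a * b ≤ conj φ a + φ b := by
  have := le_ciSup (h.bddAbove_conj a) ⟨b, hb⟩
  unfold conj
  dsimp only at this
  linarith

end Young

/-! ### Lipschitz estimate for V in terms of φ'' -/

section VMap

variable {φ : ℝ → ℝ} {i s : ℝ} {n : ℕ}

/-- All arguments are comparable: ξ ≤ p + q ≤ 2p ≤ 4ξ. Monotonicity of φ' and the lower index bound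
do the rest. -/
theorem IsRegularYoung.d1_div_le (h : IsRegularYoung φ i s) {p q ξ : ℝ} (hξ : 0 < ξ) (hp : p ≤ 2 * ξ)
    (hp0 : 0 < p) (hξp : ξ ≤ p) (hq : 0 ≤ q) (hqp : q ≤ p) :
    d1 φ ξ / ξ ≤ 4 / (i - 1) * d2 φ (p + q) := by
  have hi := h.one_lt
  have h1 := h.mul_d1_le (t := p + q) (by positivity)
  have h2 : d1 φ ξ ≤ d1 φ (p + q) :=
    h.monotoneOn_d1 (mem_Ici.2 hξ.le) (mem_Ici.2 (by positivity)) (by linarith)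
  have h3 := h.d2_nonneg (p + q)
  rw [div_le_iff₀ hξ, div_mul_eq_mul_div, div_mul_eq_mul_div, le_div_iff₀ (by linarith)]
  have : (p + q) * d2 φ (p + q) ≤ 4 * ξ * d2 φ (p + q) :=
    mul_le_mul_of_nonneg_right (by linarith) h3
  nlinarith

theorem norm_V (φ : ℝ → ℝ) (P : SymMat n) : ‖V φ P‖ = √(d1 φ ‖P‖ / ‖P‖) * ‖P‖ := by
  rw [V, norm_smul, Real.norm_of_nonneg (Real.sqrt_nonneg _)]

/-- The scalar factor of `V` has derivative at most a multiple of itself over `t`. -/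
theorem IsRegularYoung.sqrt_hasDerivAt (h : IsRegularYoung φ i s) {t : ℝ} (ht : 0 < t) :
    ∃ D, HasDerivAt (fun t => √(d1 φ t / t)) D t ∧ |D| ≤ s * √(d1 φ t / t) / t := by
  have hd := h.d1_pos ht
  have hq : 0 < d1 φ t / t := by positivity
  have h1 := ((h.d2_hasDerivAt ht).div (hasDerivAt_id t) ht.ne').sqrt hq.ne'
  refine ⟨_, h1, ?_⟩
  have hs := Real.sqrt_pos.2 hq
  have hi := h.one_lt
  have his := h.i_le_s
  simp only [Pi.div_apply, id]
  rw [abs_div, abs_of_pos (by positivity : 0 < 2 * √(d1 φ t / t)), div_le_div_iff₀ (by positivity) ht]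
  have e : s * √(d1 φ t / t) * (2 * √(d1 φ t / t)) = 2 * s * (d1 φ t / t) := by
    rw [show s * √(d1 φ t / t) * (2 * √(d1 φ t / t)) = 2 * s * (√(d1 φ t / t) * √(d1 φ t / t)) by ring,
      Real.mul_self_sqrt hq.le]
  rw [e]
  have h2 := h.mul_d2_le ht.le
  have h3 := h.mul_d1_le ht.le
  have h4 : |d2 φ t * t - d1 φ t * 1| ≤ 2 * s * d1 φ t := by
    rw [abs_le]; constructor <;> nlinarith
  calc |(d2 φ t * t - d1 φ t * 1) / t ^ 2| * t = |d2 φ t * t - d1 φ t * 1| / t := by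
        rw [abs_div, abs_of_pos (by positivity : 0 < t ^ 2)]; field_simp
    _ ≤ 2 * s * d1 φ t / t := by gcongr
    _ = _ := by ring

/-- Write V(P) = g(|P|) P with g(t) = √(φ'(t)/t), and let |Q| ≤ |P|. If |Q| ≤ |P|/2, then |P| ≤ 2|P
- Q| and V(P), V(Q) are estimated separately. Otherwise the mean value inequality is applied to g on
[|Q|, |P|], where |g'| ≤ s g / t and g is bounded by the single number G, whose square is a multiple
of φ''(|P| + |Q|). -/
theorem IsRegularYoung.norm_V_sub_sq_le (h : IsRegularYoung φ i s) (P Q : SymMat n) :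
    ‖V φ P - V φ Q‖ ^ 2 ≤ 64 * (1 + s) ^ 2 / (i - 1) * (d2 φ (‖P‖ + ‖Q‖) * ‖P - Q‖ ^ 2) := by
  wlog hPQ : ‖Q‖ ≤ ‖P‖ generalizing P Q
  · rw [norm_sub_rev, norm_sub_rev P, add_comm ‖P‖]
    exact this Q P (le_of_not_ge hPQ)
  have hi := h.one_lt
  have his := h.i_le_s
  have hd2 := h.d2_nonneg (‖P‖ + ‖Q‖)
  set g : ℝ → ℝ := fun t => √(d1 φ t / t) with hg
  have hg0 : ∀ t, 0 ≤ g t := fun t => Real.sqrt_nonneg _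
  have hgsq : ∀ t, 0 < t → g t ^ 2 = d1 φ t / t := fun t ht =>
    Real.sq_sqrt (div_nonneg (h.d1_nonneg ht.le) ht.le)
  rcases (norm_nonneg P).eq_or_lt with hP0 | hP0
  · have hQ0 : ‖Q‖ = 0 := le_antisymm (hPQ.trans hP0.symm.le) (norm_nonneg _)
    rw [norm_eq_zero.1 hP0.symm, norm_eq_zero.1 hQ0]
    simp
  set G := √(4 / (i - 1) * d2 φ (‖P‖ + ‖Q‖)) with hG
  have hGsq : G ^ 2 = 4 / (i - 1) * d2 φ (‖P‖ + ‖Q‖) :=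
    Real.sq_sqrt (mul_nonneg (div_nonneg (by norm_num) (by linarith)) hd2)
  have hG0 : 0 ≤ G := Real.sqrt_nonneg _
  have hgG : ∀ ξ, 0 < ξ → ‖P‖ ≤ 2 * ξ → ξ ≤ ‖P‖ → g ξ ≤ G := fun ξ h1 h2 h3 =>
    Real.sqrt_le_sqrt (h.d1_div_le h1 h2 hP0 h3 (norm_nonneg Q) hPQ)
  suffices hmain : ‖V φ P - V φ Q‖ ≤ 4 * (1 + s) * G * ‖P - Q‖ by
    calc ‖V φ P - V φ Q‖ ^ 2 ≤ (4 * (1 + s) * G * ‖P - Q‖) ^ 2 := by gcongr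
      _ = 16 * (1 + s) ^ 2 * G ^ 2 * ‖P - Q‖ ^ 2 := by ring
      _ = _ := by rw [hGsq]; ring
  have hgP := hgG ‖P‖ hP0 (by linarith) le_rfl
  by_cases hq : ‖Q‖ ≤ ‖P‖ / 2
  · have h1 : ‖P‖ / 2 ≤ ‖P - Q‖ := by
      have := norm_sub_norm_le P Q
      linarith
    have h2 : ‖V φ P‖ ≤ G * ‖P‖ := by
      rw [norm_V]; exact mul_le_mul_of_nonneg_right hgP hP0.le
    have h3 : ‖V φ Q‖ ≤ G * ‖P‖ := by
      rcases (norm_nonneg Q).eq_or_lt with hQ0 | hQ0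
      · rw [norm_V, ← hQ0]; simp; positivity
      rw [norm_V]
      -- The function g(t) t = √(t φ'(t)) is increasing; squares are compared.
      refine le_trans ?_ (mul_le_mul_of_nonneg_right hgP hP0.le)
      rw [← abs_of_nonneg (mul_nonneg (hg0 ‖Q‖) hQ0.le), ← abs_of_nonneg (mul_nonneg (hg0 ‖P‖) hP0.le),
        ← sq_le_sq, mul_pow, mul_pow, hgsq _ hQ0, hgsq _ hP0]
      have h4 : d1 φ ‖Q‖ ≤ d1 φ ‖P‖ := h.monotoneOn_d1 (mem_Ici.2 hQ0.le) (mem_Ici.2 hP0.le) hPQ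
      have h5 := h.d1_nonneg hQ0.le
      have h6 := h.d1_nonneg hP0.le
      rw [div_mul_eq_mul_div, div_mul_eq_mul_div, pow_two, pow_two, ← mul_assoc, ← mul_assoc,
        mul_div_assoc, mul_div_assoc, div_self hQ0.ne', div_self hP0.ne', mul_one, mul_one]
      gcongr
    calc ‖V φ P - V φ Q‖ ≤ ‖V φ P‖ + ‖V φ Q‖ := norm_sub_le _ _
      _ ≤ 2 * G * ‖P‖ := by linarith
      _ ≤ 2 * G * (2 * ‖P - Q‖) := by gcongr; linarith
      _ = 4 * 1 * G * ‖P - Q‖ := by ring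
      _ ≤ 4 * (1 + s) * G * ‖P - Q‖ := by gcongr; linarith
  · push Not at hq
    have hQ0 : 0 < ‖Q‖ := lt_trans (by positivity) hq
    have hmv : |g ‖P‖ - g ‖Q‖| ≤ s * G / ‖Q‖ * |‖P‖ - ‖Q‖| := by
      have := (convex_Icc ‖Q‖ ‖P‖).norm_image_sub_le_of_norm_deriv_le (f := g)
        (C := s * G / ‖Q‖) (x := ‖Q‖) (y := ‖P‖) ?_ ?_ (left_mem_Icc.2 hPQ) (right_mem_Icc.2 hPQ)
      · simpa only [Real.norm_eq_abs] using this
      · intro ξ hξ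
        obtain ⟨D, hD, -⟩ := h.sqrt_hasDerivAt (hQ0.trans_le hξ.1)
        exact hD.differentiableAt
      · intro ξ hξ
        have hξ0 := hQ0.trans_le hξ.1
        obtain ⟨D, hD, hle⟩ := h.sqrt_hasDerivAt hξ0
        rw [hD.deriv, Real.norm_eq_abs]
        refine hle.trans ?_
        have := hgG ξ hξ0 (by linarith [hξ.1]) hξ.2
        have hs0 : 0 ≤ s := by linarith
        have h7 : s * √(d1 φ ξ / ξ) ≤ s * G := mul_le_mul_of_nonneg_left this hs0
        gcongr
        exact hξ.1
    have e : V φ P - V φ Q = g ‖P‖ • (P - Q) + (g ‖P‖ - g ‖Q‖) • Q := by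
      simp only [V, hg]
      rw [smul_sub, sub_smul]; abel
    rw [e]
    calc ‖g ‖P‖ • (P - Q) + (g ‖P‖ - g ‖Q‖) • Q‖ ≤ g ‖P‖ * ‖P - Q‖ + |g ‖P‖ - g ‖Q‖| * ‖Q‖ := by
          refine (norm_add_le _ _).trans_eq ?_
          rw [norm_smul, norm_smul, Real.norm_of_nonneg (hg0 _), Real.norm_eq_abs]
      _ ≤ G * ‖P - Q‖ + s * G / ‖Q‖ * |‖P‖ - ‖Q‖| * ‖Q‖ := by gcongr
      _ = G * ‖P - Q‖ + s * G * |‖P‖ - ‖Q‖| := by field_simp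
      _ ≤ G * ‖P - Q‖ + s * G * ‖P - Q‖ := by
          gcongr
          · exact mul_nonneg (by linarith) hG0
          · exact abs_norm_sub_norm_le P Q
      _ = 1 * ((1 + s) * G * ‖P - Q‖) := by ring
      _ ≤ 4 * ((1 + s) * G * ‖P - Q‖) := by
          gcongr
          · exact mul_nonneg (mul_nonneg (by linarith) hG0) (norm_nonneg _)
          · norm_num
      _ = _ := by ring

end VMap

end OrliczSym

namespace OrliczSym

open Filter Topology

/-! ### Iterated partial derivatives of smooth functions -/

section PartialDerivatives

variable {n m : ℕ}

/-- The directional derivative in the `j`-th coordinate direction. -/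
noncomputable def pd (j : Fin n) (f : Pt n → ℝ) (x : Pt n) : ℝ :=
  fderiv ℝ f x (EuclideanSpace.single j 1)

theorem contDiff_pd {f : Pt n → ℝ} (hf : ContDiff ℝ ∞ f) (j : Fin n) : ContDiff ℝ ∞ (pd j f) :=
  (hf.fderiv_right (m := ∞) (by simp)).clm_apply contDiff_const

theorem contDiff_partialDeriv {f : Pt n → ℝ} (hf : ContDiff ℝ ∞ f) (α : Fin m → Fin n) :
    ContDiff ℝ ∞ (partialDeriv α f) := by
  have h := hf.iteratedFDeriv_right (m := ∞) (i := m) (by exact_mod_cast (le_top : (⊤ : ℕ∞) + m ≤ ⊤))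
  exact (ContinuousMultilinearMap.apply ℝ (fun _ : Fin m => Pt n) ℝ
    (fun j => EuclideanSpace.single (α j) 1)).contDiff.comp h

theorem partialDeriv_zero (α : Fin 0 → Fin n) (f : Pt n → ℝ) : partialDeriv α f = f := by
  ext x; simp [partialDeriv]

theorem partialDeriv_succ {f : Pt n → ℝ} (hf : ContDiff ℝ ∞ f) (α : Fin (m + 1) → Fin n) :
    partialDeriv α f = pd (α 0) (partialDeriv (Fin.tail α) f) := by
  ext x
  have h : DifferentiableAt ℝ (iteratedFDeriv ℝ m f) x :=
    (hf.differentiable_iteratedFDeriv (by exact_mod_cast ENat.natCast_lt_top m)) x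
  have h2 := ((ContinuousMultilinearMap.apply ℝ (fun _ : Fin m => Pt n) ℝ
    (fun j => EuclideanSpace.single (Fin.tail α j) 1)).hasFDerivAt.comp x h.hasFDerivAt).fderiv
  have h3 : fderiv ℝ (partialDeriv (Fin.tail α) f) x = _ := h2
  rw [pd, h3, partialDeriv, iteratedFDeriv_succ_apply_left]
  rfl

theorem partialDeriv_cons {f : Pt n → ℝ} (hf : ContDiff ℝ ∞ f) (j : Fin n) (α : Fin m → Fin n) :
    partialDeriv (Fin.cons j α : Fin (m + 1) → Fin n) f = pd j (partialDeriv α f) := by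
  rw [partialDeriv_succ hf]; simp

theorem partialDeriv_one {f : Pt n → ℝ} (hf : ContDiff ℝ ∞ f) (α : Fin 1 → Fin n) :
    partialDeriv α f = pd (α 0) f := by
  rw [partialDeriv_succ hf, partialDeriv_zero]

theorem pd_comm {f : Pt n → ℝ} {x : Pt n} (hf : ContDiffAt ℝ 2 f x) (i j : Fin n) :
    pd i (pd j f) x = pd j (pd i f) x := by
  have h : DifferentiableAt ℝ (fderiv ℝ f) x :=
    (hf.fderiv_right (m := 1) (by norm_num)).differentiableAt (by norm_num)
  have h2 : ∀ a b : Fin n, pd a (pd b f) x =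
      fderiv ℝ (fderiv ℝ f) x (EuclideanSpace.single a 1) (EuclideanSpace.single b 1) := by
    intro a b
    have := (h.hasFDerivAt.clm_apply (hasFDerivAt_const (EuclideanSpace.single b (1 : ℝ)) x)).fderiv
    unfold pd
    rw [this]; simp
  rw [h2, h2]
  exact hf.isSymmSndFDerivAt (by simp) _ _

theorem pd_comm' {f : Pt n → ℝ} (hf : ContDiff ℝ ∞ f) (i j : Fin n) :
    pd i (pd j f) = pd j (pd i f) :=
  funext fun _ => pd_comm (contDiff_infty.1 hf 2).contDiffAt i j

theorem partialDeriv_pd {f : Pt n → ℝ} (hf : ContDiff ℝ ∞ f) (α : Fin m → Fin n) (j : Fin n) :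
    partialDeriv α (pd j f) = pd j (partialDeriv α f) := by
  induction m with
  | zero => simp [partialDeriv_zero]
  | succ m ih =>
    rw [partialDeriv_succ (contDiff_pd hf j), ih, partialDeriv_succ hf,
      pd_comm' (contDiff_partialDeriv hf _)]

theorem tsupport_pd_subset (j : Fin n) (f : Pt n → ℝ) : tsupport (pd j f) ⊆ tsupport f :=
  tsupport_fderiv_apply_subset ℝ _

theorem tsupport_partialDeriv_subset (α : Fin m → Fin n) (f : Pt n → ℝ) :
    tsupport (partialDeriv α f) ⊆ tsupport f := by
  refine Subset.trans ?_ (tsupport_iteratedFDeriv_subset (𝕜 := ℝ) (f := f) m)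
  refine closure_mono fun x hx => ?_
  simp only [Function.mem_support, partialDeriv] at hx ⊢
  intro h
  exact hx (by rw [h]; rfl)

theorem isTest_pd {U : Set (Pt n)} {f : Pt n → ℝ} (hf : IsTest U f) (j : Fin n) :
    IsTest U (pd j f) :=
  ⟨contDiff_pd hf.1 j, hf.2.1.of_isClosed_subset (isClosed_tsupport _) (tsupport_pd_subset j f),
    (tsupport_pd_subset j f).trans hf.2.2⟩

theorem isTest_partialDeriv {U : Set (Pt n)} {f : Pt n → ℝ} (hf : IsTest U f) (α : Fin m → Fin n) :
    IsTest U (partialDeriv α f) :=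
  ⟨contDiff_partialDeriv hf.1 α,
    hf.2.1.of_isClosed_subset (isClosed_tsupport _) (tsupport_partialDeriv_subset α f),
    (tsupport_partialDeriv_subset α f).trans hf.2.2⟩

theorem pd_mul {f g : Pt n → ℝ} {x : Pt n} (hf : DifferentiableAt ℝ f x)
    (hg : DifferentiableAt ℝ g x) (j : Fin n) :
    pd j (fun y => f y * g y) x = f x * pd j g x + pd j f x * g x := by
  unfold pd
  rw [fderiv_fun_mul hf hg]
  simp [mul_comm]

/-- Integration by parts in one direction. -/
theorem integral_mul_pd {f g : Pt n → ℝ} (hf : ContDiff ℝ 1 f) (hg : ContDiff ℝ 1 g)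
    (hgc : HasCompactSupport g) (j : Fin n) :
    ∫ x, f x * pd j g x = - ∫ x, pd j f x * g x := by
  have cf := hf.continuous
  have cg := hg.continuous
  have cf' : Continuous (pd j f) := (hf.continuous_fderiv (by norm_num)).clm_apply continuous_const
  have cg' : Continuous (pd j g) := (hg.continuous_fderiv (by norm_num)).clm_apply continuous_const
  have hgc' : HasCompactSupport (pd j g) :=
    hgc.of_isClosed_subset (isClosed_tsupport _) (tsupport_pd_subset j g)
  exact integral_mul_fderiv_eq_neg_fderiv_mul_of_integrable
    ((cf'.mul cg).integrable_of_hasCompactSupport hgc.mul_left)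
    ((cf.mul cg').integrable_of_hasCompactSupport hgc'.mul_left)
    ((cf.mul cg).integrable_of_hasCompactSupport hgc.mul_left)
    (fun x _ => (hf.differentiable (by norm_num)) x) (fun x _ => (hg.differentiable (by norm_num)) x)

theorem integral_mul_partialDeriv {f g : Pt n → ℝ} (hf : ContDiff ℝ ∞ f) (hg : ContDiff ℝ ∞ g)
    (hgc : HasCompactSupport g) (α : Fin m → Fin n) :
    ∫ x, f x * partialDeriv α g x = (-1) ^ m * ∫ x, partialDeriv α f x * g x := by
  induction m generalizing f with
  | zero => simp [partialDeriv_zero]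
  | succ m ih =>
    have ht : IsTest univ g := ⟨hg, hgc, subset_univ _⟩
    rw [partialDeriv_succ hg, integral_mul_pd (contDiff_infty.1 hf 1)
      (contDiff_infty.1 (contDiff_partialDeriv hg _) 1) (isTest_partialDeriv ht _).2.1, ih (contDiff_pd hf _),
      partialDeriv_pd hf, ← partialDeriv_succ hf]
    ring

theorem sum_fin_succ_fun {M : Type*} [AddCommMonoid M] (F : (Fin (m + 1) → Fin n) → M) :
    ∑ α, F α = ∑ j, ∑ β : Fin m → Fin n, F (Fin.cons j β) := by
  rw [← (Fin.consEquiv fun _ => Fin n).sum_comp, Fintype.sum_prod_type]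
  rfl

end PartialDerivatives

/-! ### Weak derivatives: uniqueness, null sets, composition -/

section WeakDerivatives

variable {n m : ℕ} {U : Set (Pt n)}

/-- The fundamental lemma of the calculus of variations. It identifies the chosen `weakDeriv` with
any weak derivative that is known explicitly. -/
theorem IsWeakDeriv.unique (hU : IsOpen U) {α : Fin m → Fin n} {v g g' : Pt n → ℝ}
    (h : IsWeakDeriv U α v g) (h' : IsWeakDeriv U α v g') : g =ᵐ[volume.restrict U] g' := by
  have key := hU.ae_eq_zero_of_integral_contDiff_smul_eq_zero (h.2.1.sub h'.2.1)
    (μ := volume) ?_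
  · rw [Filter.EventuallyEq, ae_restrict_iff' hU.measurableSet]
    filter_upwards [key] with x hx hxU
    exact sub_eq_zero.1 (hx hxU)
  · intro ψ h1 h2 h3
    have hi : ∀ {f : Pt n → ℝ}, LocallyIntegrableOn f U → IntegrableOn (fun x => f x * ψ x) U := by
      intro f hf
      have h4 := (hf.integrableOn_compact_subset h3 h2.isCompact).mul_continuousOn
        h1.continuous.continuousOn h2.isCompact
      refine (integrableOn_iff_integrable_of_support_subset ?_ |>.1 h4).integrableOn
      intro x hx
      exact subset_tsupport _ (right_ne_zero_of_mul hx)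
    have e1 := h.2.2 ψ ⟨h1, h2, h3⟩
    have e2 := h'.2.2 ψ ⟨h1, h2, h3⟩
    have e3 : ∫ x in U, g x * ψ x = ∫ x in U, g' x * ψ x := by
      have : ((-1 : ℝ) ^ m) ≠ 0 := by positivity
      exact mul_left_cancel₀ this (e1.symm.trans e2)
    have e4 : ∫ x, ψ x • (g - g') x = ∫ x in U, ψ x • (g - g') x := by
      symm
      apply setIntegral_eq_integral_of_forall_compl_eq_zero
      intro x hx
      rw [image_eq_zero_of_notMem_tsupport (fun h => hx (h3 h)), zero_smul]
    rw [e4]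
    have : ∀ x, ψ x • (g - g') x = g x * ψ x - g' x * ψ x := fun x => by
      simp only [smul_eq_mul, Pi.sub_apply]; ring
    simp_rw [this]
    rw [integral_sub (hi h.2.1) (hi h'.2.1), e3, sub_self]

theorem isWeakDeriv_weakDeriv {α : Fin m → Fin n} {v g : Pt n → ℝ} (h : IsWeakDeriv U α v g) :
    IsWeakDeriv U α v (weakDeriv U α v) := by
  have : ∃ g, IsWeakDeriv U α v g := ⟨g, h⟩
  rw [weakDeriv, dif_pos this]
  exact this.choose_spec

theorem IsWeakDeriv.ae_eq (hU : IsOpen U) {α : Fin m → Fin n} {v g : Pt n → ℝ}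
    (h : IsWeakDeriv U α v g) : weakDeriv U α v =ᵐ[volume.restrict U] g :=
  (isWeakDeriv_weakDeriv h).unique hU h

theorem LocallyIntegrableOn.congr_ae_open (hU : IsOpen U) {f g : Pt n → ℝ}
    (hf : LocallyIntegrableOn f U) (h : f =ᵐ[volume.restrict U] g) : LocallyIntegrableOn g U := by
  rw [locallyIntegrableOn_iff hU.isLocallyClosed] at hf ⊢
  intro k hk hkc
  exact (hf k hk hkc).congr_fun_ae (ae_restrict_of_ae_restrict_of_subset hk h)

theorem IsWeakDeriv.congr (hU : IsOpen U) {α : Fin m → Fin n} {v v' g g' : Pt n → ℝ}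
    (h : IsWeakDeriv U α v g) (hv : v =ᵐ[volume.restrict U] v')
    (hg : g =ᵐ[volume.restrict U] g') : IsWeakDeriv U α v' g' := by
  refine ⟨LocallyIntegrableOn.congr_ae_open hU h.1 hv,
    LocallyIntegrableOn.congr_ae_open hU h.2.1 hg, fun ψ hψ => ?_⟩
  have e1 : ∫ x in U, v' x * partialDeriv α ψ x = ∫ x in U, v x * partialDeriv α ψ x :=
    integral_congr_ae (by filter_upwards [hv] with x hx; rw [hx])
  have e2 : ∫ x in U, g' x * ψ x = ∫ x in U, g x * ψ x :=
    integral_congr_ae (by filter_upwards [hg] with x hx; rw [hx])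
  rw [e1, e2, h.2.2 ψ hψ]

theorem setIntegral_eq_integral_of_tsupport {f ψ : Pt n → ℝ} (h : tsupport ψ ⊆ U) :
    ∫ x in U, f x * ψ x = ∫ x, f x * ψ x := by
  apply setIntegral_eq_integral_of_forall_compl_eq_zero
  intro x hx
  rw [image_eq_zero_of_notMem_tsupport (fun h' => hx (h h')), mul_zero]

/-- The weak derivative of a smooth function is the classical one. -/
theorem isWeakDeriv_of_contDiff {f : Pt n → ℝ} (hf : ContDiff ℝ ∞ f)
    (α : Fin m → Fin n) : IsWeakDeriv U α f (partialDeriv α f) := by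
  refine ⟨hf.continuous.locallyIntegrable.locallyIntegrableOn _,
    (contDiff_partialDeriv hf α).continuous.locallyIntegrable.locallyIntegrableOn _, fun ψ hψ => ?_⟩
  rw [setIntegral_eq_integral_of_tsupport hψ.2.2,
    setIntegral_eq_integral_of_tsupport (isTest_partialDeriv hψ α).2.2,
    integral_mul_partialDeriv hf hψ.1 hψ.2.1]

/-- A weak derivative of a weak derivative. -/
theorem IsWeakDeriv.of_cons {j : Fin n} {α : Fin m → Fin n} {v g h : Pt n → ℝ}
    (hg : IsWeakDeriv U (fun _ : Fin 1 => j) v g)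
    (hh : IsWeakDeriv U (Fin.cons j α : Fin (m + 1) → Fin n) v h) : IsWeakDeriv U α g h := by
  refine ⟨hg.2.1, hh.2.1, fun ψ hψ => ?_⟩
  have h1 := hg.2.2 _ (isTest_partialDeriv hψ α)
  have h2 := hh.2.2 _ hψ
  rw [partialDeriv_one (contDiff_partialDeriv hψ.1 α), ← partialDeriv_cons hψ.1, h2] at h1
  have h3 : ∫ x in U, g x * partialDeriv α ψ x = - ((-1) ^ (m + 1) * ∫ x in U, h x * ψ x) := by
    rw [h1]; ring
  rw [h3]; ring

end WeakDerivatives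

/-! ### Test functions are admissible in the equation -/

section TestFunctions

variable {n : ℕ} {U : Set (Pt n)} {ι : Type} [Fintype ι]

theorem IsTest.apply {ψ : Pt n → EuclideanSpace ℝ ι} (hψ : IsTest U ψ) (p : ι) :
    IsTest U (fun x => ψ x p) := by
  have hs : tsupport (fun x => ψ x p) ⊆ tsupport ψ :=
    tsupport_comp_subset (g := fun v : EuclideanSpace ℝ ι => v p) rfl ψ
  exact ⟨(EuclideanSpace.proj (𝕜 := ℝ) p).contDiff.comp hψ.1,
    hψ.2.1.of_isClosed_subset (isClosed_tsupport _) hs, hs.trans hψ.2.2⟩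

theorem IsTest.memSobolevZero (hU : IsOpen U) {ψ : Pt n → EuclideanSpace ℝ ι} (hψ : IsTest U ψ)
    (k : ℕ) : MemSobolevZero k U ψ := by
  refine ⟨fun p m _ α => ⟨_, isWeakDeriv_of_contDiff (hψ.apply p).1 α, ?_⟩,
    fun δ _ => ⟨ψ, hψ, fun p m _ α => ?_⟩⟩
  · have := isTest_partialDeriv (hψ.apply p) α
    exact (this.1.continuous.memLp_of_hasCompactSupport this.2.1).restrict _
  · have h1 := (isWeakDeriv_of_contDiff (U := U) (hψ.apply p).1 α).ae_eq hU
    have h2 : (fun x => weakDeriv U α (fun y => ψ y p) x - partialDeriv α (fun y => ψ y p) x)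
        =ᵐ[volume.restrict U] 0 := by
      filter_upwards [h1] with x hx
      simp [hx]
    rw [eLpNorm_congr_ae h2]
    simp

end TestFunctions

end OrliczSym

namespace OrliczSym

open Filter Topology

/-! ### Powers of cutoff functions and their commutators with derivatives -/

section Cutoff

variable {n : ℕ}

/-- `η` is smooth with values in `[0, 1]`, and its derivatives of order `j` are bounded by
`c j / L ^ j`. -/
structure IsCutoff (c : ℕ → ℝ) (L : ℝ) (η : Pt n → ℝ) : Prop where
  smooth : ContDiff ℝ ∞ η
  nonneg : ∀ x, 0 ≤ η x
  le_one : ∀ x, η x ≤ 1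
  bound : ∀ j x, ‖iteratedFDeriv ℝ j η x‖ ≤ c j / L ^ j

/-- Expand each argument in the coordinate basis. The bound passes from coordinate derivatives, in
which the energy is written, to the operator norm, in which the Leibniz estimate is available. -/
theorem norm_iteratedFDeriv_le_sum {m : ℕ} (g : Pt n → ℝ) (x : Pt n) :
    ‖iteratedFDeriv ℝ m g x‖ ≤ ∑ α : Fin m → Fin n, |partialDeriv α g x| := by
  refine ContinuousMultilinearMap.opNorm_le_bound (by positivity) fun v => ?_
  have hv : v = fun i => ∑ a, v i a • (EuclideanSpace.single a 1 : Pt n) := by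
    funext i
    ext b
    simp [Pi.single_apply]
  have h1 : iteratedFDeriv ℝ m g x v =
      ∑ α : Fin m → Fin n, (∏ i, v i (α i)) * partialDeriv α g x := by
    conv_lhs => rw [hv]
    rw [ContinuousMultilinearMap.map_sum]
    refine Finset.sum_congr rfl fun α _ => ?_
    rw [ContinuousMultilinearMap.map_smul_univ, smul_eq_mul]
    rfl
  rw [h1, Real.norm_eq_abs, Finset.sum_mul]
  refine (Finset.abs_sum_le_sum_abs _ _).trans (Finset.sum_le_sum fun α _ => ?_)
  rw [abs_mul, mul_comm, Finset.abs_prod]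
  gcongr with i
  exact (Real.norm_eq_abs _).symm.trans_le (PiLp.norm_apply_le (v i) (α i))

theorem abs_partialDeriv_le {m : ℕ} (α : Fin m → Fin n) (g : Pt n → ℝ) (x : Pt n) :
    |partialDeriv α g x| ≤ ‖iteratedFDeriv ℝ m g x‖ := by
  refine ((iteratedFDeriv ℝ m g x).le_opNorm _).trans_eq ?_
  simp

/-- Each derivative destroys at most one factor η, so `m - i` of them survive; the subtraction is
truncated, and for i ≥ m only boundedness is claimed. The constant sees η only through the sequence
c. -/
theorem IsCutoff.exists_bound_pow {c : ℕ → ℝ} (m i : ℕ) : ∃ C : ℝ, 0 ≤ C ∧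
    ∀ (η : Pt n → ℝ) (L : ℝ), 0 < L → IsCutoff c L η → ∀ x,
      ‖iteratedFDeriv ℝ i (fun x => η x ^ m) x‖ ≤ C / L ^ i * η x ^ (m - i) := by
  induction m generalizing i with
  | zero =>
    refine ⟨1, zero_le_one, fun η L hL h x => ?_⟩
    simp only [pow_zero, zero_tsub, mul_one]
    rcases Nat.eq_zero_or_pos i with rfl | hi
    · simp
    · rw [iteratedFDeriv_const_of_ne hi.ne']
      simp only [Pi.zero_apply, norm_zero]
      positivity
  | succ m ih =>
    choose K hK0 hK using fun i => ih i
    refine ⟨∑ l ∈ Finset.range (i + 1), (i.choose l) * ((|c l| + 1) * K (i - l)),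
      Finset.sum_nonneg fun l _ => by have := hK0 (i - l); positivity, fun η L hL h x => ?_⟩
    have e : (fun x => η x ^ (m + 1)) = fun x => η x * η x ^ m := by
      funext x; rw [pow_succ']
    rw [e]
    have h0 := h.nonneg x
    have h1 := h.le_one x
    refine (norm_iteratedFDeriv_mul_le h.smooth (h.smooth.pow m) x
      (n := i) (by exact_mod_cast le_top)).trans ?_
    rw [Finset.sum_div, Finset.sum_mul]
    refine Finset.sum_le_sum fun l hl => ?_
    have hl' : l ≤ i := Nat.lt_succ_iff.1 (Finset.mem_range.1 hl)
    have hb1 := hK (i - l) η L hL h x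
    have hle : ‖iteratedFDeriv ℝ l η x‖ * ‖iteratedFDeriv ℝ (i - l) (fun x => η x ^ m) x‖ ≤
        ((|c l| + 1) / L ^ l) * (K (i - l) / L ^ (i - l)) * η x ^ (m + 1 - i) := by
      have hc : c l / L ^ l ≤ (|c l| + 1) / L ^ l := by
        gcongr
        linarith [le_abs_self (c l)]
      -- If no derivative falls on the single factor η, that factor supplies the additional power;
      -- otherwise fewer derivatives act on `η ^ m`.
      rcases Nat.eq_zero_or_pos l with rfl | hlp
      · have : ‖iteratedFDeriv ℝ 0 η x‖ = η x := by
          rw [norm_iteratedFDeriv_zero, Real.norm_of_nonneg h0]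
        rw [this]
        simp only [tsub_zero, pow_zero, div_one] at hb1 ⊢
        have hK' : 0 ≤ K i / L ^ i := div_nonneg (hK0 i) (by positivity)
        calc η x * ‖iteratedFDeriv ℝ i (fun x => η x ^ m) x‖
            ≤ η x * (K i / L ^ i * η x ^ (m - i)) := mul_le_mul_of_nonneg_left hb1 h0
          _ = 1 * (K i / L ^ i) * η x ^ (m - i + 1) := by ring
          _ ≤ (|c 0| + 1) * (K i / L ^ i) * η x ^ (m + 1 - i) := by
              gcongr ?_ * _ * ?_
              · linarith [abs_nonneg (c 0)]
              · exact pow_le_pow_of_le_one h0 h1 (by omega)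
      · have hK' : 0 ≤ K (i - l) / L ^ (i - l) := div_nonneg (hK0 _) (by positivity)
        calc _ ≤ ((|c l| + 1) / L ^ l) * (K (i - l) / L ^ (i - l) * η x ^ (m - (i - l))) := by
              gcongr
              exact (h.bound l x).trans hc
          _ = ((|c l| + 1) / L ^ l) * (K (i - l) / L ^ (i - l)) * η x ^ (m - (i - l)) := by ring
          _ ≤ _ := by
              gcongr ?_ * ?_
              exact pow_le_pow_of_le_one h0 h1 (by omega)
    calc _ = (i.choose l : ℝ) * (‖iteratedFDeriv ℝ l η x‖ *
          ‖iteratedFDeriv ℝ (i - l) (fun x => η x ^ m) x‖) := by ring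
      _ ≤ (i.choose l : ℝ) * (((|c l| + 1) / L ^ l) * (K (i - l) / L ^ (i - l)) * η x ^ (m + 1 - i)) := by
          gcongr
      _ = _ := by
          have : L ^ i = L ^ l * L ^ (i - l) := by rw [← pow_add]; congr 1; omega
          rw [this]
          field_simp

/-- The sum of the squares of all partial derivatives of order `m`. -/
noncomputable def gradSq (m : ℕ) (g : Pt n → ℝ) (x : Pt n) : ℝ :=
  ∑ α : Fin m → Fin n, partialDeriv α g x ^ 2

theorem gradSq_nonneg (m : ℕ) (g : Pt n → ℝ) (x : Pt n) : 0 ≤ gradSq m g x :=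
  Finset.sum_nonneg fun _ _ => sq_nonneg _

theorem continuous_gradSq (m : ℕ) {g : Pt n → ℝ} (hg : ContDiff ℝ ∞ g) :
    Continuous (gradSq m g) :=
  continuous_finsetSum _ fun α _ => (contDiff_partialDeriv hg α).continuous.pow 2

theorem norm_iteratedFDeriv_sq_le (m : ℕ) (g : Pt n → ℝ) (x : Pt n) :
    ‖iteratedFDeriv ℝ m g x‖ ^ 2 ≤ (n : ℝ) ^ m * gradSq m g x := by
  calc ‖iteratedFDeriv ℝ m g x‖ ^ 2 ≤ (∑ α : Fin m → Fin n, |partialDeriv α g x|) ^ 2 := by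
        gcongr; exact norm_iteratedFDeriv_le_sum g x
    _ ≤ _ := by
        refine sq_sum_le_card_mul_sum_sq.trans_eq ?_
        simp [gradSq]

/-- The commutator of a derivative of order `k` and multiplication with `η ^ (2 k)`. -/
theorem IsCutoff.exists_commutator_bound {c : ℕ → ℝ} (k : ℕ) : ∃ C : ℝ, 0 ≤ C ∧
    ∀ (η g : Pt n → ℝ) (L : ℝ), 0 < L → IsCutoff c L η → ContDiff ℝ ∞ g → ∀ x,
      ∀ α : Fin k → Fin n,
      |partialDeriv α (fun x => η x ^ (2 * k) * g x) x - η x ^ (2 * k) * partialDeriv α g x| ≤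
        C * ∑ j ∈ Finset.range k, η x ^ (k + j) / L ^ (k - j) * ‖iteratedFDeriv ℝ j g x‖ := by
  choose K hK0 hK using fun i => IsCutoff.exists_bound_pow (n := n) (c := c) (2 * k) i
  refine ⟨∑ j ∈ Finset.range k, (k.choose j) * K (k - j),
    Finset.sum_nonneg fun j _ => by have := hK0 (k - j); positivity, fun η g L hL h hg x α => ?_⟩
  have h0 := h.nonneg x
  have hζ : ContDiff ℝ ∞ (fun x => η x ^ (2 * k)) := h.smooth.pow _
  -- The value at x is frozen: η^{2k} - z vanishes at x, which removes the Leibniz term where all k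
  -- derivatives fall on g.
  set z := η x ^ (2 * k) with hz
  have hζ' : ContDiff ℝ ∞ (fun y => η y ^ (2 * k) - z) := hζ.sub contDiff_const
  have e1 : partialDeriv α (fun x => η x ^ (2 * k) * g x) x - z * partialDeriv α g x =
      partialDeriv α (fun y => g y * (η y ^ (2 * k) - z)) x := by
    have e2 : (fun y => g y * (η y ^ (2 * k) - z)) =
        (fun y => η y ^ (2 * k) * g y) - z • g := by
      funext y; simp only [Pi.sub_apply, Pi.smul_apply, smul_eq_mul]; ring
    have hzg : ContDiffAt ℝ k (z • g) x := ((contDiff_infty.1 hg k).const_smul z).contDiffAt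
    rw [e2]
    unfold partialDeriv
    rw [iteratedFDeriv_sub_apply (contDiff_infty.1 (hζ.mul hg) k).contDiffAt
      hzg,
      iteratedFDeriv_const_smul_apply (contDiff_infty.1 hg k).contDiffAt]
    rfl
  rw [e1]
  refine (abs_partialDeriv_le _ _ _).trans ?_
  refine (norm_iteratedFDeriv_mul_le hg hζ' x (n := k) (by exact_mod_cast le_top)).trans ?_
  rw [Finset.sum_range_succ, tsub_self, norm_iteratedFDeriv_zero, sub_self, norm_zero, mul_zero,
    add_zero, Finset.sum_mul]
  refine Finset.sum_le_sum fun j hj => ?_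
  have hj' := Finset.mem_range.1 hj
  have e3 : iteratedFDeriv ℝ (k - j) (fun y => η y ^ (2 * k) - z) x =
      iteratedFDeriv ℝ (k - j) (fun y => η y ^ (2 * k)) x := by
    rw [fun_iteratedFDeriv_sub_apply (contDiff_infty.1 hζ _).contDiffAt contDiffAt_const,
      iteratedFDeriv_const_of_ne (by omega)]
    simp
  rw [e3]
  have hb := hK (k - j) η L hL h x
  have e4 : 2 * k - (k - j) = k + j := by omega
  rw [e4] at hb
  have hKj := hK0 (k - j)
  calc _ ≤ (k.choose j : ℝ) * ‖iteratedFDeriv ℝ j g x‖ * (K (k - j) / L ^ (k - j) * η x ^ (k + j)) := by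
        gcongr
    _ = (k.choose j : ℝ) * K (k - j) *
        (η x ^ (k + j) / L ^ (k - j) * ‖iteratedFDeriv ℝ j g x‖) := by ring
    _ ≤ _ := by
        gcongr
        exact Finset.single_le_sum (f := fun j => η x ^ (k + j) / L ^ (k - j) *
          ‖iteratedFDeriv ℝ j g x‖) (fun j _ => by positivity) hj

end Cutoff

end OrliczSym

namespace OrliczSym

open Filter Topology

/-! ### Lower bound for the form of order k -/

section Energy

variable {n : ℕ}

/-- In the commutator η^{k+j} = η^k η^j. The factor η^k accompanies the top derivative of g, and
Young's inequality absorbs this product into half of the leading term; η^j stays with D^j g. -/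
theorem IsCutoff.exists_pointwise_lower_bound {c : ℕ → ℝ} (k : ℕ) : ∃ C : ℝ, 0 ≤ C ∧
    ∀ (η g : Pt n → ℝ) (L : ℝ), 0 < L → IsCutoff c L η → ContDiff ℝ ∞ g → ∀ x,
      (1 / 2) * (η x ^ (2 * k) * gradSq k g x) -
        C * ∑ j ∈ Finset.range k, η x ^ (2 * j) / L ^ (2 * (k - j)) * gradSq j g x ≤
      ∑ α : Fin k → Fin n, partialDeriv α g x * partialDeriv α (fun x => η x ^ (2 * k) * g x) x := by
  obtain ⟨C, hC0, hC⟩ := IsCutoff.exists_commutator_bound (n := n) (c := c) k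
  refine ⟨(n : ℝ) ^ k * (C ^ 2 * k) * ∑ j ∈ Finset.range k, (n : ℝ) ^ j, by positivity,
    fun η g L hL h hg x => ?_⟩
  have h0 := h.nonneg x
  set S := ∑ j ∈ Finset.range k, η x ^ j / L ^ (k - j) * ‖iteratedFDeriv ℝ j g x‖ with hS
  have hSsq : S ^ 2 ≤ (k * ∑ j ∈ Finset.range k, (n : ℝ) ^ j) *
      ∑ j ∈ Finset.range k, η x ^ (2 * j) / L ^ (2 * (k - j)) * gradSq j g x := by
    refine (sq_sum_le_card_mul_sum_sq).trans ?_
    rw [Finset.card_range, mul_assoc]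
    gcongr
    rw [Finset.mul_sum]
    refine Finset.sum_le_sum fun j hj => ?_
    have hle : (n : ℝ) ^ j ≤ ∑ j ∈ Finset.range k, (n : ℝ) ^ j :=
      Finset.single_le_sum (f := fun j => (n : ℝ) ^ j) (fun _ _ => by positivity) hj
    have hg0 := gradSq_nonneg j g x
    calc (η x ^ j / L ^ (k - j) * ‖iteratedFDeriv ℝ j g x‖) ^ 2
        = η x ^ (2 * j) / L ^ (2 * (k - j)) * ‖iteratedFDeriv ℝ j g x‖ ^ 2 := by
          rw [mul_pow, div_pow, ← pow_mul, ← pow_mul, mul_comm j, mul_comm (k - j)]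
      _ ≤ η x ^ (2 * j) / L ^ (2 * (k - j)) * ((n : ℝ) ^ j * gradSq j g x) := by
          gcongr; exact norm_iteratedFDeriv_sq_le j g x
      _ = (n : ℝ) ^ j * (η x ^ (2 * j) / L ^ (2 * (k - j)) * gradSq j g x) := by ring
      _ ≤ _ := by gcongr
  have key : ∀ α : Fin k → Fin n, (1 / 2) * (η x ^ (2 * k) * partialDeriv α g x ^ 2) - C ^ 2 * S ^ 2 ≤
      partialDeriv α g x * partialDeriv α (fun x => η x ^ (2 * k) * g x) x := by
    intro α
    have h1 := hC η g L hL h hg x α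
    have e : ∑ j ∈ Finset.range k, η x ^ (k + j) / L ^ (k - j) * ‖iteratedFDeriv ℝ j g x‖ =
        η x ^ k * S := by
      rw [hS, Finset.mul_sum]
      exact Finset.sum_congr rfl fun j _ => by rw [pow_add]; ring
    rw [e] at h1
    set a := partialDeriv α g x
    set b := partialDeriv α (fun x => η x ^ (2 * k) * g x) x
    have e2 : η x ^ (2 * k) = (η x ^ k) ^ 2 := by rw [← pow_mul, mul_comm]
    rw [e2] at h1 ⊢
    set t := η x ^ k
    have h2 : -(|a| * (C * (t * S))) ≤ a * (b - t ^ 2 * a) := by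
      refine (neg_le_neg ?_).trans (neg_abs_le _)
      rw [abs_mul]
      gcongr
    have h3 : |a| ^ 2 = a ^ 2 := sq_abs a
    nlinarith [sq_nonneg (t * |a| - C * S), sq_nonneg (C * S)]
  have hsum := Finset.sum_le_sum fun α (_ : α ∈ (Finset.univ : Finset (Fin k → Fin n))) => key α
  refine le_trans ?_ hsum
  rw [Finset.sum_sub_distrib, ← Finset.mul_sum, ← Finset.mul_sum]
  simp only [Finset.sum_const, Finset.card_univ, Fintype.card_fun, Fintype.card_fin, nsmul_eq_mul,
    Nat.cast_pow]
  have : (n : ℝ) ^ k * (C ^ 2 * S ^ 2) ≤ (n : ℝ) ^ k * (C ^ 2 *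
      ((k * ∑ j ∈ Finset.range k, (n : ℝ) ^ j) *
      ∑ j ∈ Finset.range k, η x ^ (2 * j) / L ^ (2 * (k - j)) * gradSq j g x)) := by gcongr
  unfold gradSq at *
  linarith

/-- A sequence whose terms are bounded by their neighbours is bounded by its end points. -/
theorem exists_interpolation_succ {K : ℕ → ℝ → ℝ} (hK : ∀ j ε, 0 ≤ K j ε) (j : ℕ) {ε : ℝ} (hε : 0 < ε) :
    ∃ C : ℝ, 0 ≤ C ∧ ∀ N : ℕ → ℝ, (∀ j, 0 ≤ N j) →
      (∀ j ε, 0 < ε → N (j + 1) ≤ ε * N (j + 2) + K j ε * N j) → N j ≤ ε * N (j + 1) + C * N 0 := by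
  induction j generalizing ε with
  | zero =>
    refine ⟨1, zero_le_one, fun N h0 _ => ?_⟩
    have := h0 1
    nlinarith [mul_nonneg hε.le this]
  | succ j ih =>
    have hK' := hK j (ε / 2)
    -- With this parameter the term K · N j of the recursion contributes at most half of N (j + 1),
    -- which is absorbed.
    obtain ⟨C, hC0, hC⟩ := ih (ε := 1 / (2 * (K j (ε / 2) + 1))) (by positivity)
    refine ⟨2 * (K j (ε / 2) * C), by positivity, fun N h0 h => ?_⟩
    have h1 := h j (ε / 2) (by positivity)
    have h2 := mul_le_mul_of_nonneg_left (hC N h0 h) hK'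
    have h3 : K j (ε / 2) * (1 / (2 * (K j (ε / 2) + 1))) ≤ 1 / 2 := by
      rw [mul_one_div, div_le_div_iff₀ (by positivity) (by norm_num)]
      linarith
    have h4 := mul_le_mul_of_nonneg_right h3 (h0 (j + 1))
    linarith

/-- The one-level estimates are chained, every link but the last with parameter one. -/
theorem exists_interpolation {K : ℕ → ℝ → ℝ} (hK : ∀ j ε, 0 ≤ K j ε) (d j : ℕ) {ε : ℝ} (hε : 0 < ε) :
    ∃ C : ℝ, 0 ≤ C ∧ ∀ N : ℕ → ℝ, (∀ j, 0 ≤ N j) →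
      (∀ j ε, 0 < ε → N (j + 1) ≤ ε * N (j + 2) + K j ε * N j) →
      N j ≤ ε * N (j + 1 + d) + C * N 0 := by
  induction d generalizing ε with
  | zero => exact exists_interpolation_succ hK j hε
  | succ d ih =>
    obtain ⟨C, hC0, hC⟩ := ih one_pos
    obtain ⟨C', hC0', hC'⟩ := exists_interpolation_succ hK (j + 1 + d) hε
    refine ⟨C + C', by positivity, fun N h0 h => ?_⟩
    have h1 := hC N h0 h
    have h2 := hC' N h0 h
    rw [← add_assoc]
    linarith

theorem integrableOn_ball_of_continuous {f : Pt n → ℝ} (hf : Continuous f) (y : Pt n) (r : ℝ) :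
    IntegrableOn f (ball y r) :=
  (hf.continuousOn.integrableOn_compact (isCompact_closedBall y r)).mono_set ball_subset_closedBall

theorem IsCutoff.abs_pd_le {c : ℕ → ℝ} {L : ℝ} {η : Pt n → ℝ} (h : IsCutoff c L η) (j : Fin n)
    (x : Pt n) : |pd j η x| ≤ c 1 / L := by
  have h1 := h.bound 1 x
  rw [pow_one] at h1
  refine le_trans ?_ h1
  have := abs_partialDeriv_le (fun _ : Fin 1 => j) η x
  rwa [partialDeriv_one h.smooth] at this

/-- Interpolation in one direction. -/
theorem IsCutoff.integral_pd_sq_le {c : ℕ → ℝ} {L : ℝ} (hL : 0 < L) {η h : Pt n → ℝ}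
    (hη : IsCutoff c L η) {y : Pt n} {r : ℝ} (hr : ∀ x, x ∉ ball y r → η x = 0)
    (hh : ContDiff ℝ ∞ h) (s : Fin n) (j : ℕ) {ε : ℝ} (hε : 0 < ε) :
    ∫ x in ball y r, η x ^ (2 * (j + 1)) * pd s h x ^ 2 ≤
      ε * L ^ 2 * (∫ x in ball y r, η x ^ (2 * (j + 2)) * pd s (pd s h) x ^ 2) +
      (1 / ε + 4 * (j + 1) ^ 2 * c 1 ^ 2) / L ^ 2 * ∫ x in ball y r, η x ^ (2 * j) * h x ^ 2 := by
  have hηs := hη.smooth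
  have hp1 := contDiff_pd hh s
  have hp2 := contDiff_pd hp1 s
  have cη := hηs.continuous
  have hcs : HasCompactSupport η := by
    refine HasCompactSupport.intro (isCompact_closedBall y r) fun x hx => hr x fun h => ?_
    exact hx (ball_subset_closedBall h)
  have hgs : ContDiff ℝ ∞ (fun x => η x ^ (2 * (j + 1)) * pd s h x) := (hηs.pow _).mul hp1
  have hgc : HasCompactSupport (fun x => η x ^ (2 * (j + 1)) * pd s h x) := by
    refine HasCompactSupport.mul_right (f := fun x => η x ^ (2 * (j + 1))) ?_
    exact hcs.comp_left (g := fun t : ℝ => t ^ (2 * (j + 1))) (by simp)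
  have ibp := integral_mul_pd (contDiff_infty.1 hh 1) (contDiff_infty.1 hgs 1) hgc s
  have hpdη : ∀ x, pd s (fun x => η x ^ (2 * (j + 1))) x = (2 * (j + 1)) * η x ^ (2 * j + 1) * pd s η x := by
    intro x
    unfold pd
    rw [fderiv_fun_pow _ ((hηs.differentiable (by simp)) x), show 2 * (j + 1) - 1 = 2 * j + 1 by omega]
    simp
  have e1 : ∀ x, pd s (fun x => η x ^ (2 * (j + 1)) * pd s h x) x =
      η x ^ (2 * (j + 1)) * pd s (pd s h) x + (2 * (j + 1)) * η x ^ (2 * j + 1) * pd s η x * pd s h x := by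
    intro x
    rw [pd_mul ((hηs.pow _).differentiable (by simp) x) (hp1.differentiable (by simp) x), hpdη]
  -- Integration by parts moves one derivative off h; there is no boundary term because η has
  -- compact support.
  have e2 : ∫ x in ball y r, η x ^ (2 * (j + 1)) * pd s h x ^ 2 =
      ∫ x in ball y r, -(h x * (η x ^ (2 * (j + 1)) * pd s (pd s h) x +
        (2 * (j + 1)) * η x ^ (2 * j + 1) * pd s η x * pd s h x)) := by
    rw [setIntegral_eq_integral_of_forall_compl_eq_zero,
      setIntegral_eq_integral_of_forall_compl_eq_zero, integral_neg]
    · simp_rw [e1] at ibp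
      rw [ibp, neg_neg]
      exact integral_congr_ae (Eventually.of_forall fun x => by ring)
    · intro x hx; simp [hr x hx]
    · intro x hx; simp [hr x hx]
  set M := ∫ x in ball y r, η x ^ (2 * (j + 1)) * pd s h x ^ 2 with hM
  have cpd := (contDiff_pd hηs s).continuous
  have ch := hh.continuous
  have cp1 := hp1.continuous
  have cp2 := hp2.continuous
  -- Young's inequality in both terms. Half of M reappears, from the derivative of the cutoff, and
  -- is absorbed at the end.
  have hle : M ≤ ∫ x in ball y r, ((1 / 2) * (η x ^ (2 * (j + 1)) * pd s h x ^ 2) +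
      (ε / 2 * L ^ 2 * (η x ^ (2 * (j + 2)) * pd s (pd s h) x ^ 2) +
      (1 / (2 * ε) + 2 * (j + 1) ^ 2 * c 1 ^ 2) / L ^ 2 * (η x ^ (2 * j) * h x ^ 2))) := by
    rw [e2]
    refine integral_mono (integrableOn_ball_of_continuous (by fun_prop) y r)
      (integrableOn_ball_of_continuous (by fun_prop) y r) fun x => ?_
    have h0 := hη.nonneg x
    have hb := hη.abs_pd_le s x
    dsimp only
    set t := η x ^ j with ht
    have ht0 : 0 ≤ t := by positivity
    have p1 : η x ^ (2 * (j + 1)) = (t * η x) ^ 2 := by rw [ht]; ring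
    have p2 : η x ^ (2 * j + 1) = t * (t * η x) := by rw [ht]; ring
    have p3 : η x ^ (2 * (j + 2)) = (t * η x ^ 2) ^ 2 := by rw [ht]; ring
    have p4 : η x ^ (2 * j) = t ^ 2 := by rw [ht]; ring
    rw [p1, p2, p3, p4]
    set a := h x
    set b := pd s h x
    set d := pd s (pd s h) x
    set q := pd s η x
    have h1 : -(a * ((t * η x) ^ 2 * d)) ≤ ε / 2 * L ^ 2 * ((t * η x ^ 2) ^ 2 * d ^ 2) +
        1 / (2 * ε) / L ^ 2 * (t ^ 2 * a ^ 2) := by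
      have : 0 ≤ (1 / 2) * (1 / ε) * (ε * L * (t * η x ^ 2 * d) + t * a / L) ^ 2 := by positivity
      have e : (1 / 2) * (1 / ε) * (ε * L * (t * η x ^ 2 * d) + t * a / L) ^ 2 =
        ε / 2 * L ^ 2 * ((t * η x ^ 2) ^ 2 * d ^ 2) + 1 / (2 * ε) / L ^ 2 * (t ^ 2 * a ^ 2) +
          a * ((t * η x) ^ 2 * d) := by
        field_simp
        ring
      linarith
    have h2 : -(a * (2 * (j + 1) * (t * (t * η x)) * q * b)) ≤ (1 / 2) * ((t * η x) ^ 2 * b ^ 2) +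
        2 * (j + 1) ^ 2 * c 1 ^ 2 / L ^ 2 * (t ^ 2 * a ^ 2) := by
      have hq : q ^ 2 ≤ c 1 ^ 2 / L ^ 2 := by
        rw [← div_pow, ← sq_abs q]; gcongr
      have h3 : 2 * ((j : ℝ) + 1) ^ 2 * (t ^ 2 * a ^ 2) * q ^ 2 ≤
          2 * (j + 1) ^ 2 * (t ^ 2 * a ^ 2) * (c 1 ^ 2 / L ^ 2) := by gcongr
      have h4 : 0 ≤ (1 / 2) * (t * η x * b + 2 * (j + 1) * t * q * a) ^ 2 := by positivity
      have h5 : 2 * ((j : ℝ) + 1) ^ 2 * c 1 ^ 2 / L ^ 2 * (t ^ 2 * a ^ 2) =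
        2 * (j + 1) ^ 2 * (t ^ 2 * a ^ 2) * (c 1 ^ 2 / L ^ 2) := by ring
      rw [h5]
      nlinarith
    have e3 : (1 / (2 * ε) + 2 * ((j : ℝ) + 1) ^ 2 * c 1 ^ 2) / L ^ 2 * (t ^ 2 * a ^ 2) =
        1 / (2 * ε) / L ^ 2 * (t ^ 2 * a ^ 2) +
        2 * (j + 1) ^ 2 * c 1 ^ 2 / L ^ 2 * (t ^ 2 * a ^ 2) := by ring
    rw [e3]
    linarith
  rw [integral_add (integrableOn_ball_of_continuous (by fun_prop) y r)
    (integrableOn_ball_of_continuous (by fun_prop) y r),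
    integral_add (integrableOn_ball_of_continuous (by fun_prop) y r)
    (integrableOn_ball_of_continuous (by fun_prop) y r), integral_const_mul, integral_const_mul,
    integral_const_mul, ← hM] at hle
  have e4 : (1 / ε + 4 * ((j : ℝ) + 1) ^ 2 * c 1 ^ 2) / L ^ 2 =
    2 * ((1 / (2 * ε) + 2 * (j + 1) ^ 2 * c 1 ^ 2) / L ^ 2) := by field_simp; ring
  rw [e4]
  linarith

/-- Sum the one-directional inequality over the direction s and over the remaining indices β. The
last integral does not depend on s, whence the factor n. -/
theorem IsCutoff.integral_gradSq_le {c : ℕ → ℝ} {L : ℝ} (hL : 0 < L) {η g : Pt n → ℝ}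
    (hη : IsCutoff c L η) {y : Pt n} {r : ℝ} (hr : ∀ x, x ∉ ball y r → η x = 0)
    (hg : ContDiff ℝ ∞ g) (j : ℕ) {ε : ℝ} (hε : 0 < ε) :
    ∫ x in ball y r, η x ^ (2 * (j + 1)) * gradSq (j + 1) g x ≤
      ε * L ^ 2 * (∫ x in ball y r, η x ^ (2 * (j + 2)) * gradSq (j + 2) g x) +
      (n * (1 / ε + 4 * (j + 1) ^ 2 * c 1 ^ 2)) / L ^ 2 *
        ∫ x in ball y r, η x ^ (2 * j) * gradSq j g x := by
  have cη := hη.smooth.continuous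
  have hint : ∀ (m i : ℕ) (α : Fin i → Fin n), IntegrableOn
      (fun x => η x ^ m * partialDeriv α g x ^ 2) (ball y r) := fun m i α =>
    integrableOn_ball_of_continuous
      ((cη.pow _).mul ((contDiff_partialDeriv hg α).continuous.pow 2)) y r
  have hsum : ∀ m i : ℕ, ∫ x in ball y r, η x ^ m * gradSq i g x =
      ∑ α : Fin i → Fin n, ∫ x in ball y r, η x ^ m * partialDeriv α g x ^ 2 := by
    intro m i
    rw [← integral_finsetSum _ fun α _ => hint m i α]
    refine integral_congr_ae (Eventually.of_forall fun x => ?_)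
    simp only [gradSq, Finset.mul_sum]
  rw [hsum, hsum, hsum, sum_fin_succ_fun, sum_fin_succ_fun]
  have h1 : ∀ s : Fin n, ∀ β : Fin j → Fin n, _ := fun s β =>
    hη.integral_pd_sq_le hL hr (contDiff_partialDeriv hg β) s j hε
  simp_rw [← partialDeriv_cons hg] at h1
  -- Only the repeated direction s, s occurs on the right; it is one term of the full sum over s'.
  have h2 : ∀ s : Fin n, ∀ β : Fin j → Fin n,
      ∫ x in ball y r, η x ^ (2 * (j + 2)) *
        partialDeriv (Fin.cons s (Fin.cons s β : Fin (j + 1) → Fin n) : Fin (j + 2) → Fin n) g x ^ 2 ≤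
      ∑ s' : Fin n, ∫ x in ball y r, η x ^ (2 * (j + 2)) *
        partialDeriv (Fin.cons s' (Fin.cons s β : Fin (j + 1) → Fin n) : Fin (j + 2) → Fin n) g x ^ 2 := by
    intro s β
    refine Finset.single_le_sum (f := fun s' => ∫ x in ball y r, η x ^ (2 * (j + 2)) *
        partialDeriv (Fin.cons s' (Fin.cons s β : Fin (j + 1) → Fin n) : Fin (j + 2) → Fin n) g x ^ 2)
      (fun s' _ => integral_nonneg fun x => ?_) (Finset.mem_univ s)
    exact mul_nonneg (pow_nonneg (hη.nonneg x) _) (sq_nonneg _)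
  calc _ ≤ ∑ s : Fin n, ∑ β : Fin j → Fin n, (ε * L ^ 2 * (∑ s' : Fin n, ∫ x in ball y r,
        η x ^ (2 * (j + 2)) * partialDeriv
          (Fin.cons s' (Fin.cons s β : Fin (j + 1) → Fin n) : Fin (j + 2) → Fin n) g x ^ 2) +
      (1 / ε + 4 * (j + 1) ^ 2 * c 1 ^ 2) / L ^ 2 *
        ∫ x in ball y r, η x ^ (2 * j) * partialDeriv β g x ^ 2) := by
        refine Finset.sum_le_sum fun s _ => Finset.sum_le_sum fun β _ => (h1 s β).trans ?_
        have := h2 s β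
        gcongr
    _ = _ := by
        simp_rw [Finset.sum_add_distrib, ← Finset.mul_sum]
        rw [Finset.sum_const, Finset.card_univ, Fintype.card_fin, nsmul_eq_mul]
        congr 1
        · congr 1
          refine ((Finset.sum_congr rfl fun s _ => Finset.sum_comm).trans Finset.sum_comm).trans ?_
          exact Finset.sum_congr rfl fun s' _ => (sum_fin_succ_fun fun γ : Fin (j + 1) → Fin n =>
            ∫ x in ball y r, η x ^ (2 * (j + 2)) *
              partialDeriv (Fin.cons s' γ : Fin (j + 2) → Fin n) g x ^ 2).symm
        · ring

/-- The energy form of order `k`, tested with `η ^ (2 k) g`, is bounded below by the integral of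
`g ^ 2`. -/
theorem exists_energy_lower_bound (n : ℕ) {c : ℕ → ℝ} {k : ℕ} (hk : 0 < k) : ∃ C : ℝ, 0 < C ∧
    ∀ (η g : Pt n → ℝ) (L : ℝ) (y : Pt n) (r : ℝ), 0 < L → IsCutoff c L η →
      (∀ x, x ∉ ball y r → η x = 0) → ContDiff ℝ ∞ g →
      -(C / L ^ (2 * k) * ∫ x in ball y r, g x ^ 2) ≤ ∫ x, ∑ α : Fin k → Fin n,
        partialDeriv α g x * partialDeriv α (fun x => η x ^ (2 * k) * g x) x := by
  obtain ⟨C₁, hC₁0, hC₁⟩ := IsCutoff.exists_pointwise_lower_bound (n := n) (c := c) k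
  obtain ⟨C₂, hC₂0, hC₂⟩ := IsCutoff.exists_commutator_bound (n := n) (c := c) k
  set K : ℕ → ℝ → ℝ := fun j ε => n * (|1 / ε| + 4 * (j + 1) ^ 2 * c 1 ^ 2) with hKdef
  have hK : ∀ j ε, 0 ≤ K j ε := fun j ε => by positivity
  -- So small that the k lower-order terms, multiplied by C₁, use up at most half of N k.
  have hε : 0 < 1 / (2 * (C₁ * k + 1)) := by positivity
  choose D hD0 hD using fun j d => exists_interpolation hK d j hε
  refine ⟨C₁ * (∑ j ∈ Finset.range k, D j (k - 1 - j)) + 1, ?_, fun η g L y r hL hη hr hg => ?_⟩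
  · have : 0 ≤ ∑ j ∈ Finset.range k, D j (k - 1 - j) := Finset.sum_nonneg fun j _ => hD0 _ _
    positivity
  have cη := hη.smooth.continuous
  -- These weights remove L from the interpolation inequality, so the constants depend on k, n and c
  -- only.
  set N : ℕ → ℝ := fun j => L ^ (2 * j) * ∫ x in ball y r, η x ^ (2 * j) * gradSq j g x with hN
  have hN0 : ∀ j, 0 ≤ N j := fun j => mul_nonneg (by positivity)
    (integral_nonneg fun x => mul_nonneg (pow_nonneg (hη.nonneg x) _) (gradSq_nonneg _ _ _))
  have hNrec : ∀ j ε, 0 < ε → N (j + 1) ≤ ε * N (j + 2) + K j ε * N j := by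
    intro j ε hε
    have := mul_le_mul_of_nonneg_left (hη.integral_gradSq_le hL hr hg j hε)
      (by positivity : 0 ≤ L ^ (2 * (j + 1)))
    refine this.trans_eq ?_
    simp only [hN, hKdef]
    rw [abs_of_pos (by positivity : 0 < 1 / ε)]
    field_simp
    ring
  have hNk : ∀ j ∈ Finset.range k, N j ≤ 1 / (2 * (C₁ * k + 1)) * N k + D j (k - 1 - j) * N 0 := by
    intro j hj
    have hjk := Finset.mem_range.1 hj
    have := hD j (k - 1 - j) N hN0 hNrec
    rwa [show j + 1 + (k - 1 - j) = k by omega] at this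
  -- Where η vanishes, so does the commutator bound, and hence D^α(η^{2k} g): every term carries the
  -- power k + j > 0 of η.
  have hzero : ∀ x, x ∉ ball y r → ∑ α : Fin k → Fin n,
      partialDeriv α g x * partialDeriv α (fun x => η x ^ (2 * k) * g x) x = 0 := by
    intro x hx
    refine Finset.sum_eq_zero fun α _ => ?_
    have h1 := hC₂ η g L hL hη hg x α
    have h2 : ∑ j ∈ Finset.range k, η x ^ (k + j) / L ^ (k - j) * ‖iteratedFDeriv ℝ j g x‖ = 0 :=
      Finset.sum_eq_zero fun j _ => by rw [hr x hx, zero_pow (by omega)]; simp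
    rw [h2, hr x hx, zero_pow (by omega), zero_mul, sub_zero, mul_zero] at h1
    rw [abs_nonpos_iff.1 h1, mul_zero]
  rw [← setIntegral_eq_integral_of_forall_compl_eq_zero hzero]
  have hsm : ContDiff ℝ ∞ (fun x => η x ^ (2 * k) * g x) := (hη.smooth.pow _).mul hg
  have i0 : ∀ j, IntegrableOn (fun x => η x ^ (2 * j) * gradSq j g x) (ball y r) := fun j =>
    integrableOn_ball_of_continuous ((cη.pow _).mul (continuous_gradSq j hg)) y r
  have i1 : IntegrableOn (fun x => C₁ * ∑ j ∈ Finset.range k,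
      η x ^ (2 * j) / L ^ (2 * (k - j)) * gradSq j g x) (ball y r) := by
    refine integrableOn_ball_of_continuous (continuous_const.mul
      (continuous_finsetSum _ fun j _ => ?_)) y r
    exact ((cη.pow _).div_const _).mul (continuous_gradSq j hg)
  have hint := setIntegral_mono (((i0 k).const_mul (1 / 2)).sub i1)
    (integrableOn_ball_of_continuous (continuous_finsetSum _ fun α _ =>
      (contDiff_partialDeriv hg α).continuous.mul (contDiff_partialDeriv hsm α).continuous) y r)
    (fun x => hC₁ η g L hL hη hg x)
  refine le_trans ?_ hint
  have e1 : ∫ x in ball y r, ((1 / 2) * (η x ^ (2 * k) * gradSq k g x) - C₁ * ∑ j ∈ Finset.range k,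
      η x ^ (2 * j) / L ^ (2 * (k - j)) * gradSq j g x) =
      1 / L ^ (2 * k) * ((1 / 2) * N k - C₁ * ∑ j ∈ Finset.range k, N j) := by
    rw [integral_sub ((i0 k).const_mul (1 / 2)) i1, integral_const_mul, integral_const_mul,
      integral_finsetSum]
    · rw [mul_sub, ← mul_assoc, mul_comm (1 / L ^ (2 * k)) (1 / 2), mul_assoc]
      congr 1
      · simp only [hN]; field_simp
      · rw [← mul_assoc, mul_comm (1 / L ^ (2 * k)) C₁, mul_assoc]
        congr 1
        rw [Finset.mul_sum]
        refine Finset.sum_congr rfl fun j hj => ?_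
        have hjk := Finset.mem_range.1 hj
        simp only [hN]
        rw [← mul_assoc, ← integral_const_mul]
        refine integral_congr_ae (Eventually.of_forall fun x => ?_)
        have : L ^ (2 * k) = L ^ (2 * (k - j)) * L ^ (2 * j) := by
          rw [← pow_add]; congr 1; omega
        simp only [this]
        field_simp
    · intro j _
      have := (i0 j).const_mul (1 / L ^ (2 * (k - j)))
      refine this.congr (Eventually.of_forall fun x => ?_)
      simp only; ring
  have e1' : (∫ x in ball y r, ((fun x => (1 / 2) * (η x ^ (2 * k) * gradSq k g x)) - fun x =>
      C₁ * ∑ j ∈ Finset.range k, η x ^ (2 * j) / L ^ (2 * (k - j)) * gradSq j g x) x) = _ := e1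
  rw [e1']
  have e2 : ∫ x in ball y r, g x ^ 2 = N 0 := by
    simp only [hN, mul_zero, pow_zero, one_mul]
    refine integral_congr_ae (Eventually.of_forall fun x => ?_)
    simp [gradSq, partialDeriv_zero]
  rw [e2]
  have hs := Finset.sum_le_sum hNk
  rw [Finset.sum_add_distrib, Finset.sum_const, Finset.card_range, nsmul_eq_mul,
    ← Finset.sum_mul] at hs
  have hs2 := mul_le_mul_of_nonneg_left hs hC₁0
  have h4 : C₁ * (k * (1 / (2 * (C₁ * k + 1)) * N k)) ≤ 1 / 2 * N k := by
    have : C₁ * k / (2 * (C₁ * k + 1)) ≤ 1 / 2 := by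
      rw [div_le_div_iff₀ (by positivity) (by norm_num)]; linarith
    calc _ = C₁ * k / (2 * (C₁ * k + 1)) * N k := by ring
      _ ≤ _ := mul_le_mul_of_nonneg_right this (hN0 k)
  have h5 := hN0 0
  have h6 : -((C₁ * (∑ j ∈ Finset.range k, D j (k - 1 - j)) + 1) * N 0) ≤
      1 / 2 * N k - C₁ * ∑ j ∈ Finset.range k, N j := by nlinarith
  calc _ = 1 / L ^ (2 * k) * -((C₁ * (∑ j ∈ Finset.range k, D j (k - 1 - j)) + 1) * N 0) := by ring
    _ ≤ _ := by gcongr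

end Energy

end OrliczSym

namespace OrliczSym

open Filter Topology

/-! ### Convolution with smooth kernels -/

section Convolution

variable {n m : ℕ}

/-- The convolution `∫ ρ (x - t) g t dt`. -/
noncomputable def cv (ρ g : Pt n → ℝ) (x : Pt n) : ℝ := ∫ t, ρ (x - t) * g t

/-- This order of the factors is the one suited to differentiating the kernel; `cv_eq_lsmul` is the
form that fits normalized bump functions. -/
theorem cv_eq_mul (ρ g : Pt n → ℝ) :
    cv ρ g = convolution g ρ (ContinuousLinearMap.mul ℝ ℝ) volume := by
  ext x
  simp only [cv, convolution_def, ContinuousLinearMap.mul_apply', mul_comm]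

theorem cv_eq_lsmul (ρ g : Pt n → ℝ) :
    cv ρ g = convolution ρ g (ContinuousLinearMap.lsmul ℝ ℝ) volume := by
  ext x
  simp only [cv, convolution_lsmul_swap, smul_eq_mul]

theorem cv_comm (ρ g : Pt n → ℝ) : cv ρ g = cv g ρ := by
  rw [cv_eq_lsmul, cv_eq_mul]; rfl

theorem contDiff_cv {ρ g : Pt n → ℝ} (hρ : ContDiff ℝ ∞ ρ) (hc : HasCompactSupport ρ)
    (hg : LocallyIntegrable g) : ContDiff ℝ ∞ (cv ρ g) := by
  rw [cv_eq_mul]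
  exact hc.contDiff_convolution_right _ hg hρ

theorem pd_cv {ρ g : Pt n → ℝ} (hρ : ContDiff ℝ ∞ ρ) (hc : HasCompactSupport ρ)
    (hg : LocallyIntegrable g) (j : Fin n) : pd j (cv ρ g) = cv (pd j ρ) g := by
  ext x
  rw [cv_eq_mul, cv_eq_mul, pd, (hc.hasFDerivAt_convolution_right (ContinuousLinearMap.mul ℝ ℝ) hg
    (contDiff_infty.1 hρ 1) x).fderiv]
  exact convolution_precompR_apply _ hg (hc.fderiv ℝ)
    ((contDiff_infty.1 hρ 1).continuous_fderiv (by norm_num)) _ _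

theorem partialDeriv_cv {ρ g : Pt n → ℝ} (hρ : ContDiff ℝ ∞ ρ) (hc : HasCompactSupport ρ)
    (hg : LocallyIntegrable g) (α : Fin m → Fin n) :
    partialDeriv α (cv ρ g) = cv (partialDeriv α ρ) g := by
  induction m with
  | zero => simp [partialDeriv_zero]
  | succ m ih =>
    have h := isTest_partialDeriv (U := univ) ⟨hρ, hc, subset_univ _⟩ (Fin.tail α)
    rw [partialDeriv_succ (contDiff_cv hρ hc hg), ih, pd_cv h.1 h.2.1 hg, ← partialDeriv_succ hρ]

theorem partialDeriv_cv_right {ρ g : Pt n → ℝ} (hρ : ContDiff ℝ ∞ ρ)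
    (hg : ContDiff ℝ ∞ g) (hc : HasCompactSupport g) (α : Fin m → Fin n) :
    partialDeriv α (cv ρ g) = cv ρ (partialDeriv α g) := by
  rw [cv_comm, partialDeriv_cv hg hc hρ.continuous.locallyIntegrable, cv_comm]

theorem pd_cv_right {ρ g : Pt n → ℝ} (hρ : ContDiff ℝ ∞ ρ)
    (hg : ContDiff ℝ ∞ g) (hc : HasCompactSupport g) (j : Fin n) :
    pd j (cv ρ g) = cv ρ (pd j g) := by
  rw [cv_comm, pd_cv hg hc hρ.continuous.locallyIntegrable, cv_comm]

theorem pd_comp_sub {ρ : Pt n → ℝ} (hρ : Differentiable ℝ ρ) (x : Pt n) (j : Fin n) :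
    pd j (fun t => ρ (x - t)) = fun t => -pd j ρ (x - t) := by
  ext t
  have h := (hρ (x - t)).hasFDerivAt.comp t ((hasFDerivAt_const x t).sub (hasFDerivAt_id t))
  have h' : fderiv ℝ (fun t => ρ (x - t)) t = _ := h.fderiv
  simp only [pd]
  rw [h']
  simp

theorem partialDeriv_comp_sub {ρ : Pt n → ℝ} (hρ : ContDiff ℝ ∞ ρ) (x : Pt n) (α : Fin m → Fin n) :
    partialDeriv α (fun t => ρ (x - t)) = fun t => (-1) ^ m * partialDeriv α ρ (x - t) := by
  induction m generalizing ρ with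
  | zero => simp [partialDeriv_zero]
  | succ m ih =>
    have h1 : ContDiff ℝ ∞ (fun t => ρ (x - t)) := hρ.comp (contDiff_const.sub contDiff_id)
    have h2 : (fun t => -pd (α 0) ρ (x - t)) = fun t => (fun z => -pd (α 0) ρ z) (x - t) := rfl
    rw [partialDeriv_succ h1, ← partialDeriv_pd h1, pd_comp_sub (hρ.differentiable (by simp)), h2, ih (contDiff_pd hρ _).neg,
      partialDeriv_succ hρ, ← partialDeriv_pd hρ]
    ext t
    have h3 : partialDeriv (Fin.tail α) (fun z => -pd (α 0) ρ z) (x - t) =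
        -partialDeriv (Fin.tail α) (pd (α 0) ρ) (x - t) := by
      unfold partialDeriv
      have := iteratedFDeriv_neg_apply (𝕜 := ℝ) (i := m) (f := pd (α 0) ρ) (x := x - t)
      have e : (fun z => -pd (α 0) ρ z) = -pd (α 0) ρ := rfl
      rw [e, this]
      rfl
    rw [h3]; ring

/-- Derivatives of a mollification are mollifications of weak derivatives. -/
theorem partialDeriv_cv_indicator {U : Set (Pt n)} (hU : MeasurableSet U) {ρ : Pt n → ℝ}
    (hρ : ContDiff ℝ ∞ ρ) (hc : HasCompactSupport ρ) {v g : Pt n → ℝ} {α : Fin m → Fin n}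
    (hv : IntegrableOn v U) (h : IsWeakDeriv U α v g) {x : Pt n}
    (hx : ∀ t, x - t ∈ tsupport ρ → t ∈ U) :
    partialDeriv α (cv ρ (U.indicator v)) x = cv ρ (U.indicator g) x := by
  have hvi : LocallyIntegrable (U.indicator v) := (hv.integrable_indicator hU).locallyIntegrable
  rw [partialDeriv_cv hρ hc hvi]
  have hcv : ∀ ρ' w : Pt n → ℝ, cv ρ' (U.indicator w) x = ∫ t in U, w t * ρ' (x - t) := by
    intro ρ' w
    rw [cv, ← integral_indicator hU]
    refine integral_congr_ae (Eventually.of_forall fun t => ?_)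
    by_cases ht : t ∈ U <;> simp [ht, mul_comm]
  have hsm : ContDiff ℝ ∞ (fun t => ρ (x - t)) := hρ.comp (contDiff_const.sub contDiff_id)
  have hts : tsupport (fun t => ρ (x - t)) ⊆ (fun t => x - t) ⁻¹' tsupport ρ :=
    closure_minimal (fun t ht => subset_tsupport ρ ht)
      ((isClosed_tsupport ρ).preimage (by fun_prop))
  -- The reflected kernel is admissible in the definition of the weak derivative; the sign produced
  -- by the reflection cancels the sign there.
  have htest : IsTest U (fun t => ρ (x - t)) := by
    refine ⟨hsm, ?_, hts.trans fun t ht => hx t ht⟩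
    exact hc.comp_homeomorph (Homeomorph.subLeft x)
  have := h.2.2 _ htest
  rw [partialDeriv_comp_sub hρ] at this
  rw [hcv, hcv]
  have e : ∫ t in U, v t * ((-1) ^ m * partialDeriv α ρ (x - t)) =
      (-1) ^ m * ∫ t in U, v t * partialDeriv α ρ (x - t) := by
    rw [← integral_const_mul]
    exact integral_congr_ae (Eventually.of_forall fun t => by ring)
  simp only [e] at this
  exact mul_left_cancel₀ (by positivity : ((-1 : ℝ) ^ m) ≠ 0) this

/-- Mollification with an even kernel is symmetric. -/
theorem integral_mul_cv {ρ g χ : Pt n → ℝ} (hρ : Continuous ρ) (hc : HasCompactSupport ρ)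
    (hev : ∀ x, ρ (-x) = ρ x) (hg : Integrable g) (hχ : Continuous χ) (hχc : HasCompactSupport χ) :
    ∫ x, g x * cv ρ χ x = ∫ x, cv ρ g x * χ x := by
  obtain ⟨C, hC⟩ := hc.exists_bound_of_continuous hρ
  have hint : Integrable (Function.uncurry fun x t => ρ (x - t) * (g x * χ t)) := by
    have h1 : Integrable (fun z : Pt n × Pt n => g z.1 * χ z.2) :=
      hg.mul_prod (hχ.integrable_of_hasCompactSupport hχc)
    exact h1.bdd_mul (c := C) (by fun_prop) (Eventually.of_forall fun z => hC _)
  have e1 : ∀ x, g x * cv ρ χ x = ∫ t, ρ (x - t) * (g x * χ t) := by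
    intro x
    rw [cv, ← integral_const_mul]
    exact integral_congr_ae (Eventually.of_forall fun t => by ring)
  have e2 : ∀ t, cv ρ g t * χ t = ∫ x, ρ (x - t) * (g x * χ t) := by
    intro t
    rw [cv, ← integral_mul_const]
    refine integral_congr_ae (Eventually.of_forall fun x => ?_)
    have : ρ (t - x) = ρ (x - t) := by rw [← hev, neg_sub]
    simp only [this]; ring
  simp_rw [e1, e2]
  exact integral_integral_swap hint

/-- A sequence of bump functions concentrating at the origin. -/
noncomputable def bump (n m : ℕ) : ContDiffBump (0 : Pt n) where
  rIn := 1 / (2 * (m + 1))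
  rOut := 1 / (m + 1)
  rIn_pos := by positivity
  rIn_lt_rOut := by
    rw [div_lt_div_iff₀ (by positivity) (by positivity)]
    have : (0 : ℝ) ≤ m := by positivity
    linarith

/-- A sequence of even mollification kernels. -/
noncomputable def kern (n m : ℕ) : Pt n → ℝ := (bump n m).normed volume

theorem kern_contDiff (n m : ℕ) : ContDiff ℝ ∞ (kern n m) := (bump n m).contDiff_normed

theorem kern_hasCompactSupport (n m : ℕ) : HasCompactSupport (kern n m) :=
  (bump n m).hasCompactSupport_normed

theorem kern_nonneg (n m : ℕ) (x : Pt n) : 0 ≤ kern n m x := (bump n m).nonneg_normed x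

theorem kern_neg (n m : ℕ) (x : Pt n) : kern n m (-x) = kern n m x := (bump n m).normed_neg x

theorem kern_integral (n m : ℕ) : ∫ x, kern n m x = 1 := (bump n m).integral_normed

theorem tsupport_kern (n m : ℕ) : tsupport (kern n m) = closedBall 0 (1 / (m + 1)) :=
  (bump n m).tsupport_normed_eq

theorem tendsto_rOut (n : ℕ) : Tendsto (fun m => (bump n m).rOut) atTop (𝓝 0) :=
  tendsto_one_div_add_atTop_nhds_zero_nat

theorem kern_integrable (n m : ℕ) : Integrable (kern n m) :=
  (kern_contDiff n m).continuous.integrable_of_hasCompactSupport (kern_hasCompactSupport n m)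

theorem abs_cv_kern_le {g : Pt n → ℝ} {C : ℝ} (hg : ∀ x, |g x| ≤ C) (m : ℕ) (x : Pt n) :
    |cv (kern n m) g x| ≤ C := by
  have h1 : |cv (kern n m) g x| ≤ ∫ t, kern n m (x - t) * C := by
    rw [cv, ← Real.norm_eq_abs]
    refine norm_integral_le_of_norm_le (((kern_integrable n m).comp_sub_left x).mul_const C)
      (Eventually.of_forall fun t => ?_)
    rw [norm_mul, Real.norm_of_nonneg (kern_nonneg n m _)]
    exact mul_le_mul_of_nonneg_left (hg t) (kern_nonneg n m _)
  rwa [integral_mul_const, integral_sub_left_eq_self (fun t => kern n m t), kern_integral,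
    one_mul] at h1

end Convolution

/-! ### Cutoff functions between concentric balls -/

section CutoffExistence

variable {n : ℕ}

/-- Cutoff functions between concentric balls, with derivative bounds that depend only on the
distance of the spheres. -/
theorem exists_isCutoff (n : ℕ) : ∃ c : ℕ → ℝ, ∀ (y : Pt n) (ρ r : ℝ), 0 < ρ → ρ < r →
    ∃ η : Pt n → ℝ, IsCutoff c (r - ρ) η ∧ (∀ x ∈ ball y ρ, η x = 1) ∧ ∀ x, x ∉ ball y r → η x = 0 := by
  refine ⟨fun j => 2 ^ j * ∑ α : Fin j → Fin n, ∫ t, |partialDeriv α (kern n 0) t|,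
    fun y ρ r hρ hr => ?_⟩
  have hL : 0 < r - ρ := sub_pos.2 hr
  -- In the variable (2/(r - ρ))(x - y) the two spheres have radii a - 1 and a + 1. Mollifying the
  -- indicator of the ball of radius a at scale one therefore fits between them.
  set a : ℝ := (ρ + (r - ρ) / 2) / ((r - ρ) / 2) with ha
  set S : Pt n → ℝ := (ball 0 a).indicator 1 with hS
  have hS0 : ∀ x, 0 ≤ S x := fun x => indicator_nonneg (fun _ _ => zero_le_one) x
  have hS1 : ∀ x, S x ≤ 1 := fun x => indicator_le_self' (fun _ _ => zero_le_one) x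
  have hSi : LocallyIntegrable S := by
    refine Integrable.locallyIntegrable ?_
    refine (integrable_indicator_iff measurableSet_ball).2 ?_
    exact integrableOn_const (measure_ball_lt_top.ne)
  set η₁ := cv (kern n 0) S with hη₁
  have hs₁ : ContDiff ℝ ∞ η₁ := contDiff_cv (kern_contDiff n 0) (kern_hasCompactSupport n 0) hSi
  have hkS : ∀ x, Integrable fun t => kern n 0 (x - t) * S t := by
    intro x
    have := ((kern_integrable n 0).comp_sub_left x).bdd_mul (c := 1) hSi.aestronglyMeasurable
      (Eventually.of_forall fun t => by rw [Real.norm_of_nonneg (hS0 t)]; exact hS1 t)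
    simpa only [mul_comm] using this
  have h0 : ∀ x, 0 ≤ η₁ x := fun x => integral_nonneg fun t => mul_nonneg (kern_nonneg _ _ _) (hS0 t)
  have h1 : ∀ x, η₁ x ≤ 1 := by
    intro x
    refine (le_abs_self _).trans (abs_cv_kern_le (fun t => ?_) 0 x)
    rw [abs_of_nonneg (hS0 t)]; exact hS1 t
  have hsupp : ∀ z : Pt n, 1 < ‖z‖ → kern n 0 z = 0 := by
    intro z hz
    refine image_eq_zero_of_notMem_tsupport fun h => ?_
    rw [tsupport_kern] at h
    simp at h
    linarith
  have hsupp' : ∀ z : Pt n, 1 ≤ ‖z‖ → kern n 0 z = 0 := by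
    intro z hz
    have : z ∉ Function.support (kern n 0) := by
      have e : Function.support (kern n 0) = ball 0 (bump n 0).rOut := (bump n 0).support_normed_eq
      rw [e]
      simp [bump, hz]
    simpa using this
  have hone : ∀ x : Pt n, ‖x‖ < a - 1 → η₁ x = 1 := by
    intro x hx
    rw [hη₁, cv]
    have : ∀ t, kern n 0 (x - t) * S t = kern n 0 (x - t) := by
      intro t
      by_cases ht : t ∈ ball (0 : Pt n) a
      · simp [hS, ht]
      · rw [hsupp, zero_mul]
        simp only [mem_ball, dist_zero_right, not_lt] at ht
        have := norm_sub_norm_le t x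
        rw [norm_sub_rev] at this
        linarith
    simp_rw [this]
    rw [integral_sub_left_eq_self (fun t => kern n 0 t), kern_integral]
  have hzero : ∀ x : Pt n, a + 1 ≤ ‖x‖ → η₁ x = 0 := by
    intro x hx
    rw [hη₁, cv]
    have : ∀ t, kern n 0 (x - t) * S t = 0 := by
      intro t
      by_cases ht : t ∈ ball (0 : Pt n) a
      · rw [hsupp', zero_mul]
        simp only [mem_ball, dist_zero_right] at ht
        have := norm_sub_norm_le x t
        linarith
      · simp [hS, ht]
    simp [this]
  -- All derivatives fall on the kernel, so the bound does not see a; the rescaling later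
  -- contributes 2^j / (r - ρ)^j.
  have hD : ∀ (j : ℕ) (x : Pt n), ‖iteratedFDeriv ℝ j η₁ x‖ ≤
      ∑ α : Fin j → Fin n, ∫ t, |partialDeriv α (kern n 0) t| := by
    intro j x
    refine (norm_iteratedFDeriv_le_sum η₁ x).trans (Finset.sum_le_sum fun α _ => ?_)
    rw [hη₁, partialDeriv_cv (kern_contDiff n 0) (kern_hasCompactSupport n 0) hSi, cv,
      ← Real.norm_eq_abs, ← integral_sub_left_eq_self (fun t => |partialDeriv α (kern n 0) t|) _ x]
    have ht := isTest_partialDeriv (U := univ) ⟨kern_contDiff n 0, kern_hasCompactSupport n 0,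
      subset_univ _⟩ α
    refine norm_integral_le_of_norm_le
      (((ht.1.continuous.integrable_of_hasCompactSupport ht.2.1).abs).comp_sub_left x)
      (Eventually.of_forall fun t => ?_)
    rw [norm_mul, Real.norm_eq_abs, Real.norm_of_nonneg (hS0 t)]
    exact mul_le_of_le_one_right (abs_nonneg _) (hS1 t)
  set b : ℝ := 2 / (r - ρ) with hb
  have hb0 : 0 < b := by positivity
  have hnorm : ∀ x : Pt n, ‖b • (x - y)‖ = b * dist x y := fun x => by
    rw [norm_smul, Real.norm_of_nonneg hb0.le, dist_eq_norm]
  have haρ : a - 1 = b * ρ := by rw [ha, hb]; field_simp; ring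
  have har : a + 1 = b * r := by rw [ha, hb]; field_simp; ring
  refine ⟨fun x => η₁ (b • (x - y)), ⟨?_, fun x => h0 _, fun x => h1 _, fun j x => ?_⟩, ?_, ?_⟩
  · exact hs₁.comp (by fun_prop)
  · have e : iteratedFDeriv ℝ j (fun x => η₁ (b • (x - y))) x = b ^ j • iteratedFDeriv ℝ j η₁ (b • (x - y)) := by
      rw [iteratedFDeriv_comp_sub (f := fun z => η₁ (b • z)) j y x,
        iteratedFDeriv_comp_const_smul b (contDiff_infty.1 hs₁ j)]
    rw [e, norm_smul, Real.norm_of_nonneg (by positivity)]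
    calc _ ≤ b ^ j * ∑ α : Fin j → Fin n, ∫ t, |partialDeriv α (kern n 0) t| := by
          gcongr; exact hD j _
      _ = _ := by rw [hb, div_pow]; ring
  · intro x hx
    apply hone
    rw [hnorm, haρ]
    exact mul_lt_mul_of_pos_left hx hb0
  · intro x hx
    apply hzero
    rw [hnorm, har]
    exact mul_le_mul_of_nonneg_left (not_lt.1 hx) hb0.le

end CutoffExistence

end OrliczSym

namespace OrliczSym

open Filter Topology

/-! ### A Sobolev inequality by the Fourier transform -/

section FourierSup

variable {n : ℕ}

open scoped SchwartzMap FourierTransform LineDeriv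

/-- The `m`-fold derivative of a Schwartz function in the `i`-th coordinate direction. -/
noncomputable def schwartzPd (i : Fin n) : ℕ → 𝓢(Pt n, ℂ) → 𝓢(Pt n, ℂ)
  | 0, f => f
  | m + 1, f => ∂_{(EuclideanSpace.single i (1 : ℝ) : Pt n)} (schwartzPd i m f)

theorem norm_fourier_schwartzPd (i : Fin n) (m : ℕ) (f : 𝓢(Pt n, ℂ)) (ξ : Pt n) :
    ‖𝓕 (schwartzPd i m f) ξ‖ = (2 * Real.pi * |ξ i|) ^ m * ‖𝓕 f ξ‖ := by
  induction m with
  | zero => simp [schwartzPd]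
  | succ m ih =>
    have hg : (fun x : Pt n => inner ℝ x (EuclideanSpace.single i (1 : ℝ) : Pt n)).HasTemperateGrowth :=
      ((innerSL ℝ).flip (EuclideanSpace.single i (1 : ℝ) : Pt n)).hasTemperateGrowth
    rw [schwartzPd, SchwartzMap.fourier_lineDerivOp_eq, smul_apply,
      SchwartzMap.smulLeftCLM_apply_apply hg, norm_smul, norm_smul, ih]
    have h1 : ‖(2 * Real.pi * Complex.I : ℂ)‖ = 2 * Real.pi := by
      simp [abs_of_pos Real.pi_pos]
    have h2 : ‖inner ℝ ξ (EuclideanSpace.single i (1 : ℝ) : Pt n)‖ = |ξ i| := by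
      rw [EuclideanSpace.inner_single_right]; simp
    rw [h1, h2, pow_succ]
    ring

theorem schwartzPd_apply (i : Fin n) (m : ℕ) {v : Pt n → ℝ} (hv : ContDiff ℝ ∞ v)
    (f : 𝓢(Pt n, ℂ)) (hf : ∀ x, f x = (v x : ℂ)) (x : Pt n) :
    schwartzPd i m f x = (partialDeriv (fun _ : Fin m => i) v x : ℂ) := by
  induction m generalizing x with
  | zero => simp [schwartzPd, hf, partialDeriv_zero]
  | succ m ih =>
    rw [schwartzPd, SchwartzMap.lineDerivOp_apply_eq_fderiv, partialDeriv_succ hv]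
    have e : (fun x => (schwartzPd i m f) x) =
        fun x => Complex.ofRealCLM (partialDeriv (fun _ : Fin m => i) v x) := funext ih
    have hd := ((contDiff_partialDeriv hv (fun _ : Fin m => i)).differentiable (by simp)) x
    have h2 := (Complex.ofRealCLM.hasFDerivAt.comp x hd.hasFDerivAt).fderiv
    have h3 := (congrArg (fun q => fderiv ℝ q x) e).trans h2
    have h4 : fderiv ℝ (schwartzPd i m f) x = fderiv ℝ (fun x => (schwartzPd i m f) x) x := rfl
    rw [h4, h3]
    rfl

/-- The power mean inequality for the n + 1 numbers 1, |ξ₁|, …, |ξₙ|. Because of it only unmixed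
derivatives are needed in the Sobolev inequality. -/
theorem one_add_norm_pow_le (m : ℕ) (ξ : Pt n) :
    (1 + ‖ξ‖) ^ (2 * m) ≤ (n + 1 : ℝ) ^ (2 * m) * (1 + ∑ i, |ξ i| ^ (2 * m)) := by
  rcases Nat.eq_zero_or_pos m with rfl | hm
  · simp
  have h1 : ‖ξ‖ ≤ ∑ i, |ξ i| := by
    have : ξ = ∑ i, ξ i • (EuclideanSpace.single i 1 : Pt n) := by
      ext b; simp [Pi.single_apply]
    conv_lhs => rw [this]
    refine (norm_sum_le _ _).trans (Finset.sum_le_sum fun i _ => ?_)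
    rw [norm_smul]; simp
  have h3 := pow_sum_div_card_le_sum_pow (s := (Finset.univ : Finset (Option (Fin n))))
    (f := fun o => o.elim 1 fun i => |ξ i|)
    (fun o _ => by cases o <;> simp) (2 * m - 1)
  rw [show 2 * m - 1 + 1 = 2 * m by omega] at h3
  simp only [Fintype.sum_option, Option.elim, Finset.card_univ, Fintype.card_option,
    Fintype.card_fin, one_pow] at h3
  rw [div_le_iff₀ (by positivity)] at h3
  have hS : 0 ≤ 1 + ∑ i, |ξ i| ^ (2 * m) := by positivity
  calc (1 + ‖ξ‖) ^ (2 * m) ≤ (1 + ∑ i, |ξ i|) ^ (2 * m) := by gcongr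
    _ ≤ _ := h3
    _ = ((n + 1 : ℕ) : ℝ) ^ (2 * m - 1) * (1 + ∑ i, |ξ i| ^ (2 * m)) := by ring
    _ ≤ _ := by
        push_cast
        gcongr
        · have : (0 : ℝ) ≤ n := by positivity
          linarith
        · omega

/-- A quantitative Sobolev inequality for smooth functions with compact support. -/
theorem exists_sup_bound {m : ℕ} (hm : n < 2 * m) : ∃ C : ℝ, 0 < C ∧
    ∀ v : Pt n → ℝ, ContDiff ℝ ∞ v → HasCompactSupport v → ∀ t : ℝ, 0 < t → ∀ x,
      |v x| ≤ C * (t + 1 / t * ((∫ y, v y ^ 2) +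
        ∑ i, ∫ y, partialDeriv (fun _ : Fin m => i) v y ^ 2)) := by
  set J := ∫ ξ : Pt n, (1 + ‖ξ‖) ^ (-(2 * m : ℝ)) with hJ
  -- Integrability of this weight is where n < 2m enters.
  have hJi : Integrable fun ξ : Pt n => (1 + ‖ξ‖) ^ (-(2 * m : ℝ)) := by
    refine integrable_one_add_norm ?_
    simp only [finrank_euclideanSpace, Fintype.card_fin]
    exact_mod_cast hm
  have hJ0 : 0 ≤ J := integral_nonneg fun ξ => by positivity
  refine ⟨J + (n + 1 : ℝ) ^ (2 * m), by positivity, fun v hv hvc t ht x => ?_⟩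
  have hvC : ContDiff ℝ ∞ (fun x => (v x : ℂ)) := Complex.ofRealCLM.contDiff.comp hv
  have hcC : HasCompactSupport (fun x => (v x : ℂ)) := hvc.comp_left (g := fun r : ℝ => (r : ℂ)) (by simp)
  set f : 𝓢(Pt n, ℂ) := hcC.toSchwartzMap hvC with hf
  have hfv : ∀ x, f x = (v x : ℂ) := fun x => rfl
  set F : 𝓢(Pt n, ℂ) := 𝓕 f with hF
  have hFi : Integrable F := F.integrable
  have sq_int : ∀ G : 𝓢(Pt n, ℂ), Integrable fun ξ => ‖G ξ‖ ^ 2 := fun G =>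
    (G.memLp 2).norm.integrable_sq
  -- Fourier inversion bounds the supremum by the L¹ norm of the transform.
  have hsup : |v x| ≤ ∫ ξ, ‖F ξ‖ := by
    have h1 : 𝓕⁻ (𝓕 f) x = f x := by rw [FourierTransform.fourierInv_fourier_eq]
    rw [← Real.norm_eq_abs, ← Complex.norm_real, ← hfv, ← h1, SchwartzMap.fourierInv_coe]
    exact VectorFourier.norm_fourierIntegral_le_integral_norm _ _ _ _ _
  have hpt : ∀ ξ, ‖F ξ‖ ≤ t * (1 + ‖ξ‖) ^ (-(2 * m : ℝ)) + 1 / t * ((n + 1 : ℝ) ^ (2 * m) *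
      (‖F ξ‖ ^ 2 + ∑ i, ‖𝓕 (schwartzPd i m f) ξ‖ ^ 2)) := by
    intro ξ
    have hq := one_add_norm_pow_le m ξ
    have e1 : (1 + ‖ξ‖) ^ (-(2 * m : ℝ)) = ((1 + ‖ξ‖) ^ (2 * m))⁻¹ := by
      rw [Real.rpow_neg (by positivity)]
      congr 1
      exact_mod_cast Real.rpow_natCast (1 + ‖ξ‖) (2 * m)
    rw [e1]
    set q := (1 + ‖ξ‖) ^ (2 * m) with hqdef
    have hq0 : 0 < q := by positivity
    have h3 : q * ‖F ξ‖ ^ 2 ≤ (n + 1 : ℝ) ^ (2 * m) *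
        (‖F ξ‖ ^ 2 + ∑ i, ‖𝓕 (schwartzPd i m f) ξ‖ ^ 2) := by
      calc q * ‖F ξ‖ ^ 2 ≤ (n + 1 : ℝ) ^ (2 * m) * (1 + ∑ i, |ξ i| ^ (2 * m)) * ‖F ξ‖ ^ 2 := by gcongr
        _ = (n + 1 : ℝ) ^ (2 * m) * (‖F ξ‖ ^ 2 + ∑ i, (|ξ i| ^ m * ‖F ξ‖) ^ 2) := by
            rw [mul_assoc, add_mul, one_mul, Finset.sum_mul]
            congr 3
            funext i
            rw [mul_pow, ← pow_mul, mul_comm m 2]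
        _ ≤ _ := by
            gcongr with i
            rw [norm_fourier_schwartzPd]
            have hpi : 1 ≤ 2 * Real.pi := by linarith [Real.pi_gt_three]
            have : |ξ i| ≤ 2 * Real.pi * |ξ i| := by nlinarith [abs_nonneg (ξ i)]
            gcongr
    -- Young's inequality replaces the Cauchy–Schwarz inequality: the first term is integrable, the
    -- second becomes an L² norm by Plancherel, and t stays free.
    have h4 : ‖F ξ‖ ≤ t * q⁻¹ + 1 / t * (q * ‖F ξ‖ ^ 2) := by
      have h5 : 0 ≤ 1 / (t * q) * ((t - q * ‖F ξ‖) ^ 2 + t * q * ‖F ξ‖) := by positivity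
      have h6 : 1 / (t * q) * ((t - q * ‖F ξ‖) ^ 2 + t * q * ‖F ξ‖) =
        t * q⁻¹ + 1 / t * (q * ‖F ξ‖ ^ 2) - ‖F ξ‖ := by field_simp; ring
      linarith
    refine h4.trans ?_
    gcongr
  have hsi : Integrable fun ξ => ‖F ξ‖ ^ 2 + ∑ i, ‖𝓕 (schwartzPd i m f) ξ‖ ^ 2 :=
    (sq_int F).add (integrable_finsetSum _ fun i _ => sq_int _)
  have hint : Integrable fun ξ => t * (1 + ‖ξ‖) ^ (-(2 * m : ℝ)) + 1 / t * ((n + 1 : ℝ) ^ (2 * m) *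
      (‖F ξ‖ ^ 2 + ∑ i, ‖𝓕 (schwartzPd i m f) ξ‖ ^ 2)) :=
    (hJi.const_mul t).add ((hsi.const_mul _).const_mul _)
  have h7 := hsup.trans (integral_mono hFi.norm hint hpt)
  have hS : ∫ ξ, (‖F ξ‖ ^ 2 + ∑ i, ‖𝓕 (schwartzPd i m f) ξ‖ ^ 2) =
      (∫ y, v y ^ 2) + ∑ i, ∫ y, partialDeriv (fun _ : Fin m => i) v y ^ 2 := by
    rw [integral_add (sq_int F) (integrable_finsetSum _ fun i _ => sq_int _),
      integral_finsetSum _ fun i _ => sq_int _, hF, SchwartzMap.integral_norm_sq_fourier]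
    congr 1
    · refine integral_congr_ae (Eventually.of_forall fun y => ?_)
      simp only [hfv, Complex.norm_real, Real.norm_eq_abs, sq_abs]
    · refine Finset.sum_congr rfl fun i _ => ?_
      rw [SchwartzMap.integral_norm_sq_fourier]
      refine integral_congr_ae (Eventually.of_forall fun y => ?_)
      simp only [schwartzPd_apply i m hv f hfv, Complex.norm_real, Real.norm_eq_abs, sq_abs]
  rw [integral_add (hJi.const_mul t) ((hsi.const_mul _).const_mul _), integral_const_mul,
      integral_const_mul, integral_const_mul, hS, ← hJ] at h7
  set S := (∫ y, v y ^ 2) + ∑ i, ∫ y, partialDeriv (fun _ : Fin m => i) v y ^ 2 with hSdef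
  have hS0 : 0 ≤ S := add_nonneg (integral_nonneg fun _ => sq_nonneg _)
    (Finset.sum_nonneg fun _ _ => integral_nonneg fun _ => sq_nonneg _)
  refine h7.trans ?_
  have h8 : 0 ≤ 1 / t * S := by positivity
  have h9 : 0 ≤ (n + 1 : ℝ) ^ (2 * m) := by positivity
  nlinarith [mul_nonneg hJ0 h8, mul_nonneg h9 ht.le]

end FourierSup

/-! ### Mollification in L² -/

section LTwoMollification

variable {n : ℕ}

theorem integrable_kern_mul {g : Pt n → ℝ} (hg : LocallyIntegrable g) (m : ℕ) (x : Pt n) :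
    Integrable fun t => kern n m (x - t) * g t := by
  have h := (kern_hasCompactSupport n m).convolutionExists_left (ContinuousLinearMap.lsmul ℝ ℝ)
    (kern_contDiff n m).continuous hg x
  have h2 := ((integrable_comp_sub_left (fun t => kern n m t * g (x - t)) x).2 h)
  simpa using h2

theorem cv_kern_sub {f g : Pt n → ℝ} (hf : LocallyIntegrable f) (hg : LocallyIntegrable g) (m : ℕ)
    (x : Pt n) : cv (kern n m) (f - g) x = cv (kern n m) f x - cv (kern n m) g x := by
  rw [cv, cv, cv, ← integral_sub (integrable_kern_mul hf m x) (integrable_kern_mul hg m x)]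
  exact integral_congr_ae (Eventually.of_forall fun t => by simp only [Pi.sub_apply]; ring)

theorem continuous_cv_kern {g : Pt n → ℝ} (hg : LocallyIntegrable g) (m : ℕ) :
    Continuous (cv (kern n m) g) :=
  (contDiff_cv (kern_contDiff n m) (kern_hasCompactSupport n m) hg).continuous

/-- Jensen's inequality, in the form that the variance with respect to a probability density is
nonnegative. -/
theorem cv_kern_sq_le {g : Pt n → ℝ} (hg : LocallyIntegrable g)
    (hg2 : LocallyIntegrable fun x => g x ^ 2) (m : ℕ) (x : Pt n) :
    cv (kern n m) g x ^ 2 ≤ cv (kern n m) (fun x => g x ^ 2) x := by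
  set c := cv (kern n m) g x with hc
  have h0 : 0 ≤ ∫ t, kern n m (x - t) * (g t - c) ^ 2 :=
    integral_nonneg fun t => mul_nonneg (kern_nonneg _ _ _) (sq_nonneg _)
  have e : ∫ t, kern n m (x - t) * (g t - c) ^ 2 = cv (kern n m) (fun x => g x ^ 2) x - c ^ 2 := by
    have e1 : ∀ t, kern n m (x - t) * (g t - c) ^ 2 = kern n m (x - t) * g t ^ 2 -
        (2 * c) * (kern n m (x - t) * g t) + c ^ 2 * kern n m (x - t) := fun t => by ring
    simp_rw [e1]
    rw [integral_add, integral_sub, integral_const_mul, integral_const_mul,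
      integral_sub_left_eq_self (fun t => kern n m t), kern_integral]
    · have : ∫ t, kern n m (x - t) * g t = c := rfl
      rw [this, cv]; ring
    · exact integrable_kern_mul hg2 m x
    · exact (integrable_kern_mul hg m x).const_mul _
    · exact (integrable_kern_mul hg2 m x).sub ((integrable_kern_mul hg m x).const_mul _)
    · exact ((kern_integrable n m).comp_sub_left x).const_mul _
  linarith

theorem integrable_cv_kern {g : Pt n → ℝ} (hg : Integrable g) (m : ℕ) :
    Integrable (cv (kern n m) g) ∧ ∫ x, cv (kern n m) g x = ∫ x, g x := by
  rw [cv_eq_lsmul]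
  refine ⟨(kern_integrable n m).integrable_convolution _ hg, ?_⟩
  rw [integral_convolution _ (kern_integrable n m) hg, kern_integral]
  simp

theorem memLp_two_cv_kern {g : Pt n → ℝ} (hg : MemLp g 2) (m : ℕ) :
    Integrable (fun x => cv (kern n m) g x ^ 2) ∧ ∫ x, cv (kern n m) g x ^ 2 ≤ ∫ x, g x ^ 2 := by
  have hl := hg.locallyIntegrable (by norm_num)
  have h2 := hg.integrable_sq
  obtain ⟨h3, h4⟩ := integrable_cv_kern h2 m
  have hi : Integrable (fun x => cv (kern n m) g x ^ 2) := by
    refine h3.mono' ((continuous_cv_kern hl m).pow 2).aestronglyMeasurable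
      (Eventually.of_forall fun x => ?_)
    rw [Real.norm_of_nonneg (sq_nonneg _)]
    exact cv_kern_sq_le hl h2.locallyIntegrable m x
  exact ⟨hi, (integral_mono hi h3 (cv_kern_sq_le hl h2.locallyIntegrable m)).trans_eq h4⟩

theorem integrable_sub_cv_sq {g : Pt n → ℝ} (hg : MemLp g 2) (m : ℕ) :
    Integrable fun x => (cv (kern n m) g x - g x) ^ 2 := by
  have hl := hg.locallyIntegrable (by norm_num)
  have h1 : MemLp (cv (kern n m) g) 2 :=
    (memLp_two_iff_integrable_sq (continuous_cv_kern hl m).aestronglyMeasurable).2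
      (memLp_two_cv_kern hg m).1
  exact (h1.sub hg).integrable_sq

/-- Mollifications of a compactly supported continuous function converge in `L²`. -/
theorem tendsto_integral_cv_sub_sq_of_continuous {h : Pt n → ℝ} (hh : Continuous h)
    (hc : HasCompactSupport h) {ε : ℝ} (hε : 0 < ε) :
    ∀ᶠ m in atTop, ∫ x, (cv (kern n m) h x - h x) ^ 2 ≤ ε := by
  obtain ⟨R, hR⟩ := hc.isCompact.isBounded.subset_closedBall (0 : Pt n)
  set K := closedBall (0 : Pt n) (R + 1)
  have hK : volume K < ⊤ := measure_closedBall_lt_top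
  set M := (volume K).toReal with hM
  have hM0 : 0 ≤ M := ENNReal.toReal_nonneg
  set d := √(ε / (M + 1)) with hd
  have hd0 : 0 < d := Real.sqrt_pos.2 (by positivity)
  have hunif := hc.uniformContinuous_of_continuous hh
  obtain ⟨δ, hδ, hδ'⟩ := Metric.uniformContinuous_iff.1 hunif d hd0
  have hev : ∀ᶠ m in atTop, (bump n m).rOut < δ := (tendsto_rOut n).eventually (gt_mem_nhds hδ)
  filter_upwards [hev] with m hm
  have hpt : ∀ x, (cv (kern n m) h x - h x) ^ 2 ≤ K.indicator (fun _ => d ^ 2) x := by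
    intro x
    by_cases hx : x ∈ K
    · rw [indicator_of_mem hx, ← sq_abs (_ - _)]
      gcongr
      rw [cv_eq_lsmul, ← Real.dist_eq]
      refine ContDiffBump.dist_normed_convolution_le hh.aestronglyMeasurable fun y hy => ?_
      exact (hδ' (lt_trans hy hm)).le
    · rw [indicator_of_notMem hx]
      have hnx : R + 1 < ‖x‖ := by simpa [K] using hx
      have hz : ∀ y, R < ‖y‖ → h y = 0 := fun y hy => by
        refine image_eq_zero_of_notMem_tsupport fun hy' => ?_
        have := hR hy'
        simp at this
        linarith
      have h1 : cv (kern n m) h x = 0 := by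
        rw [cv]
        have : ∀ t, kern n m (x - t) * h t = 0 := by
          intro t
          by_cases ht : R < ‖t‖
          · rw [hz t ht, mul_zero]
          · have h2 : kern n m (x - t) = 0 := by
              refine image_eq_zero_of_notMem_tsupport fun hy' => ?_
              rw [tsupport_kern] at hy'
              simp only [mem_closedBall, dist_zero_right] at hy'
              have h3 := norm_sub_norm_le x t
              have h4 : (1 : ℝ) / (m + 1) ≤ 1 := by
                rw [div_le_one (by positivity)]
                have : (0 : ℝ) ≤ m := by positivity
                linarith
              push Not at ht
              linarith
            rw [h2, zero_mul]
        simp [this]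
      rw [h1, hz x (by linarith)]; simp
  have hmem : MemLp h 2 := hh.memLp_of_hasCompactSupport hc
  refine (integral_mono (integrable_sub_cv_sq hmem m) ?_ hpt).trans ?_
  · exact (integrable_indicator_iff measurableSet_closedBall).2 (integrableOn_const hK.ne)
  · rw [integral_indicator measurableSet_closedBall, setIntegral_const, smul_eq_mul]
    have : d ^ 2 = ε / (M + 1) := Real.sq_sqrt (by positivity)
    rw [this, Measure.real, ← hM, mul_div_assoc', div_le_iff₀ (by positivity)]
    nlinarith

/-- Mollifications of an `L²` function converge in `L²`. -/
theorem tendsto_integral_cv_sub_sq {g : Pt n → ℝ} (hg : MemLp g 2) {ε : ℝ} (hε : 0 < ε) :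
    ∀ᶠ m in atTop, ∫ x, (cv (kern n m) g x - g x) ^ 2 ≤ ε := by
  -- Each of three differences has squared norm at most ε / 9, and the square of a sum of three
  -- terms costs a factor 3.
  obtain ⟨h, hc, hle, hh, hm⟩ := hg.exists_hasCompactSupport_eLpNorm_sub_le (by norm_num)
    (ε := ENNReal.ofReal √(ε / 9)) (by
      simp only [ne_eq, ENNReal.ofReal_eq_zero, not_le]
      exact Real.sqrt_pos.2 (by positivity))
  have hgh := hg.sub hm
  have h1 : ∫ x, (g - h) x ^ 2 ≤ ε / 9 := by
    have e := hgh.eLpNorm_eq_integral_rpow_norm (by norm_num) (by norm_num)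
    rw [e] at hle
    have h2 := (ENNReal.ofReal_le_ofReal_iff (Real.sqrt_nonneg _)).1 hle
    simp only [ENNReal.toReal_ofNat, Real.rpow_ofNat, Real.norm_eq_abs, sq_abs] at h2
    rw [← one_div, ← Real.sqrt_eq_rpow] at h2
    exact (Real.sqrt_le_sqrt_iff (by positivity)).1 h2
  filter_upwards [tendsto_integral_cv_sub_sq_of_continuous hh hc (by positivity : 0 < ε / 9)]
    with m hmm
  have hlg := hg.locallyIntegrable (by norm_num)
  have hlh := hm.locallyIntegrable (by norm_num)
  obtain ⟨i1, b1⟩ := memLp_two_cv_kern hgh m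
  have i2 := integrable_sub_cv_sq hm m
  have i3 := hgh.integrable_sq
  have hpt : ∀ x, (cv (kern n m) g x - g x) ^ 2 ≤
      3 * (cv (kern n m) (g - h) x ^ 2 + (cv (kern n m) h x - h x) ^ 2 + (g - h) x ^ 2) := by
    intro x
    rw [cv_kern_sub hlg hlh, Pi.sub_apply]
    set a := cv (kern n m) g x
    set b := cv (kern n m) h x
    nlinarith [sq_nonneg ((a - b) - (b - h x)), sq_nonneg ((a - b) + (g x - h x)),
      sq_nonneg ((b - h x) + (g x - h x))]
  have := integral_mono (integrable_sub_cv_sq hg m) (((i1.add i2).add i3).const_mul 3) hpt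
  refine this.trans ?_
  have e3 : ∫ x, 3 * ((((fun x => cv (kern n m) (g - h) x ^ 2) + fun x => (cv (kern n m) h x - h x) ^ 2) +
      fun x => (g - h) x ^ 2) x) = 3 * ((∫ x, cv (kern n m) (g - h) x ^ 2) +
      (∫ x, (cv (kern n m) h x - h x) ^ 2) + ∫ x, (g - h) x ^ 2) := by
    rw [integral_const_mul, integral_add' (i1.add i2) i3, integral_add' i1 i2]
  rw [e3]
  linarith

theorem integral_cv_sub_cv_sq_eventually {g : Pt n → ℝ} (hg : MemLp g 2) {ε : ℝ} (hε : 0 < ε) :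
    ∃ M, ∀ a ≥ M, ∀ b ≥ M, Integrable (fun x => (cv (kern n a) g x - cv (kern n b) g x) ^ 2) ∧
      ∫ x, (cv (kern n a) g x - cv (kern n b) g x) ^ 2 ≤ ε := by
  obtain ⟨M, hM⟩ := eventually_atTop.1 (tendsto_integral_cv_sub_sq hg (by positivity : 0 < ε / 4))
  have hl := hg.locallyIntegrable (by norm_num)
  have hmem : ∀ m, MemLp (cv (kern n m) g) 2 := fun m =>
    (memLp_two_iff_integrable_sq (continuous_cv_kern hl m).aestronglyMeasurable).2
      (memLp_two_cv_kern hg m).1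
  refine ⟨M, fun a ha b hb => ?_⟩
  have hi : Integrable (fun x => (cv (kern n a) g x - cv (kern n b) g x) ^ 2) :=
    ((hmem a).sub (hmem b)).integrable_sq
  refine ⟨hi, ?_⟩
  have i1 := integrable_sub_cv_sq hg a
  have i2 := integrable_sub_cv_sq hg b
  refine (integral_mono hi ((i1.add i2).const_mul 2) fun x => ?_).trans ?_
  · simp only [Pi.add_apply]
    nlinarith [sq_nonneg ((cv (kern n a) g x - g x) + (cv (kern n b) g x - g x))]
  · rw [integral_const_mul, integral_add' i1 i2]
    linarith [hM a ha, hM b hb]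

end LTwoMollification

end OrliczSym

namespace OrliczSym

open Filter Topology

/-! ### Continuous representatives of Sobolev functions -/

section Representative

variable {n : ℕ}

theorem partialDeriv_sub {m : ℕ} {f g : Pt n → ℝ} (hf : ContDiff ℝ ∞ f) (hg : ContDiff ℝ ∞ g)
    (α : Fin m → Fin n) (x : Pt n) :
    partialDeriv α (f - g) x = partialDeriv α f x - partialDeriv α g x := by
  unfold partialDeriv
  rw [iteratedFDeriv_sub_apply (contDiff_infty.1 hf m).contDiffAt
    (contDiff_infty.1 hg m).contDiffAt]
  rfl

/-- Multiplication by a fixed cutoff function is bounded on derivatives of order at most `m`. -/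
theorem exists_partialDeriv_mul_sq_le {η : Pt n → ℝ} (hη : ContDiff ℝ ∞ η)
    (hc : HasCompactSupport η) (m : ℕ) : ∃ K : ℝ, 0 ≤ K ∧
    ∀ w : Pt n → ℝ, ContDiff ℝ ∞ w → ∀ l ≤ m, ∀ (α : Fin l → Fin n) (x : Pt n),
      partialDeriv α (fun y => η y * w y) x ^ 2 ≤ K * ∑ j ∈ Finset.range (m + 1), gradSq j w x := by
  have hb : ∀ i, ∃ A, 0 ≤ A ∧ ∀ x, ‖iteratedFDeriv ℝ i η x‖ ≤ A := by
    intro i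
    obtain ⟨A, hA⟩ := (hc.iteratedFDeriv (𝕜 := ℝ) i).exists_bound_of_continuous
      (hη.continuous_iteratedFDeriv (by exact_mod_cast le_top))
    exact ⟨A, (norm_nonneg _).trans (hA 0), hA⟩
  choose A hA0 hA using hb
  set A' := ∑ i ∈ Finset.range (m + 1), A i with hA'
  have hA'0 : 0 ≤ A' := Finset.sum_nonneg fun i _ => hA0 i
  refine ⟨(2 ^ m * A') ^ 2 * ((m + 1) * ∑ j ∈ Finset.range (m + 1), (n : ℝ) ^ j), by positivity,
    fun w hw l hl α x => ?_⟩
  set T := ∑ j ∈ Finset.range (m + 1), ‖iteratedFDeriv ℝ j w x‖ with hT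
  have hT0 : 0 ≤ T := Finset.sum_nonneg fun i _ => norm_nonneg _
  have h1 : |partialDeriv α (fun y => η y * w y) x| ≤ 2 ^ m * A' * T := by
    refine (abs_partialDeriv_le _ _ _).trans ((norm_iteratedFDeriv_mul_le hη hw x (n := l)
      (by exact_mod_cast le_top)).trans ?_)
    calc _ ≤ ∑ i ∈ Finset.range (l + 1), (l.choose i : ℝ) * A' * T := by
          refine Finset.sum_le_sum fun i hi => ?_
          have hi' := Finset.mem_range.1 hi
          gcongr
          · refine (hA i x).trans ?_
            exact Finset.single_le_sum (f := A) (fun i _ => hA0 i) (Finset.mem_range.2 (by omega))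
          · exact Finset.single_le_sum (f := fun j => ‖iteratedFDeriv ℝ j w x‖)
              (fun i _ => norm_nonneg _) (Finset.mem_range.2 (by omega))
      _ = 2 ^ l * A' * T := by
          rw [← Finset.sum_mul, ← Finset.sum_mul]
          congr 2
          exact_mod_cast Nat.sum_range_choose l
      _ ≤ _ := by
          gcongr
          norm_num
  have h2 : T ^ 2 ≤ ((m + 1) * ∑ j ∈ Finset.range (m + 1), (n : ℝ) ^ j) *
      ∑ j ∈ Finset.range (m + 1), gradSq j w x := by
    refine sq_sum_le_card_mul_sum_sq.trans ?_
    rw [Finset.card_range, mul_assoc]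
    push_cast
    gcongr
    rw [Finset.mul_sum]
    refine Finset.sum_le_sum fun j hj => (norm_iteratedFDeriv_sq_le j w x).trans ?_
    have := gradSq_nonneg j w x
    gcongr
    exact Finset.single_le_sum (f := fun j => (n : ℝ) ^ j) (fun _ _ => by positivity) hj
  rw [← sq_abs]
  calc _ ≤ (2 ^ m * A' * T) ^ 2 := by gcongr
    _ = (2 ^ m * A') ^ 2 * T ^ 2 := by ring
    _ ≤ (2 ^ m * A') ^ 2 * (((m + 1) * ∑ j ∈ Finset.range (m + 1), (n : ℝ) ^ j) *
      ∑ j ∈ Finset.range (m + 1), gradSq j w x) := by gcongr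
    _ = _ := by ring

/-- `v` has square integrable weak derivatives of order at most `m` in `U`. -/
def SqWeakDerivs (m : ℕ) (U : Set (Pt n)) (v : Pt n → ℝ) : Prop :=
  ∀ l ≤ m, ∀ α : Fin l → Fin n, ∃ g, IsWeakDeriv U α v g ∧ MemLp g 2 (volume.restrict U)

theorem SqWeakDerivs.isWeakDeriv {m l : ℕ} {U : Set (Pt n)} {v : Pt n → ℝ}
    (h : SqWeakDerivs m U v) (hl : l ≤ m) (α : Fin l → Fin n) :
    IsWeakDeriv U α v (weakDeriv U α v) := by
  obtain ⟨g, hg, -⟩ := h l hl α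
  exact isWeakDeriv_weakDeriv hg

theorem SqWeakDerivs.memLp {m l : ℕ} {U : Set (Pt n)} (hU : IsOpen U) {v : Pt n → ℝ}
    (h : SqWeakDerivs m U v) (hl : l ≤ m) (α : Fin l → Fin n) :
    MemLp (weakDeriv U α v) 2 (volume.restrict U) := by
  obtain ⟨g, hg, hg2⟩ := h l hl α
  exact hg2.ae_eq (hg.ae_eq hU).symm

theorem isWeakDeriv_zero_self {U : Set (Pt n)} {v : Pt n → ℝ} (hv : LocallyIntegrableOn v U)
    (α : Fin 0 → Fin n) : IsWeakDeriv U α v v :=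
  ⟨hv, hv, fun ψ _ => by simp [partialDeriv_zero]⟩

theorem SqWeakDerivs.memLp_self {m : ℕ} {U : Set (Pt n)} (hU : IsOpen U) {v : Pt n → ℝ}
    (h : SqWeakDerivs m U v) : MemLp v 2 (volume.restrict U) := by
  obtain ⟨g, hg, hg2⟩ := h 0 (Nat.zero_le m) Fin.elim0
  exact hg2.ae_eq (hg.unique hU (isWeakDeriv_zero_self hg.1 _))

theorem SqWeakDerivs.integrableOn {m : ℕ} {x₀ : Pt n} {R : ℝ} {v : Pt n → ℝ}
    (h : SqWeakDerivs m (ball x₀ R) v) : IntegrableOn v (ball x₀ R) := by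
  have : IsFiniteMeasure (volume.restrict (ball x₀ R)) := ⟨by
    simpa using measure_ball_lt_top⟩
  exact (h.memLp_self isOpen_ball).integrable (by norm_num)

theorem partialDeriv_cv_kern {l : ℕ} {x₀ : Pt n} {R : ℝ} {v g : Pt n → ℝ} {α : Fin l → Fin n}
    (hv : IntegrableOn v (ball x₀ R)) (h : IsWeakDeriv (ball x₀ R) α v g) {a : ℕ} {x : Pt n}
    (hx : dist x x₀ + 1 / (a + 1) < R) :
    partialDeriv α (cv (kern n a) ((ball x₀ R).indicator v)) x =
      cv (kern n a) ((ball x₀ R).indicator g) x := by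
  refine partialDeriv_cv_indicator measurableSet_ball (kern_contDiff n a)
    (kern_hasCompactSupport n a) hv h fun t ht => ?_
  rw [tsupport_kern, mem_closedBall, dist_zero_right, ← dist_eq_norm, dist_comm] at ht
  exact mem_ball.2 ((dist_triangle t x x₀).trans_lt (by linarith))

theorem eventually_small_radius {δ : ℝ} (hδ : 0 < δ) : ∀ᶠ a : ℕ in atTop, (1 : ℝ) / (a + 1) < δ :=
  tendsto_one_div_add_atTop_nhds_zero_nat.eventually (gt_mem_nhds hδ)

theorem SqWeakDerivs.uniformCauchy {m : ℕ} (hm : n < 2 * m) {x₀ : Pt n} {R R' : ℝ} (hR'0 : 0 < R')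
    (hR : R' < R) {v : Pt n → ℝ} (h : SqWeakDerivs m (ball x₀ R) v) {ε : ℝ} (hε : 0 < ε) :
    ∃ M, ∀ a ≥ M, ∀ b ≥ M, ∀ x ∈ ball x₀ R',
      |cv (kern n a) ((ball x₀ R).indicator v) x - cv (kern n b) ((ball x₀ R).indicator v) x| ≤ ε := by
  obtain ⟨C, hC0, hC⟩ := exists_sup_bound hm
  set R'' := (R' + R) / 2 with hR''
  -- The sup bound needs compact support. On the support of this cutoff, derivatives of late
  -- mollifications are mollifications of weak derivatives, and these are Cauchy in L².
  let η : ContDiffBump x₀ := ⟨R', R'', hR'0, by rw [hR'']; linarith⟩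
  have hηs : ContDiff ℝ ∞ η := η.contDiff
  have hηc : HasCompactSupport η := η.hasCompactSupport
  obtain ⟨K, hK0, hK⟩ := exists_partialDeriv_mul_sq_le hηs hηc m
  set N : ℝ := ∑ j ∈ Finset.range (m + 1), (n : ℝ) ^ j with hN
  have hN0 : 0 ≤ N := by positivity
  -- The two terms of the sup bound are balanced: C t = ε / 2, and ε' below makes the L² part
  -- contribute at most ε / 2 as well.
  set t := ε / (2 * C) with ht
  have ht0 : 0 < t := by positivity
  set ε' := (ε * t / (2 * C)) / ((1 + n) * (K * N) + 1) with hε'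
  have hε'0 : 0 < ε' := by positivity
  have hvi := h.integrableOn
  set G : ∀ j, (Fin j → Fin n) → Pt n → ℝ :=
    fun j β => (ball x₀ R).indicator (weakDeriv (ball x₀ R) β v) with hG
  have hG2 : ∀ j ≤ m, ∀ β : Fin j → Fin n, MemLp (G j β) 2 := fun j hj β =>
    (memLp_indicator_iff_restrict measurableSet_ball).2 (h.memLp isOpen_ball hj β)
  have hev : ∀ᶠ M in atTop, ∀ j ∈ Finset.range (m + 1), ∀ β : Fin j → Fin n, ∀ a ≥ M, ∀ b ≥ M,
      Integrable (fun x => (cv (kern n a) (G j β) x - cv (kern n b) (G j β) x) ^ 2) ∧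
      ∫ x, (cv (kern n a) (G j β) x - cv (kern n b) (G j β) x) ^ 2 ≤ ε' := by
    rw [Filter.eventually_all_finset]
    intro j hj
    rw [Filter.eventually_all]
    intro β
    obtain ⟨M, hM⟩ := integral_cv_sub_cv_sq_eventually
      (hG2 j (Nat.lt_succ_iff.1 (Finset.mem_range.1 hj)) β) hε'0
    filter_upwards [eventually_ge_atTop M] with M' hM' a ha b hb
    exact hM a (le_trans hM' ha) b (le_trans hM' hb)
  have hδ : 0 < R - R'' := by rw [hR'']; linarith
  obtain ⟨M₁, hM₁⟩ := eventually_atTop.1 (eventually_small_radius hδ)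
  obtain ⟨M₂, hM₂⟩ := hev.exists_forall_of_atTop
  refine ⟨max M₁ M₂, fun a ha b hb x hx => ?_⟩
  have ha1 := hM₁ a (le_trans (le_max_left _ _) ha)
  have hb1 := hM₁ b (le_trans (le_max_left _ _) hb)
  have hI := fun j hj β => hM₂ M₂ le_rfl j hj β a (le_trans (le_max_right _ _) ha) b
    (le_trans (le_max_right _ _) hb)
  set ua := cv (kern n a) ((ball x₀ R).indicator v) with hua
  set ub := cv (kern n b) ((ball x₀ R).indicator v) with hub
  have hvl : LocallyIntegrable ((ball x₀ R).indicator v) :=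
    (hvi.integrable_indicator measurableSet_ball).locallyIntegrable
  have hsa : ContDiff ℝ ∞ ua := contDiff_cv (kern_contDiff n a) (kern_hasCompactSupport n a) hvl
  have hsb : ContDiff ℝ ∞ ub := contDiff_cv (kern_contDiff n b) (kern_hasCompactSupport n b) hvl
  have hsw : ContDiff ℝ ∞ (ua - ub) := hsa.sub hsb
  set E : Pt n → ℝ := fun x => ∑ j ∈ Finset.range (m + 1), ∑ β : Fin j → Fin n,
    (cv (kern n a) (G j β) x - cv (kern n b) (G j β) x) ^ 2 with hE
  have hE0 : ∀ x, 0 ≤ E x := fun x => Finset.sum_nonneg fun _ _ => Finset.sum_nonneg fun _ _ => sq_nonneg _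
  have hEi : Integrable E := integrable_finsetSum _ fun j hj => integrable_finsetSum _ fun β _ => (hI j hj β).1
  have hEb : ∫ x, E x ≤ N * ε' := by
    rw [hE, integral_finsetSum _ fun j hj => integrable_finsetSum _ fun β _ => (hI j hj β).1, hN,
      Finset.sum_mul]
    refine Finset.sum_le_sum fun j hj => ?_
    rw [integral_finsetSum _ fun β _ => (hI j hj β).1]
    refine (Finset.sum_le_sum fun β _ => (hI j hj β).2).trans_eq ?_
    simp
  have hpt : ∀ l ≤ m, ∀ (α : Fin l → Fin n) (y : Pt n),
      partialDeriv α (fun y => η y * (ua - ub) y) y ^ 2 ≤ K * E y := by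
    intro l hl α y
    by_cases hy : y ∈ closedBall x₀ R''
    · refine (hK _ hsw l hl α y).trans_eq ?_
      congr 1
      refine Finset.sum_congr rfl fun j hj => Finset.sum_congr rfl fun β _ => ?_
      have hjm := Nat.lt_succ_iff.1 (Finset.mem_range.1 hj)
      have hw := h.isWeakDeriv hjm β
      rw [mem_closedBall] at hy
      rw [partialDeriv_sub hsa hsb, hua, hub, partialDeriv_cv_kern hvi hw (by linarith),
        partialDeriv_cv_kern hvi hw (by linarith)]
    · have hz : partialDeriv α (fun y => η y * (ua - ub) y) y = 0 := by
        refine image_eq_zero_of_notMem_tsupport fun hy' => hy ?_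
        have h1 := tsupport_partialDeriv_subset α _ hy'
        have h2 := (tsupport_mul_subset_left (f := η) (g := (ua - ub))) h1
        rwa [η.tsupport_eq] at h2
      rw [hz]
      have := mul_nonneg hK0 (hE0 y)
      simpa using this
  have hint : ∀ l ≤ m, ∀ (α : Fin l → Fin n),
      ∫ y, partialDeriv α (fun y => η y * (ua - ub) y) y ^ 2 ≤ K * (N * ε') := by
    intro l hl α
    refine (integral_mono_of_nonneg (Eventually.of_forall fun y => sq_nonneg _) (hEi.const_mul K)
      (Eventually.of_forall (hpt l hl α))).trans ?_
    rw [integral_const_mul]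
    gcongr
  have hsup := hC (fun y => η y * (ua - ub) y) (hηs.mul hsw) hηc.mul_right t ht0 x
  have hη1 : η x = 1 := η.one_of_mem_closedBall (ball_subset_closedBall hx)
  rw [hη1, one_mul, Pi.sub_apply] at hsup
  refine hsup.trans ?_
  have hS : (∫ y, (fun y => η y * (ua - ub) y) y ^ 2) +
      ∑ i, ∫ y, partialDeriv (fun _ : Fin m => i) (fun y => η y * (ua - ub) y) y ^ 2 ≤
      (1 + n) * (K * (N * ε')) := by
    have h1 := hint 0 (Nat.zero_le m) Fin.elim0
    rw [partialDeriv_zero] at h1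
    have h2 := Finset.sum_le_sum fun i (_ : i ∈ (Finset.univ : Finset (Fin n))) =>
      hint m le_rfl (fun _ => i)
    simp only [Finset.sum_const, Finset.card_univ, Fintype.card_fin, nsmul_eq_mul] at h2
    linarith
  have hS2 : (1 + n) * (K * (N * ε')) ≤ ε * t / (2 * C) := by
    have : (1 + n) * (K * (N * ε')) = ((1 + n) * (K * N)) * ε' := by ring
    rw [this, hε', mul_div_assoc', div_le_iff₀ (by positivity)]
    have : 0 ≤ ε * t / (2 * C) := by positivity
    nlinarith
  calc _ ≤ C * (t + 1 / t * (ε * t / (2 * C))) := by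
        have := hS.trans hS2
        gcongr
    _ = ε := by rw [ht]; field_simp; ring

/-- The Sobolev embedding into continuous functions. -/
theorem SqWeakDerivs.exists_continuous {m : ℕ} (hm : n < 2 * m) {x₀ : Pt n} {R : ℝ}
    {v : Pt n → ℝ} (h : SqWeakDerivs m (ball x₀ R) v) :
    ∃ w, ContinuousOn w (ball x₀ R) ∧ v =ᵐ[volume.restrict (ball x₀ R)] w := by
  have hvl : LocallyIntegrable ((ball x₀ R).indicator v) :=
    (h.integrableOn.integrable_indicator measurableSet_ball).locallyIntegrable
  set u : ℕ → Pt n → ℝ := fun a => cv (kern n a) ((ball x₀ R).indicator v) with hu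
  have hcont : ∀ a, Continuous (u a) := fun a => continuous_cv_kern hvl a
  have hex : ∀ x ∈ ball x₀ R, ∃ R', 0 < R' ∧ R' < R ∧ x ∈ ball x₀ R' := by
    intro x hx
    have h0 : dist x x₀ < R := hx
    have h1 : 0 ≤ dist x x₀ := dist_nonneg
    exact ⟨(dist x x₀ + R) / 2, by linarith, by linarith, mem_ball.2 (by linarith)⟩
  have hUC : ∀ R', 0 < R' → R' < R → UniformCauchySeqOn u atTop (ball x₀ R') := by
    intro R' h0 h1
    rw [Metric.uniformCauchySeqOn_iff]
    intro ε hε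
    obtain ⟨M, hM⟩ := h.uniformCauchy hm h0 h1 (half_pos hε)
    refine ⟨M, fun a ha b hb x hx => ?_⟩
    rw [Real.dist_eq]
    exact (hM a ha b hb x hx).trans_lt (half_lt_self hε)
  have hlim : ∀ x, ∃ l, x ∈ ball x₀ R → Tendsto (fun a => u a x) atTop (𝓝 l) := by
    intro x
    by_cases hx : x ∈ ball x₀ R
    · obtain ⟨R', h0, h1, h2⟩ := hex x hx
      obtain ⟨l, hl⟩ := cauchySeq_tendsto_of_complete ((hUC R' h0 h1).cauchySeq h2)
      exact ⟨l, fun _ => hl⟩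
    · exact ⟨0, fun h => absurd h hx⟩
  choose w hw using hlim
  refine ⟨w, fun x hx => ?_, ?_⟩
  · obtain ⟨R', h0, h1, h2⟩ := hex x hx
    have h3 : TendstoUniformlyOn u w atTop (ball x₀ R') :=
      (hUC R' h0 h1).tendstoUniformlyOn_of_tendsto fun y hy => hw y (ball_subset_ball h1.le hy)
    have h4 := h3.continuousOn (Frequently.of_forall fun a => (hcont a).continuousOn)
    exact (h4.continuousAt (isOpen_ball.mem_nhds h2)).continuousWithinAt
  -- Lebesgue differentiation identifies the limit with v. It requires a bounded ratio `rOut / rIn`,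
  -- which is 2 for these kernels.
  · have hae := ContDiffBump.ae_convolution_tendsto_right_of_locallyIntegrable (μ := volume)
      (φ := bump n) (K := 2) (tendsto_rOut n) (Eventually.of_forall fun a => by
        have : (0 : ℝ) < a + 1 := by positivity
        simp only [bump]
        apply le_of_eq
        field_simp) hvl
    rw [EventuallyEq, ae_restrict_iff' measurableSet_ball]
    filter_upwards [hae] with x hx hxB
    have h1 : Tendsto (fun a => u a x) atTop (𝓝 ((ball x₀ R).indicator v x)) := by
      simp only [hu, cv_eq_lsmul]
      exact hx
    rw [indicator_of_mem hxB] at h1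
    exact tendsto_nhds_unique h1 (hw x hxB)

end Representative

/-! ### Sobolev embedding into C^d -/

section Regularity

variable {n : ℕ}

/-- Convergence along `atTop ×ˢ 𝓝 x` expresses uniformity near x, and it survives mollification
because the kernels shrink to the origin. The functions may vary with the index, as is needed for
the doubly mollified test function. -/
theorem tendsto_cv_kern {F : ℕ → Pt n → ℝ} {x : Pt n} {z : ℝ}
    (hF : ∀ᶠ a in atTop, AEStronglyMeasurable (F a) volume)
    (h : Tendsto (fun p : ℕ × Pt n => F p.1 p.2) (atTop ×ˢ 𝓝 x) (𝓝 z)) :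
    Tendsto (fun p : ℕ × Pt n => cv (kern n p.1) (F p.1) p.2) (atTop ×ˢ 𝓝 x) (𝓝 z) := by
  simp only [cv_eq_lsmul]
  refine ContDiffBump.convolution_tendsto_right (φ := fun p : ℕ × Pt n => bump n p.1)
    (g := fun p => F p.1) (k := fun p => p.2) (x₀ := x) ((tendsto_rOut n).comp tendsto_fst)
    (tendsto_fst.eventually hF) ?_ tendsto_snd
  have : Tendsto (fun q : (ℕ × Pt n) × Pt n => (q.1.1, q.2)) ((atTop ×ˢ 𝓝 x) ×ˢ 𝓝 x)
      (atTop ×ˢ 𝓝 x) :=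
    (tendsto_fst.comp tendsto_fst).prodMk tendsto_snd
  exact h.comp this

theorem tendsto_cv_kern_indicator {U : Set (Pt n)} (hU : IsOpen U) {f : Pt n → ℝ}
    (hf : ContinuousOn f U) {x : Pt n} (hx : x ∈ U) :
    Tendsto (fun p : ℕ × Pt n => cv (kern n p.1) (U.indicator f) p.2) (atTop ×ˢ 𝓝 x) (𝓝 (f x)) := by
  refine tendsto_cv_kern (F := fun _ => U.indicator f) (Eventually.of_forall fun _ =>
    (aestronglyMeasurable_indicator_iff hU.measurableSet).2
      (hf.aestronglyMeasurable hU.measurableSet)) ?_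
  have h1 : Tendsto f (𝓝 x) (𝓝 (f x)) := hf.continuousAt (hU.mem_nhds hx)
  have h2 : Tendsto (U.indicator f) (𝓝 x) (𝓝 (f x)) := by
    refine h1.congr' ?_
    filter_upwards [hU.mem_nhds hx] with y hy
    rw [indicator_of_mem hy]
  exact h2.comp tendsto_snd

theorem tendsto_partialDeriv_cv_kern {l : ℕ} {x₀ : Pt n} {R : ℝ} {v g : Pt n → ℝ}
    {α : Fin l → Fin n} (hv : IntegrableOn v (ball x₀ R)) (h : IsWeakDeriv (ball x₀ R) α v g)
    (hg : ContinuousOn g (ball x₀ R)) {x : Pt n} (hx : x ∈ ball x₀ R) :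
    Tendsto (fun p : ℕ × Pt n => partialDeriv α (cv (kern n p.1) ((ball x₀ R).indicator v)) p.2)
      (atTop ×ˢ 𝓝 x) (𝓝 (g x)) := by
  refine (tendsto_cv_kern_indicator isOpen_ball hg hx).congr' ?_
  have hx' : dist x x₀ < R := hx
  set d := (R - dist x x₀) / 2 with hd
  have hd0 : 0 < d := by rw [hd]; linarith
  filter_upwards [prod_mem_prod (eventually_small_radius hd0) (ball_mem_nhds x hd0)] with p hp
  have h3 : dist p.2 x₀ + 1 / ((p.1 : ℝ) + 1) < R := by
    have h4 : (1 : ℝ) / (p.1 + 1) < d := hp.1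
    have h5 : dist p.2 x < d := hp.2
    have := dist_triangle p.2 x x₀
    linarith
  exact (partialDeriv_cv_kern hv h h3).symm

/-- A continuous linear form given by its values on the coordinate directions. -/
noncomputable def gradForm (c : Fin n → ℝ) : Pt n →L[ℝ] ℝ :=
  ∑ j, c j • (EuclideanSpace.proj j : Pt n →L[ℝ] ℝ)

theorem fderiv_eq_gradForm (f : Pt n → ℝ) (x : Pt n) : fderiv ℝ f x = gradForm fun j => pd j f x := by
  ext v
  have hv : v = ∑ a, v a • (EuclideanSpace.single a 1 : Pt n) := by
    ext b; simp [Pi.single_apply]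
  conv_lhs => rw [hv]
  simp only [map_sum, map_smul, gradForm, sum_apply, smul_eq_mul, pd]
  refine Finset.sum_congr rfl fun j _ => ?_
  simp [mul_comm]

theorem continuous_gradForm : Continuous (gradForm : (Fin n → ℝ) → Pt n →L[ℝ] ℝ) :=
  continuous_finsetSum _ fun j _ => (continuous_apply j).smul continuous_const

/-- A continuous function with continuous weak derivatives is continuously differentiable. -/
theorem hasFDerivAt_of_isWeakDeriv {x₀ : Pt n} {R : ℝ} {h : Pt n → ℝ} {g : Fin n → Pt n → ℝ}
    (hh : ContinuousOn h (ball x₀ R)) (hi : IntegrableOn h (ball x₀ R))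
    (hg : ∀ j, ContinuousOn (g j) (ball x₀ R))
    (hw : ∀ j, IsWeakDeriv (ball x₀ R) (fun _ : Fin 1 => j) h (g j)) {x : Pt n} (hx : x ∈ ball x₀ R) :
    HasFDerivAt h (gradForm fun j => g j x) x := by
  set B := ball x₀ R with hB
  have hvl : LocallyIntegrable (B.indicator h) :=
    (hi.integrable_indicator measurableSet_ball).locallyIntegrable
  set u : ℕ → Pt n → ℝ := fun a => cv (kern n a) (B.indicator h) with hu
  have hsm : ∀ a, ContDiff ℝ ∞ (u a) := fun a =>
    contDiff_cv (kern_contDiff n a) (kern_hasCompactSupport n a) hvl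
  -- The mollifications converge pointwise and their gradients locally uniformly, so the limit is
  -- differentiable with the limit gradient.
  refine hasFDerivAt_of_tendstoLocallyUniformlyOn (s := B) (f := u) (g := h)
    (f' := fun a y => fderiv ℝ (u a) y) (g' := fun y => gradForm fun j => g j y) (l := atTop)
    isOpen_ball ?_ (fun a y _ => ((hsm a).differentiable (by simp) y).hasFDerivAt) ?_ hx
  · rw [tendstoLocallyUniformlyOn_iff_forall_tendsto]
    intro y hy
    rw [isOpen_ball.nhdsWithin_eq hy]
    have h1 : Tendsto (fun p : ℕ × Pt n => gradForm fun j => g j p.2) (atTop ×ˢ 𝓝 y)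
        (𝓝 (gradForm fun j => g j y)) := by
      refine (continuous_gradForm.tendsto _).comp (tendsto_pi_nhds.2 fun j => ?_)
      exact ((hg j).continuousAt (isOpen_ball.mem_nhds hy)).tendsto.comp tendsto_snd
    have h2 : Tendsto (fun p : ℕ × Pt n => fderiv ℝ (u p.1) p.2) (atTop ×ˢ 𝓝 y)
        (𝓝 (gradForm fun j => g j y)) := by
      simp_rw [fderiv_eq_gradForm (u _)]
      refine (continuous_gradForm.tendsto _).comp (tendsto_pi_nhds.2 fun j => ?_)
      have h6 := tendsto_partialDeriv_cv_kern hi (hw j) (hg j) hy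
      refine h6.congr fun p => ?_
      rw [partialDeriv_one (hsm p.1)]
    have h7 := h1.prodMk_nhds h2
    exact h7.mono_right (nhds_le_uniformity _)
  · intro y hy
    have h8 : Tendsto (fun a : ℕ => (a, y)) atTop (atTop ×ˢ 𝓝 y) :=
      tendsto_id.prodMk tendsto_const_nhds
    have h9 := Tendsto.comp (tendsto_cv_kern_indicator isOpen_ball hh hy) h8
    simpa only [Function.comp_def] using h9

theorem contDiffOn_one_of_pd {U : Set (Pt n)} (hU : IsOpen U) {h : Pt n → ℝ} {g : Fin n → Pt n → ℝ}
    {k : ℕ} (hg : ∀ j, ContDiffOn ℝ k (g j) U)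
    (hd : ∀ x ∈ U, HasFDerivAt h (gradForm fun j => g j x) x) : ContDiffOn ℝ (k + 1 : ℕ) h U := by
  have := (contDiffOn_succ_iff_fderiv_of_isOpen (𝕜 := ℝ) (n := (k : ℕ∞ω)) (f := h) hU).2
    ⟨fun x hx => (hd x hx).differentiableAt.differentiableWithinAt, by simp, ?_⟩
  · exact_mod_cast this
  · have e : ∀ x ∈ U, fderiv ℝ h x = gradForm fun j => g j x := fun x hx => (hd x hx).fderiv
    refine ContDiffOn.congr ?_ e
    unfold gradForm
    exact ContDiffOn.sum fun j _ => (hg j).smul contDiffOn_const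

theorem SqWeakDerivs.weakDeriv_one {m : ℕ} {U : Set (Pt n)} {v : Pt n → ℝ}
    (h : SqWeakDerivs (m + 1) U v) (j : Fin n) :
    SqWeakDerivs m U (weakDeriv U (fun _ : Fin 1 => j) v) := by
  intro l hl α
  obtain ⟨g, hg, hg2⟩ := h (l + 1) (by omega) (Fin.cons j α)
  exact ⟨g, (h.isWeakDeriv (by omega) (fun _ : Fin 1 => j)).of_cons hg, hg2⟩

theorem SqWeakDerivs.mono {m m' : ℕ} (hm : m ≤ m') {U : Set (Pt n)} {v : Pt n → ℝ}
    (h : SqWeakDerivs m' U v) : SqWeakDerivs m U v := fun l hl α => h l (hl.trans hm) α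

/-- The Sobolev embedding into functions of class `C^d`. -/
theorem SqWeakDerivs.exists_contDiffOn {m : ℕ} (hm : n < 2 * m) {x₀ : Pt n} {R : ℝ} (d : ℕ)
    {v : Pt n → ℝ} (h : SqWeakDerivs (m + d) (ball x₀ R) v) :
    ∃ w, ContDiffOn ℝ d w (ball x₀ R) ∧ v =ᵐ[volume.restrict (ball x₀ R)] w := by
  induction d generalizing v with
  | zero =>
    obtain ⟨w, hw, he⟩ := h.exists_continuous hm
    exact ⟨w, by exact_mod_cast contDiffOn_zero.2 hw, he⟩
  | succ d ih =>
    obtain ⟨w, hw, he⟩ := (h.mono (Nat.le_add_right m (d + 1))).exists_continuous hm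
    -- Induction on d: the first weak derivatives have a representative of class C^d, and then w is
    -- of class C^{d+1}.
    have hj := fun j => ih ((h.weakDeriv_one j : SqWeakDerivs (m + d) _ _))
    choose g hg hge using hj
    refine ⟨w, ?_, he⟩
    refine contDiffOn_one_of_pd isOpen_ball hg fun x hx => ?_
    refine hasFDerivAt_of_isWeakDeriv hw (h.integrableOn.congr he)
      (fun j => (hg j).continuousOn) (fun j => ?_) hx
    exact (h.isWeakDeriv (by omega) (fun _ : Fin 1 => j)).congr isOpen_ball he (hge j)

end Regularity

end OrliczSym

namespace OrliczSym

open Filter Topology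

/-! ### Functions that are Lipschitz on smaller balls -/

section Lipschitz

variable {n : ℕ} {F : Type*} [NormedAddCommGroup F]

/-- Lipschitz continuity on all smaller concentric balls. -/
def LipschitzOnSubballs (x₀ : Pt n) (R : ℝ) (f : Pt n → F) : Prop :=
  ∀ R' < R, ∃ C, LipschitzOnWith C f (ball x₀ R')

theorem exists_subball {x₀ x : Pt n} {R : ℝ} (hx : x ∈ ball x₀ R) : ∃ R' < R, x ∈ ball x₀ R' := by
  have h0 : dist x x₀ < R := hx
  exact ⟨(dist x x₀ + R) / 2, by linarith, mem_ball.2 (by linarith)⟩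

theorem exists_subball_of_isCompact {x₀ : Pt n} {R : ℝ} {K : Set (Pt n)} (hK : IsCompact K)
    (hKB : K ⊆ ball x₀ R) : ∃ R' < R, K ⊆ ball x₀ R' := by
  rcases K.eq_empty_or_nonempty with rfl | hne
  · exact ⟨R - 1, by linarith, empty_subset _⟩
  · obtain ⟨z, hz, hmax⟩ := hK.exists_isMaxOn hne
      (continuous_id.dist continuous_const : Continuous fun x : Pt n => dist x x₀).continuousOn
    obtain ⟨R', h1, h2⟩ := exists_subball (hKB hz)
    exact ⟨R', h1, fun x hx => mem_ball.2 ((hmax hx).trans_lt h2)⟩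

theorem LipschitzOnSubballs.continuousOn {x₀ : Pt n} {R : ℝ} {f : Pt n → F}
    (h : LipschitzOnSubballs x₀ R f) : ContinuousOn f (ball x₀ R) := by
  intro x hx
  obtain ⟨R', h1, h2⟩ := exists_subball hx
  obtain ⟨C, hC⟩ := h R' h1
  exact (hC.continuousOn.continuousAt (isOpen_ball.mem_nhds h2)).continuousWithinAt

theorem lineDeriv_congr_of_eqOn {f g : Pt n → ℝ} {U : Set (Pt n)} (hU : IsOpen U) (h : EqOn f g U)
    {x : Pt n} (hx : x ∈ U) (v : Pt n) : lineDeriv ℝ f x v = lineDeriv ℝ g x v :=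
  Filter.EventuallyEq.lineDeriv_eq (h.eventuallyEq_of_mem (hU.mem_nhds hx))

/-- Integration by parts against a continuously differentiable function with compact support. -/
theorem LipschitzOnSubballs.integral_lineDeriv_mul {x₀ : Pt n} {R : ℝ} {f χ : Pt n → ℝ}
    (h : LipschitzOnSubballs x₀ R f) (hχ : ContDiff ℝ 1 χ) (hc : HasCompactSupport χ)
    (hs : tsupport χ ⊆ ball x₀ R) (j : Fin n) :
    ∫ x in ball x₀ R, lineDeriv ℝ f x (EuclideanSpace.single j 1) * χ x =
      -∫ x in ball x₀ R, f x * pd j χ x := by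
  obtain ⟨R', h1, h2⟩ := exists_subball_of_isCompact hc hs
  obtain ⟨C, hC⟩ := h R' h1
  -- Only the values near the support of χ matter, so f may be exchanged for a globally Lipschitz
  -- extension.
  obtain ⟨g, hg, hfg⟩ := hC.extend_real
  obtain ⟨D, hD⟩ := ContDiff.lipschitzWith_of_hasCompactSupport hc hχ (by simp)
  have key := hg.integral_lineDeriv_mul_eq (μ := volume) hD hc (EuclideanSpace.single j 1)
  have hz : ∀ x ∉ ball x₀ R', χ x = 0 := fun x hx =>
    image_eq_zero_of_notMem_tsupport fun h' => hx (h2 h')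
  have hz' : ∀ x ∉ ball x₀ R', pd j χ x = 0 := fun x hx =>
    image_eq_zero_of_notMem_tsupport fun h' => hx (h2 (tsupport_pd_subset j χ h'))
  have e1 : ∀ x, f x * pd j χ x = g x * pd j χ x := fun x => by
    by_cases hx : x ∈ ball x₀ R'
    · rw [hfg hx]
    · rw [hz' x hx]; simp
  have e2 : ∀ x, lineDeriv ℝ f x (EuclideanSpace.single j 1) * χ x =
      lineDeriv ℝ g x (EuclideanSpace.single j 1) * χ x := fun x => by
    by_cases hx : x ∈ ball x₀ R'
    · rw [lineDeriv_congr_of_eqOn isOpen_ball hfg hx]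
    · rw [hz x hx]; simp
  have hB : ball x₀ R' ⊆ ball x₀ R := ball_subset_ball h1.le
  rw [setIntegral_eq_integral_of_forall_compl_eq_zero,
    setIntegral_eq_integral_of_forall_compl_eq_zero]
  · simp_rw [e1, e2]
    rw [key]
    simp_rw [(hχ.differentiable (by simp)).differentiableAt.lineDeriv_eq_fderiv]
    simp only [map_neg, pd, neg_mul, integral_neg]
    congr 1
    refine integral_congr_ae (Eventually.of_forall fun x => mul_comm _ _)
  · intro x hx
    rw [hz' x fun h' => hx (hB h'), mul_zero]
  · intro x hx
    rw [hz x fun h' => hx (hB h'), mul_zero]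

theorem LipschitzOnSubballs.isWeakDeriv {x₀ : Pt n} {R : ℝ} {f : Pt n → ℝ}
    (h : LipschitzOnSubballs x₀ R f) (j : Fin n) :
    IsWeakDeriv (ball x₀ R) (fun _ : Fin 1 => j) f
      (fun x => lineDeriv ℝ f x (EuclideanSpace.single j 1)) := by
  refine ⟨h.continuousOn.locallyIntegrableOn measurableSet_ball, ?_, ?_⟩
  · intro x hx
    obtain ⟨R', h1, h2⟩ := exists_subball hx
    obtain ⟨C, hC⟩ := h R' h1
    obtain ⟨g, hg, hfg⟩ := hC.extend_real
    refine ⟨ball x₀ R', mem_nhdsWithin_of_mem_nhds (isOpen_ball.mem_nhds h2), ?_⟩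
    exact ((hg.locallyIntegrable_lineDeriv (EuclideanSpace.single j 1)).integrableOn_isCompact
      (isCompact_closedBall x₀ R')).mono_set ball_subset_closedBall |>.congr_fun
      (fun y hy => (lineDeriv_congr_of_eqOn isOpen_ball hfg hy _).symm) measurableSet_ball
  · intro ψ hψ
    have key := h.integral_lineDeriv_mul (contDiff_infty.1 hψ.1 1) hψ.2.1 hψ.2.2 j
    rw [partialDeriv_one hψ.1, pow_one, key]
    simp

theorem LipschitzOnSubballs.apply {ι : Type*} [Fintype ι] {x₀ : Pt n} {R : ℝ}
    {f : Pt n → EuclideanSpace ℝ ι} (h : LipschitzOnSubballs x₀ R f) (p : ι) :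
    LipschitzOnSubballs x₀ R fun x => f x p := by
  intro R' hR
  obtain ⟨C, hC⟩ := h R' hR
  refine ⟨C, LipschitzOnWith.of_dist_le_mul fun x hx y hy => ?_⟩
  refine le_trans ?_ (hC.dist_le_mul x hx y hy)
  rw [Real.dist_eq, dist_eq_norm]
  simpa using PiLp.norm_apply_le (f x - f y) p

/-- Rademacher's theorem on the countably many balls of radius R - 1/(m + 1), which exhaust the
ball. -/
theorem LipschitzOnSubballs.ae_differentiableAt [NormedSpace ℝ F] [FiniteDimensional ℝ F]
    {x₀ : Pt n} {R : ℝ} {f : Pt n → F} (h : LipschitzOnSubballs x₀ R f) :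
    ∀ᵐ x ∂volume.restrict (ball x₀ R), DifferentiableAt ℝ f x := by
  have key : ∀ m : ℕ, ∀ᵐ x, x ∈ ball x₀ (R - 1 / (m + 1)) → DifferentiableAt ℝ f x := by
    intro m
    obtain ⟨C, hC⟩ := h (R - 1 / (m + 1)) (by
      have : (0 : ℝ) < 1 / (m + 1) := by positivity
      linarith)
    filter_upwards [hC.ae_differentiableWithinAt_of_mem] with x hx hxB
    exact (hx hxB).differentiableAt (isOpen_ball.mem_nhds hxB)
  rw [ae_restrict_iff' measurableSet_ball]
  filter_upwards [ae_all_iff.2 key] with x hx hxB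
  have h0 : dist x x₀ < R := hxB
  obtain ⟨m, hm⟩ := (eventually_small_radius (sub_pos.2 h0)).exists
  exact hx m (mem_ball.2 (by linarith))

theorem LipschitzOnSubballs.abs_lineDeriv_le {x₀ : Pt n} {R R' : ℝ} {f : Pt n → ℝ}
    (h : LipschitzOnSubballs x₀ R f) (hR : R' < R) (j : Fin n) :
    ∃ C : ℝ, ∀ x ∈ ball x₀ R', |lineDeriv ℝ f x (EuclideanSpace.single j 1)| ≤ C := by
  obtain ⟨C, hC⟩ := h R' hR
  obtain ⟨g, hg, hfg⟩ := hC.extend_real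
  refine ⟨C * ‖(EuclideanSpace.single j 1 : Pt n)‖, fun x hx => ?_⟩
  rw [lineDeriv_congr_of_eqOn isOpen_ball hfg hx]
  exact norm_lineDeriv_le_of_lipschitz ℝ hg

theorem lipschitzOnSubballs_of_contDiffOn [NormedSpace ℝ F] {x₀ : Pt n} {R : ℝ} {f : Pt n → F}
    (h : ContDiffOn ℝ 1 f (ball x₀ R)) : LipschitzOnSubballs x₀ R f := by
  intro R' hR
  have hsub : closedBall x₀ R' ⊆ ball x₀ R := closedBall_subset_ball hR
  obtain ⟨C, hC⟩ := (isCompact_closedBall x₀ R').exists_bound_of_continuousOn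
    ((h.continuousOn_fderiv_of_isOpen isOpen_ball le_rfl).mono hsub)
  refine ⟨C.toNNReal, (convex_ball x₀ R').lipschitzOnWith_of_nnnorm_fderiv_le (𝕜 := ℝ)
    (fun x hx => ?_) fun x hx => ?_⟩
  · exact ((h.differentiableOn (by simp)) x (hsub (ball_subset_closedBall hx))).differentiableAt
      (isOpen_ball.mem_nhds (hsub (ball_subset_closedBall hx)))
  · rw [← NNReal.coe_le_coe, coe_nnnorm]
    exact (hC x (ball_subset_closedBall hx)).trans (Real.le_coe_toNNReal C)

end Lipschitz

end OrliczSym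

namespace OrliczSym

open Filter Topology

/-! ### The differentiated equation and the passage to the limit -/

section LimitInequality

variable {n : ℕ}

/-- Joint convergence bounds late members of the sequence near each point, and finitely many
neighbourhoods cover K. The bound provides the majorant for dominated convergence. -/
theorem eventually_abs_le_of_tendsto {K : Set (Pt n)} (hK : IsCompact K) {P : ℕ → Pt n → ℝ}
    {Q : Pt n → ℝ}
    (h : ∀ x ∈ K, Tendsto (fun p : ℕ × Pt n => P p.1 p.2) (atTop ×ˢ 𝓝 x) (𝓝 (Q x))) :
    ∃ M : ℝ, ∀ᶠ a in atTop, ∀ x ∈ K, |P a x| ≤ M := by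
  refine hK.induction_on (p := fun S => ∃ M : ℝ, ∀ᶠ a in atTop, ∀ x ∈ S, |P a x| ≤ M) ?_ ?_ ?_ ?_
  · exact ⟨0, by simp⟩
  · rintro S T hST ⟨M, hM⟩
    exact ⟨M, hM.mono fun a ha x hx => ha x (hST hx)⟩
  · rintro S T ⟨M, hM⟩ ⟨M', hM'⟩
    refine ⟨max M M', (hM.and hM').mono fun a ha x hx => ?_⟩
    rcases hx with hx | hx
    · exact (ha.1 x hx).trans (le_max_left _ _)
    · exact (ha.2 x hx).trans (le_max_right _ _)
  · intro x hx
    have h1 : ∀ᶠ p : ℕ × Pt n in atTop ×ˢ 𝓝 x, |P p.1 p.2| < |Q x| + 1 :=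
      (h x hx).abs.eventually (gt_mem_nhds (lt_add_one _))
    obtain ⟨p, hp, q, hq, hpq⟩ := eventually_prod_iff.1 h1
    exact ⟨{z | q z}, mem_nhdsWithin_of_mem_nhds hq, |Q x| + 1,
      hp.mono fun a ha z hz => (hpq ha hz).le⟩

theorem tendsto_setIntegral_mul {K S : Set (Pt n)} (hK : IsCompact K) (hS : MeasurableSet S)
    (hSK : S ⊆ K) {b : Pt n → ℝ} (hb : IntegrableOn b K) {P : ℕ → Pt n → ℝ} {Q : Pt n → ℝ}
    (hP : ∀ a, Continuous (P a))
    (h : ∀ x ∈ K, Tendsto (fun p : ℕ × Pt n => P p.1 p.2) (atTop ×ˢ 𝓝 x) (𝓝 (Q x))) :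
    Tendsto (fun a => ∫ x in S, b x * P a x) atTop (𝓝 (∫ x in S, b x * Q x)) := by
  obtain ⟨M, hM⟩ := eventually_abs_le_of_tendsto hK h
  have hb' : IntegrableOn b S := hb.mono_set hSK
  refine tendsto_integral_filter_of_dominated_convergence (fun x => |b x| * M) ?_ ?_ ?_ ?_
  · exact Eventually.of_forall fun a => hb'.1.mul (hP a).aestronglyMeasurable
  · filter_upwards [hM] with a ha
    filter_upwards [ae_restrict_mem hS] with x hx
    rw [norm_mul, Real.norm_eq_abs, Real.norm_eq_abs]
    exact mul_le_mul_of_nonneg_left (ha x (hSK hx)) (abs_nonneg _)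
  · exact hb'.abs.mul_const M
  · filter_upwards [ae_restrict_mem hS] with x hx
    have h1 : Tendsto (fun a : ℕ => (a, x)) atTop (atTop ×ˢ 𝓝 x) :=
      tendsto_id.prodMk tendsto_const_nhds
    have h2 := Tendsto.comp (h x (hSK hx)) h1
    exact tendsto_const_nhds.mul (by simpa only [Function.comp_def] using h2)

theorem cv_kern_eq_zero {h : Pt n → ℝ} {y : Pt n} {r d : ℝ} (hh : ∀ x ∉ ball y r, h x = 0) {a : ℕ}
    (ha : 1 / ((a : ℝ) + 1) ≤ d) {x : Pt n} (hx : x ∉ ball y (r + d)) : cv (kern n a) h x = 0 := by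
  unfold cv
  refine integral_eq_zero_of_ae (Eventually.of_forall fun t => ?_)
  by_cases ht : t ∈ ball y r
  · have h1 : kern n a (x - t) = 0 := by
      refine image_eq_zero_of_notMem_tsupport fun h' => hx ?_
      rw [tsupport_kern, mem_closedBall, dist_zero_right, ← dist_eq_norm] at h'
      have h2 := dist_triangle x t y
      have h3 : dist t y < r := ht
      exact mem_ball.2 (by linarith)
    simp [h1]
  · simp [hh t ht]

theorem exists_closedBall_add_subset {x₀ y : Pt n} {R r : ℝ} (hr : 0 ≤ r)
    (h : closedBall y r ⊆ ball x₀ R) : ∃ d > 0, closedBall y (r + d) ⊆ ball x₀ R := by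
  obtain ⟨d, hd, hd'⟩ := (isCompact_closedBall y r).exists_cthickening_subset_open isOpen_ball h
  refine ⟨d, hd, ?_⟩
  rwa [cthickening_closedBall hd.le hr, add_comm] at hd'

/-- A zero of a nonnegative function is a minimum. Applied to η^{2k}, it shows that the gradient
vanishes off the open ball too, including the bounding sphere. -/
theorem pd_eq_zero_of_nonneg {f : Pt n → ℝ} (hf : ∀ x, 0 ≤ f x) {x : Pt n} (hx : f x = 0)
    (j : Fin n) : pd j f x = 0 := by
  have : IsLocalMin f x := Eventually.of_forall fun z => by rw [hx]; exact hf z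
  rw [pd, this.fderiv_eq_zero]; rfl

/-- The mollified equation tested with the mollified test function. -/
theorem energy_identity {k : ℕ} {x₀ : Pt n} {R : ℝ} {v : Pt n → ℝ}
    (hv : SqWeakDerivs k (ball x₀ R) v) {ζ : Pt n → ℝ} (hζ : ContDiff ℝ ∞ ζ) {y : Pt n} {r R' : ℝ}
    (hζ0 : ∀ x ∉ ball y r, ζ x = 0) (hyr : closedBall y r ⊆ closedBall x₀ R') {a : ℕ}
    (ha : R' + 1 / ((a : ℝ) + 1) < R) (s : Fin n) :
    ∑ α : Fin k → Fin n, ∫ x in ball x₀ R, weakDeriv (ball x₀ R) α v x * partialDeriv α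
        (pd s (cv (kern n a) fun x => ζ x * pd s (cv (kern n a) ((ball x₀ R).indicator v)) x)) x =
      -∫ x, ∑ α : Fin k → Fin n,
        partialDeriv α (pd s (cv (kern n a) ((ball x₀ R).indicator v))) x *
        partialDeriv α (fun x => ζ x * pd s (cv (kern n a) ((ball x₀ R).indicator v)) x) x := by
  set B := ball x₀ R with hB
  have hvl : LocallyIntegrable (B.indicator v) :=
    (hv.integrableOn.integrable_indicator measurableSet_ball).locallyIntegrable
  set u := cv (kern n a) (B.indicator v) with hu
  have hus : ContDiff ℝ ∞ u := contDiff_cv (kern_contDiff n a) (kern_hasCompactSupport n a) hvl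
  have hgs : ContDiff ℝ ∞ (pd s u) := contDiff_pd hus s
  set h : Pt n → ℝ := fun x => ζ x * pd s u x with hh
  have hhs : ContDiff ℝ ∞ h := hζ.mul hgs
  have hts : tsupport h ⊆ closedBall y r := by
    refine closure_minimal (fun x hx => ?_) isClosed_closedBall
    by_contra hx'
    exact hx (by simp [hh, hζ0 x fun h' => hx' (ball_subset_closedBall h')])
  have hhc : HasCompactSupport h := (isCompact_closedBall y r).of_isClosed_subset
    (isClosed_tsupport _) hts
  have hi : ∀ α : Fin k → Fin n, Integrable fun x => partialDeriv α (pd s u) x * partialDeriv α h x :=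
    fun α => ((contDiff_partialDeriv hgs α).continuous.mul
      (contDiff_partialDeriv hhs α).continuous).integrable_of_hasCompactSupport
      (HasCompactSupport.mul_left (hhc.of_isClosed_subset (isClosed_tsupport _)
        (tsupport_partialDeriv_subset α h)))
  rw [integral_finsetSum _ fun α _ => hi α, ← Finset.sum_neg_distrib]
  refine Finset.sum_congr rfl fun α _ => ?_
  have hpc : HasCompactSupport (pd s h) :=
    hhc.of_isClosed_subset (isClosed_tsupport _) (tsupport_pd_subset s h)
  have hχc : HasCompactSupport (partialDeriv α (pd s h)) :=
    hpc.of_isClosed_subset (isClosed_tsupport _) (tsupport_partialDeriv_subset α _)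
  rw [pd_cv_right (kern_contDiff n a) hhs hhc,
    partialDeriv_cv_right (kern_contDiff n a) (contDiff_pd hhs s) hpc,
    ← integral_indicator measurableSet_ball]
  have hG : Integrable (B.indicator (weakDeriv B α v)) := by
    have : IsFiniteMeasure (volume.restrict B) := ⟨by simpa using measure_ball_lt_top⟩
    have h1 : IntegrableOn (weakDeriv B α v) B :=
      (hv.memLp isOpen_ball le_rfl α).integrable (by norm_num)
    exact h1.integrable_indicator measurableSet_ball
  have e1 : (B.indicator fun x => weakDeriv B α v x * cv (kern n a) (partialDeriv α (pd s h)) x) =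
      fun x => B.indicator (weakDeriv B α v) x * cv (kern n a) (partialDeriv α (pd s h)) x := by
    ext x
    by_cases hx : x ∈ B <;> simp [hx]
  -- The kernel is even, so the outer mollification passes to the weak derivative of v, where it
  -- yields D^α of the mollified v.
  rw [e1, integral_mul_cv (kern_contDiff n a).continuous (kern_hasCompactSupport n a) (kern_neg n a)
    hG (contDiff_partialDeriv (contDiff_pd hhs s) α).continuous hχc]
  have e2 : ∀ x, cv (kern n a) (B.indicator (weakDeriv B α v)) x * partialDeriv α (pd s h) x =
      partialDeriv α u x * pd s (partialDeriv α h) x := by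
    intro x
    by_cases hx : x ∈ closedBall y r
    · have h1 : dist x x₀ ≤ R' := hyr hx
      rw [partialDeriv_pd hhs, hu,
        partialDeriv_cv_kern hv.integrableOn (hv.isWeakDeriv le_rfl α) (by linarith)]
    · have h1 : partialDeriv α (pd s h) x = 0 := image_eq_zero_of_notMem_tsupport fun h' =>
        hx (hts (tsupport_pd_subset s h (tsupport_partialDeriv_subset α _ h')))
      rw [← partialDeriv_pd hhs, h1, mul_zero, mul_zero]
  simp_rw [e2]
  rw [integral_mul_pd (contDiff_infty.1 (contDiff_partialDeriv hus α) 1)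
    (contDiff_infty.1 (contDiff_partialDeriv hhs α) 1)
    (hhc.of_isClosed_subset (isClosed_tsupport _) (tsupport_partialDeriv_subset α h)),
    ← partialDeriv_pd hus]

/-- The differentiated equation, tested with `η^{2k} ∂ₛv`; the term of order `k` has been estimated
from below. -/
theorem exists_differentiated_inequality (n : ℕ) (c : ℕ → ℝ) {k : ℕ} (hk : 2 ≤ k) :
    ∃ C : ℝ, 0 < C ∧ ∀ (x₀ : Pt n) (R τ : ℝ) (v F : Pt n → ℝ) (a : Fin n → Pt n → ℝ) (s : Fin n)
      (v₁ G : Pt n → ℝ) (v₂ b : Fin n → Pt n → ℝ), 0 < τ →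
      SqWeakDerivs k (ball x₀ R) v →
      (∀ ψ : Pt n → ℝ, IsTest (ball x₀ R) ψ →
        τ * ∑ α : Fin k → Fin n, ∫ x in ball x₀ R,
          weakDeriv (ball x₀ R) α v x * partialDeriv α ψ x =
        -(∑ j, ∫ x in ball x₀ R, a j x * pd j ψ x) + ∫ x in ball x₀ R, F x * ψ x) →
      IsWeakDeriv (ball x₀ R) (fun _ : Fin 1 => s) v v₁ → ContinuousOn v₁ (ball x₀ R) →
      (∀ j, IsWeakDeriv (ball x₀ R) (fun _ : Fin 1 => j) v₁ (v₂ j)) →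
      (∀ j, ContinuousOn (v₂ j) (ball x₀ R)) →
      (∀ j, IsWeakDeriv (ball x₀ R) (fun _ : Fin 1 => s) (a j) (b j)) →
      IsWeakDeriv (ball x₀ R) (fun _ : Fin 1 => s) F G →
      ∀ (η : Pt n → ℝ) (L r : ℝ) (y : Pt n), 0 < L → 0 < r → IsCutoff c L η →
        (∀ x ∉ ball y r, η x = 0) → closedBall y r ⊆ ball x₀ R →
        ∑ j, ∫ x in ball y r,
            b j x * (η x ^ (2 * k) * v₂ j x + pd j (fun z => η z ^ (2 * k)) x * v₁ x) ≤
          (∫ x in ball y r, G x * (η x ^ (2 * k) * v₁ x)) +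
            τ * (C / L ^ (2 * k) * ∫ x in ball y r, v₁ x ^ 2) := by
  obtain ⟨C, hC0, hC⟩ := exists_energy_lower_bound n (c := c) (k := k) (by omega)
  refine ⟨C, hC0, ?_⟩
  intro x₀ R τ v F a s v₁ G v₂ b hτ hv heq hv₁ hv₁c hv₂ hv₂c hb hG η L r y hL hr hη hη0 hyr
  set B := ball x₀ R with hB
  obtain ⟨R', hR', hR''⟩ := exists_subball_of_isCompact (isCompact_closedBall y r) hyr
  obtain ⟨d, hd, hdB⟩ := exists_closedBall_add_subset hr.le hyr
  -- Mollification enlarges supports; before the limit the integrals live on this larger ball.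
  set K := closedBall y (r + d) with hK
  have hKc : IsCompact K := isCompact_closedBall _ _
  have hSK : ball y r ⊆ K := ball_subset_closedBall.trans (closedBall_subset_closedBall (by linarith))
  set ζ : Pt n → ℝ := fun x => η x ^ (2 * k) with hζ
  have hζs : ContDiff ℝ ∞ ζ := hη.smooth.pow _
  have hζ0 : ∀ x ∉ ball y r, ζ x = 0 := fun x hx => by
    simp only [hζ]; rw [hη0 x hx, zero_pow (by omega)]
  have hζ1 : ∀ x ∉ ball y r, ∀ j, pd j ζ x = 0 := fun x hx j =>
    pd_eq_zero_of_nonneg (fun z => pow_nonneg (hη.nonneg z) _) (hζ0 x hx) j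
  have hvi := hv.integrableOn
  have hvl : LocallyIntegrable (B.indicator v) :=
    (hvi.integrable_indicator measurableSet_ball).locallyIntegrable
  set u : ℕ → Pt n → ℝ := fun a => cv (kern n a) (B.indicator v) with hu
  have hus : ∀ a, ContDiff ℝ ∞ (u a) := fun a =>
    contDiff_cv (kern_contDiff n a) (kern_hasCompactSupport n a) hvl
  set g : ℕ → Pt n → ℝ := fun a => pd s (u a) with hg
  have hgs : ∀ a, ContDiff ℝ ∞ (g a) := fun a => contDiff_pd (hus a) s
  -- The test function will be ∂ₛ of the mollification of `h m`. The inner mollification, in g,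
  -- makes `h m` smooth; the outer one lets evenness replace v by its mollification in the term of
  -- order k.
  set h : ℕ → Pt n → ℝ := fun a x => ζ x * g a x with hh
  have hhs : ∀ a, ContDiff ℝ ∞ (h a) := fun a => hζs.mul (hgs a)
  have hh0 : ∀ a, ∀ x ∉ ball y r, h a x = 0 := fun a x hx => by simp [hh, hζ0 x hx]
  have hh1 : ∀ a x j, pd j (h a) x = ζ x * pd j (g a) x + pd j ζ x * g a x := fun a x j =>
    pd_mul (hζs.differentiable (by simp) x) ((hgs a).differentiable (by simp) x) j
  have hh1' : ∀ a j, ∀ x ∉ ball y r, pd j (h a) x = 0 := fun a j x hx => by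
    rw [hh1, hζ0 x hx, hζ1 x hx]; ring
  have hhc : ∀ a, HasCompactSupport (h a) := fun a =>
    HasCompactSupport.intro (isCompact_closedBall y r) fun x hx =>
      hh0 a x fun h' => hx (ball_subset_closedBall h')
  -- joint convergence
  have hg_lim : ∀ x ∈ B, Tendsto (fun p : ℕ × Pt n => g p.1 p.2) (atTop ×ˢ 𝓝 x) (𝓝 (v₁ x)) := by
    intro x hx
    refine (tendsto_partialDeriv_cv_kern hvi hv₁ hv₁c hx).congr fun p => ?_
    rw [partialDeriv_one (hus p.1)]
  -- v has weak derivatives of order two because k ≥ 2; uniqueness identifies them with the weak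
  -- derivatives of v₁.
  have hv₂' : ∀ j, IsWeakDeriv B (Fin.cons s (fun _ : Fin 1 => j) : Fin 2 → Fin n) v (v₂ j) := by
    intro j
    have h1 := hv.isWeakDeriv hk (Fin.cons s (fun _ : Fin 1 => j) : Fin 2 → Fin n)
    exact h1.congr isOpen_ball (ae_eq_refl _) ((hv₁.of_cons h1).unique isOpen_ball (hv₂ j))
  have hg1_lim : ∀ j, ∀ x ∈ B,
      Tendsto (fun p : ℕ × Pt n => pd j (g p.1) p.2) (atTop ×ˢ 𝓝 x) (𝓝 (v₂ j x)) := by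
    intro j x hx
    refine (tendsto_partialDeriv_cv_kern hvi (hv₂' j) (hv₂c j) hx).congr fun p => ?_
    rw [partialDeriv_cons (hus p.1), partialDeriv_one (hus p.1), pd_comm' (hus p.1)]
  have hζc : ∀ x, Tendsto (fun p : ℕ × Pt n => ζ p.2) (atTop ×ˢ 𝓝 x) (𝓝 (ζ x)) := fun x =>
    (hζs.continuous.tendsto x).comp tendsto_snd
  have hζc1 : ∀ j x, Tendsto (fun p : ℕ × Pt n => pd j ζ p.2) (atTop ×ˢ 𝓝 x) (𝓝 (pd j ζ x)) :=
    fun j x => ((contDiff_pd hζs j).continuous.tendsto x).comp tendsto_snd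
  have hH_lim : ∀ x ∈ B, Tendsto (fun p : ℕ × Pt n => cv (kern n p.1) (h p.1) p.2) (atTop ×ˢ 𝓝 x)
      (𝓝 (ζ x * v₁ x)) := fun x hx =>
    tendsto_cv_kern (Eventually.of_forall fun a => (hhs a).continuous.aestronglyMeasurable)
      ((hζc x).mul (hg_lim x hx))
  have hH1_lim : ∀ j, ∀ x ∈ B, Tendsto (fun p : ℕ × Pt n => cv (kern n p.1) (pd j (h p.1)) p.2)
      (atTop ×ˢ 𝓝 x) (𝓝 (ζ x * v₂ j x + pd j ζ x * v₁ x)) := by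
    intro j x hx
    refine tendsto_cv_kern (Eventually.of_forall fun a =>
      (contDiff_pd (hhs a) j).continuous.aestronglyMeasurable) ?_
    simp_rw [hh1]
    exact ((hζc x).mul (hg1_lim j x hx)).add ((hζc1 j x).mul (hg_lim x hx))
  have hint : ∀ {f : Pt n → ℝ}, LocallyIntegrableOn f B → IntegrableOn f K := fun hf =>
    hf.integrableOn_compact_subset hdB hKc
  -- the inequality before the passage to the limit
  have hpre : ∀ᶠ m in atTop,
      ∑ j, ∫ x in K, b j x * cv (kern n m) (pd j (h m)) x ≤
        (∫ x in K, G x * cv (kern n m) (h m) x) +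
          τ * (C / L ^ (2 * k) * ∫ x in ball y r, 1 * g m x ^ 2) := by
    filter_upwards [eventually_small_radius hd, eventually_small_radius (sub_pos.2 hR')] with m h1 h2
    set H := cv (kern n m) (h m) with hHdef
    have hHs : ContDiff ℝ ∞ H := contDiff_cv (kern_contDiff n m) (kern_hasCompactSupport n m)
      (hhs m).continuous.locallyIntegrable
    have hKz : ∀ {f : Pt n → ℝ}, (∀ x ∉ ball y r, f x = 0) → ∀ x ∉ K, cv (kern n m) f x = 0 :=
      fun hf x hx => cv_kern_eq_zero hf h1.le fun h' => hx (ball_subset_closedBall h')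
    have hHt : IsTest B H := by
      have h3 : tsupport H ⊆ K := by
        refine closure_minimal (fun x hx => ?_) isClosed_closedBall
        by_contra hx'
        exact hx (hKz (hh0 m) x hx')
      exact ⟨hHs, hKc.of_isClosed_subset (isClosed_tsupport _) h3, h3.trans hdB⟩
    have hpH : ∀ j, pd j H = cv (kern n m) (pd j (h m)) := fun j =>
      pd_cv_right (kern_contDiff n m) (hhs m) (hhc m) j
    -- The derivative ∂ₛ is then shifted from H to the coefficients a and the right-hand side F,
    -- which possess the weak derivatives b and G.
    have e0 := heq (pd s H) (isTest_pd hHt s)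
    have e1 : ∀ j, ∫ x in B, a j x * pd j (pd s H) x = -∫ x in K, b j x * cv (kern n m) (pd j (h m)) x := by
      intro j
      have h4 := (hb j).2.2 _ (isTest_pd hHt j)
      rw [partialDeriv_one (isTest_pd hHt j).1, pow_one, neg_one_mul, hpH j] at h4
      rw [pd_comm' hHs, hpH j, h4]
      congr 1
      refine setIntegral_eq_of_subset_of_forall_sdiff_eq_zero measurableSet_ball hdB fun x hx => ?_
      rw [hKz (hh1' m j) x hx.2, mul_zero]
    have e2 : ∫ x in B, F x * pd s H x = -∫ x in K, G x * H x := by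
      have h4 := hG.2.2 _ hHt
      rw [partialDeriv_one hHs, pow_one, neg_one_mul] at h4
      rw [h4]
      congr 1
      refine setIntegral_eq_of_subset_of_forall_sdiff_eq_zero measurableSet_ball hdB fun x hx => ?_
      rw [hHdef, hKz (hh0 m) x hx.2, mul_zero]
    have e3 := energy_identity hv hζs hζ0 (hR''.trans ball_subset_closedBall)
      (a := m) (by linarith) s
    have e4 := hC η (g m) L y r hL hη hη0 (hgs m)
    simp_rw [e1, e2, Finset.sum_neg_distrib, neg_neg] at e0
    rw [e3] at e0
    simp_rw [one_mul]
    have e5 : -(τ * (C / L ^ (2 * k) * ∫ x in ball y r, g m x ^ 2)) ≤ τ * ∫ x, ∑ α : Fin k → Fin n,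
        partialDeriv α (g m) x * partialDeriv α (h m) x := by
      rw [← mul_neg]
      exact mul_le_mul_of_nonneg_left e4 hτ.le
    linarith
  have l1 : Tendsto (fun m => ∑ j, ∫ x in K, b j x * cv (kern n m) (pd j (h m)) x) atTop
      (𝓝 (∑ j, ∫ x in K, b j x * (ζ x * v₂ j x + pd j ζ x * v₁ x))) :=
    tendsto_finsetSum _ fun j _ => tendsto_setIntegral_mul hKc measurableSet_closedBall subset_rfl
      (hint (hb j).2.1) (fun m => continuous_cv_kern
        (contDiff_pd (hhs m) j).continuous.locallyIntegrable m) fun x hx => hH1_lim j x (hdB hx)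
  have l2 : Tendsto (fun m => ∫ x in K, G x * cv (kern n m) (h m) x) atTop
      (𝓝 (∫ x in K, G x * (ζ x * v₁ x))) :=
    tendsto_setIntegral_mul hKc measurableSet_closedBall subset_rfl (hint hG.2.1)
      (fun m => continuous_cv_kern (hhs m).continuous.locallyIntegrable m)
      fun x hx => hH_lim x (hdB hx)
  have l3 : Tendsto (fun m => ∫ x in ball y r, 1 * g m x ^ 2) atTop
      (𝓝 (∫ x in ball y r, 1 * v₁ x ^ 2)) :=
    tendsto_setIntegral_mul hKc measurableSet_ball hSK (b := fun _ => 1)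
      (continuousOn_const.integrableOn_compact hKc) (P := fun m x => g m x ^ 2)
      (fun m => (hgs m).continuous.pow 2) fun x hx => (hg_lim x (hdB hx)).pow 2
  have key := le_of_tendsto_of_tendsto l1 (l2.add ((l3.const_mul (C / L ^ (2 * k))).const_mul τ)) hpre
  simp_rw [one_mul] at key
  rw [setIntegral_eq_of_subset_of_forall_sdiff_eq_zero (s := ball y r) (t := K)
    measurableSet_closedBall hSK fun x hx => by rw [hζ0 x hx.2]; ring] at key
  refine le_of_eq_of_le (Finset.sum_congr rfl fun j _ => ?_) key
  refine (setIntegral_eq_of_subset_of_forall_sdiff_eq_zero measurableSet_closedBall hSK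
    fun x hx => ?_).symm
  rw [hζ1 x hx.2, show η x ^ (2 * k) = 0 from hζ0 x hx.2]; ring

end LimitInequality

end OrliczSym

namespace OrliczSym

open Filter Topology

/-! ### Consequences of the structure conditions on A -/

section Operator

variable {n : ℕ}

/-- A strict violation at one point persists on a nonempty open set, which has positive measure. The
structure conditions are needed at every point, since difference quotients compare x with x + t e.
-/
theorem le_of_ae_le_of_continuousOn {Ω : Set (Pt n)} (hΩ : IsOpen Ω) {f g : Pt n → ℝ}
    (hf : ContinuousOn f Ω) (hg : ContinuousOn g Ω)
    (h : ∀ᵐ x ∂volume.restrict Ω, f x ≤ g x) : ∀ x ∈ Ω, f x ≤ g x := by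
  by_contra! hcon
  obtain ⟨x, hx, hlt⟩ := hcon
  have hopen : IsOpen (Ω ∩ (fun x => f x - g x) ⁻¹' Ioi 0) :=
    (hf.sub hg).isOpen_inter_preimage hΩ isOpen_Ioi
  have hpos := hopen.measure_pos volume ⟨x, hx, mem_Ioi.2 (sub_pos.2 hlt)⟩
  refine hpos.ne' ?_
  rw [ae_restrict_iff' hΩ.measurableSet, ae_iff] at h
  refine measure_mono_null (fun z hz => ?_) h
  have : 0 < f z - g z := hz.2
  simp only [mem_ofPred_eq, Classical.not_imp, not_le]
  exact ⟨hz.1, by linarith⟩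

variable {Ω : Set (Pt n)} {φ : ℝ → ℝ} {ν L₁ L₂ K i s : ℝ} {A : Pt n → SymMat n → SymMat n}

theorem IsOrliczOperator.elliptic_of_mem (hA : IsOrliczOperator Ω φ ν L₁ L₂ K A) (hΩ : IsOpen Ω)
    {x : Pt n} (hx : x ∈ Ω) (P Q : SymMat n) :
    ν * d2 φ (‖P‖ + ‖Q‖) * ‖P - Q‖ ^ 2 ≤ inner ℝ (A x P - A x Q) (P - Q) :=
  le_of_ae_le_of_continuousOn hΩ continuousOn_const
    (((hA.cont_x P).sub (hA.cont_x Q)).inner continuousOn_const)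
    (hA.elliptic.mono fun _ h => h P Q) x hx

theorem IsOrliczOperator.lipschitz_P_of_mem (hA : IsOrliczOperator Ω φ ν L₁ L₂ K A) (hΩ : IsOpen Ω)
    {x : Pt n} (hx : x ∈ Ω) (P Q : SymMat n) :
    ‖A x P - A x Q‖ ≤ L₁ * d2 φ (‖P‖ + ‖Q‖) * ‖P - Q‖ :=
  le_of_ae_le_of_continuousOn hΩ ((hA.cont_x P).sub (hA.cont_x Q)).norm continuousOn_const
    (hA.lipschitz_P.mono fun _ h => h P Q) x hx

theorem IsOrliczOperator.growth_of_mem (hA : IsOrliczOperator Ω φ ν L₁ L₂ K A) (hΩ : IsOpen Ω)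
    {x : Pt n} (hx : x ∈ Ω) (P : SymMat n) : ‖A x P‖ ≤ L₂ * d1 φ ‖P‖ :=
  le_of_ae_le_of_continuousOn hΩ (hA.cont_x P).norm continuousOn_const
    (hA.growth.mono fun _ h => h P) x hx

theorem IsOrliczOperator.lipschitz_x_of_mem (hA : IsOrliczOperator Ω φ ν L₁ L₂ K A) (hΩ : IsOpen Ω)
    {x y : Pt n} (hx : x ∈ Ω) (hy : y ∈ Ω) (P : SymMat n) :
    ‖A x P - A y P‖ ≤ K * ‖x - y‖ * d1 φ ‖P‖ := by
  have h1 : ∀ᵐ x ∂volume.restrict Ω, ‖A x P - A y P‖ ≤ K * ‖x - y‖ * d1 φ ‖P‖ := by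
    filter_upwards [hA.lipschitz_x] with x hx
    exact le_of_ae_le_of_continuousOn hΩ (continuousOn_const.sub (hA.cont_x P)).norm
      (by fun_prop) (hx.mono fun _ h => h P) y hy
  exact le_of_ae_le_of_continuousOn hΩ ((hA.cont_x P).sub continuousOn_const).norm
    (by fun_prop) h1 x hx

theorem IsRegularYoung.exists_d2_le (h : IsRegularYoung φ i s) (M : ℝ) :
    ∃ D : ℝ, 0 ≤ D ∧ ∀ t, 0 ≤ t → t ≤ M → d2 φ t ≤ D := by
  obtain ⟨D, hD⟩ := (isCompact_Icc (a := (0 : ℝ)) (b := M)).exists_bound_of_continuousOn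
    (h.continuousOn_d2.mono Icc_subset_Ici_self)
  exact ⟨max D 0, le_max_right _ _, fun t h0 h1 =>
    ((le_abs_self _).trans (hD t ⟨h0, h1⟩)).trans (le_max_left _ _)⟩

theorem exists_norm_le_subball {F : Type*} [NormedAddCommGroup F] {x₀ : Pt n} {R R' : ℝ}
    {f : Pt n → F} (hf : ContinuousOn f (ball x₀ R)) (hR : R' < R) :
    ∃ M : ℝ, 0 ≤ M ∧ ∀ x ∈ ball x₀ R', ‖f x‖ ≤ M := by
  obtain ⟨M, hM⟩ := (isCompact_closedBall x₀ R').exists_bound_of_continuousOn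
    (hf.mono (closedBall_subset_ball hR))
  exact ⟨max M 0, le_max_right _ _, fun x hx =>
    (hM x (ball_subset_closedBall hx)).trans (le_max_left _ _)⟩

/-- Vary x with the matrix fixed, then the matrix with the point fixed. On a smaller ball E is
bounded, hence so are φ'(|E|) and φ''(|E(x)| + |E(y)|). -/
theorem IsOrliczOperator.lipschitzOnSubballs (hA : IsOrliczOperator Ω φ ν L₁ L₂ K A)
    (hφ : IsRegularYoung φ i s) (hΩ : IsOpen Ω) (hL₁ : 0 < L₁) (hK : 0 < K) {x₀ : Pt n} {R : ℝ}
    (hB : ball x₀ R ⊆ Ω) {E : Pt n → SymMat n} (hE : LipschitzOnSubballs x₀ R E) :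
    LipschitzOnSubballs x₀ R fun x => A x (E x) := by
  intro R' hR
  obtain ⟨M, hM0, hM⟩ := exists_norm_le_subball hE.continuousOn hR
  obtain ⟨D, hD0, hD⟩ := hφ.exists_d2_le (M + M)
  obtain ⟨C, hC⟩ := hE R' hR
  have hd := hφ.d1_nonneg hM0
  refine ⟨(K * d1 φ M + L₁ * D * C).toNNReal, LipschitzOnWith.of_dist_le_mul fun x hx y hy => ?_⟩
  have hxB := hB (ball_subset_ball hR.le hx)
  have hyB := hB (ball_subset_ball hR.le hy)
  rw [Real.coe_toNNReal _ (by positivity), dist_eq_norm]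
  have h1 := hA.lipschitz_x_of_mem hΩ hxB hyB (E x)
  have h2 := hA.lipschitz_P_of_mem hΩ hyB (E x) (E y)
  have h3 := hC.dist_le_mul x hx y hy
  rw [dist_eq_norm] at h3
  have h4 : d1 φ ‖E x‖ ≤ d1 φ M := hφ.monotoneOn_d1 (norm_nonneg _) hM0 (hM x hx)
  have h5 := hD (‖E x‖ + ‖E y‖) (by positivity) (add_le_add (hM x hx) (hM y hy))
  calc ‖A x (E x) - A y (E y)‖ ≤ ‖A x (E x) - A y (E x)‖ + ‖A y (E x) - A y (E y)‖ :=
        norm_sub_le_norm_sub_add_norm_sub _ _ _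
    _ ≤ K * ‖x - y‖ * d1 φ M + L₁ * D * (C * dist x y) := by
        refine add_le_add (h1.trans (by gcongr)) (h2.trans ?_)
        have := hφ.d2_nonneg (‖E x‖ + ‖E y‖)
        gcongr
    _ = _ := by rw [← dist_eq_norm]; ring

theorem IsRegularYoung.lipschitzOnSubballs_V (hφ : IsRegularYoung φ i s) {x₀ : Pt n} {R : ℝ}
    {E : Pt n → SymMat n} (hE : LipschitzOnSubballs x₀ R E) :
    LipschitzOnSubballs x₀ R fun x => V φ (E x) := by
  intro R' hR
  obtain ⟨M, hM0, hM⟩ := exists_norm_le_subball hE.continuousOn hR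
  obtain ⟨D, hD0, hD⟩ := hφ.exists_d2_le (M + M)
  obtain ⟨C, hC⟩ := hE R' hR
  have hi := hφ.one_lt
  set c := 64 * (1 + s) ^ 2 / (i - 1) with hc
  have hc0 : 0 ≤ c := div_nonneg (by positivity) (by linarith)
  refine ⟨(√(c * D) * C).toNNReal, LipschitzOnWith.of_dist_le_mul fun x hx y hy => ?_⟩
  rw [Real.coe_toNNReal _ (by positivity), dist_eq_norm]
  refine abs_le_of_sq_le_sq' ?_ (by positivity) |>.2
  have h1 := hφ.norm_V_sub_sq_le (E x) (E y)
  have h3 := hC.dist_le_mul x hx y hy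
  rw [dist_eq_norm] at h3
  have h5 := hD (‖E x‖ + ‖E y‖) (by positivity) (add_le_add (hM x hx) (hM y hy))
  calc _ ≤ c * (D * (C * dist x y) ^ 2) := by
        refine h1.trans ?_
        have := hφ.d2_nonneg (‖E x‖ + ‖E y‖)
        gcongr
    _ = _ := by rw [mul_pow, mul_pow, mul_pow, Real.sq_sqrt (by positivity)]; ring

theorem tendsto_diffQuot {F : Type*} [NormedAddCommGroup F] [NormedSpace ℝ F] {f : Pt n → F}
    {x : Pt n} (hf : DifferentiableAt ℝ f x) (e : Pt n) :
    Tendsto (fun t : ℝ => t⁻¹ • (f (x + t • e) - f x)) (𝓝[>] 0) (𝓝 (fderiv ℝ f x e)) := by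
  have := (hf.hasFDerivAt.hasLineDerivAt e).tendsto_slope_zero_right
  simpa using this

theorem tendsto_add_smul (x e : Pt n) : Tendsto (fun t : ℝ => x + t • e) (𝓝[>] 0) (𝓝 x) := by
  have : Tendsto (fun t : ℝ => x + t • e) (𝓝 0) (𝓝 (x + (0 : ℝ) • e)) :=
    Continuous.tendsto (by fun_prop) 0
  rw [zero_smul, add_zero] at this
  exact this.mono_left nhdsWithin_le_nhds

theorem tendsto_comp_norm {g : ℝ → ℝ} (hg : ContinuousOn g (Ici 0)) {l : Filter ℝ} {f : ℝ → ℝ} {z : ℝ}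
    (hf : Tendsto f l (𝓝 z)) (h0 : ∀ t, 0 ≤ f t) (hz : 0 ≤ z) :
    Tendsto (fun t => g (f t)) l (𝓝 (g z)) :=
  (hg z hz).tendsto.comp (tendsto_nhdsWithin_iff.2 ⟨hf, Eventually.of_forall h0⟩)

/-- A limit of difference quotients; the chain rule is avoided, since A need not be differentiable
in x, nor in P at P = 0. Separating the change of x costs the term with K, and |E(x + t e)| + |E(x)|
tends to 2|E(x)|. -/
theorem IsOrliczOperator.inner_fderiv_ge (hA : IsOrliczOperator Ω φ ν L₁ L₂ K A)
    (hφ : IsRegularYoung φ i s) (hΩ : IsOpen Ω) {E : Pt n → SymMat n} {x e : Pt n} (hx : x ∈ Ω)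
    (he : ‖e‖ = 1) (hE : DifferentiableAt ℝ E x)
    (ha : DifferentiableAt ℝ (fun x => A x (E x)) x) :
    ν * d2 φ (2 * ‖E x‖) * ‖fderiv ℝ E x e‖ ^ 2 - K * d1 φ ‖E x‖ * ‖fderiv ℝ E x e‖ ≤
      inner ℝ (fderiv ℝ (fun x => A x (E x)) x e) (fderiv ℝ E x e) := by
  have t1 := tendsto_diffQuot hE e
  have t2 := tendsto_diffQuot ha e
  have t3 : Tendsto (fun t : ℝ => ‖E (x + t • e)‖) (𝓝[>] 0) (𝓝 ‖E x‖) :=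
    (hE.continuousAt.tendsto.comp (tendsto_add_smul x e)).norm
  have t4 := tendsto_comp_norm hφ.continuousOn_d1 t3 (fun _ => norm_nonneg _) (norm_nonneg _)
  have t5 : Tendsto (fun t : ℝ => d2 φ (‖E (x + t • e)‖ + ‖E x‖)) (𝓝[>] 0)
      (𝓝 (d2 φ (2 * ‖E x‖))) := by
    rw [two_mul]
    exact tendsto_comp_norm hφ.continuousOn_d2 (t3.add tendsto_const_nhds)
      (fun _ => by positivity) (by positivity)
  refine le_of_tendsto_of_tendsto (((tendsto_const_nhds.mul t5).mul (t1.norm.pow 2)).sub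
    ((tendsto_const_nhds.mul t4).mul t1.norm)) (t2.inner t1) ?_
  filter_upwards [self_mem_nhdsWithin, (tendsto_add_smul x e).eventually (hΩ.mem_nhds hx)] with t ht hxt
  have ht0 : (0 : ℝ) < t := ht
  set z := x + t • e with hz
  have h1 := hA.elliptic_of_mem hΩ hx (E z) (E x)
  have h2 := hA.lipschitz_x_of_mem hΩ hxt hx (E z)
  have h3 : ‖z - x‖ = t := by
    rw [hz, add_sub_cancel_left, norm_smul, he, mul_one, Real.norm_of_nonneg ht0.le]
  rw [h3] at h2
  have h4 : A z (E z) - A x (E x) = (A z (E z) - A x (E z)) + (A x (E z) - A x (E x)) := by abel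
  have h5 : -(K * t * d1 φ ‖E z‖ * ‖E z - E x‖) ≤ inner ℝ (A z (E z) - A x (E z)) (E z - E x) := by
    have h6 := abs_real_inner_le_norm (A z (E z) - A x (E z)) (E z - E x)
    have h7 := mul_le_mul_of_nonneg_right h2 (norm_nonneg (E z - E x))
    linarith [neg_abs_le (inner ℝ (A z (E z) - A x (E z)) (E z - E x))]
  rw [real_inner_smul_left, real_inner_smul_right, h4, inner_add_left, norm_smul,
    Real.norm_of_nonneg (by positivity : 0 ≤ t⁻¹)]
  have h8 : ν * d2 φ (‖E z‖ + ‖E x‖) * (t⁻¹ * ‖E z - E x‖) ^ 2 -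
      K * d1 φ ‖E z‖ * (t⁻¹ * ‖E z - E x‖) =
      t⁻¹ * (t⁻¹ * (-(K * t * d1 φ ‖E z‖ * ‖E z - E x‖) +
        ν * d2 φ (‖E z‖ + ‖E x‖) * ‖E z - E x‖ ^ 2)) := by
    field_simp
    ring
  rw [h8]
  have : 0 ≤ t⁻¹ := by positivity
  gcongr

/-- The Lipschitz estimate for V, divided by t² along x + t e, in the limit t → 0⁺. -/
theorem IsRegularYoung.norm_fderiv_V_sq_le (hφ : IsRegularYoung φ i s) {E : Pt n → SymMat n}
    {x : Pt n} (e : Pt n) (hE : DifferentiableAt ℝ E x)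
    (hV : DifferentiableAt ℝ (fun x => V φ (E x)) x) :
    ‖fderiv ℝ (fun x => V φ (E x)) x e‖ ^ 2 ≤
      64 * (1 + s) ^ 2 / (i - 1) * (d2 φ (2 * ‖E x‖) * ‖fderiv ℝ E x e‖ ^ 2) := by
  have t1 := tendsto_diffQuot hE e
  have t2 := tendsto_diffQuot hV e
  have t3 : Tendsto (fun t : ℝ => ‖E (x + t • e)‖) (𝓝[>] 0) (𝓝 ‖E x‖) :=
    (hE.continuousAt.tendsto.comp (tendsto_add_smul x e)).norm
  have t5 : Tendsto (fun t : ℝ => d2 φ (‖E (x + t • e)‖ + ‖E x‖)) (𝓝[>] 0)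
      (𝓝 (d2 φ (2 * ‖E x‖))) := by
    rw [two_mul]
    exact tendsto_comp_norm hφ.continuousOn_d2 (t3.add tendsto_const_nhds)
      (fun _ => by positivity) (by positivity)
  refine le_of_tendsto_of_tendsto (t2.norm.pow 2) ((t5.mul (t1.norm.pow 2)).const_mul _) ?_
  filter_upwards [self_mem_nhdsWithin] with t ht
  have h1 := hφ.norm_V_sub_sq_le (E (x + t • e)) (E x)
  rw [norm_smul, norm_smul, mul_pow, mul_pow]
  calc _ ≤ ‖t⁻¹‖ ^ 2 * _ := mul_le_mul_of_nonneg_left h1 (sq_nonneg _)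
    _ = _ := by ring

end Operator

end OrliczSym

namespace OrliczSym

open Filter Topology

/-! ### The pointwise coercivity inequality -/

section Pointwise

variable {n : ℕ}

/-- The symmetric part of a matrix. -/
noncomputable def symPart : Mat n →ₗ[ℝ] SymMat n where
  toFun M := ⟨WithLp.toLp 2 fun p => (M (p.1, p.2) + M (p.2, p.1)) / 2, by
    intro i j; simp [add_comm]⟩
  map_add' M N := by
    ext p
    simp only [PiLp.add_apply, Submodule.coe_add]
    ring
  map_smul' c M := by
    ext p
    simp only [PiLp.smul_apply, smul_eq_mul, RingHom.id_apply, Submodule.coe_smul]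
    ring

theorem symPart_apply (M : Mat n) (p : Fin n × Fin n) :
    (symPart M : Mat n) p = (M (p.1, p.2) + M (p.2, p.1)) / 2 := rfl

theorem norm_symPart_le (M : Mat n) : ‖symPart M‖ ≤ ‖M‖ := by
  change ‖(symPart M : Mat n)‖ ≤ ‖M‖
  rw [← abs_of_nonneg (norm_nonneg (symPart M : Mat n)),
    ← abs_of_nonneg (norm_nonneg M), ← sq_le_sq, EuclideanSpace.norm_sq_eq, EuclideanSpace.norm_sq_eq]
  have h1 : ∑ p : Fin n × Fin n, ‖M (p.2, p.1)‖ ^ 2 = ∑ p : Fin n × Fin n, ‖M p‖ ^ 2 :=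
    (Equiv.prodComm (Fin n) (Fin n)).sum_comp fun p => ‖M p‖ ^ 2
  calc _ ≤ ∑ p : Fin n × Fin n, (‖M p‖ ^ 2 + ‖M (p.2, p.1)‖ ^ 2) / 2 := by
        refine Finset.sum_le_sum fun p _ => ?_
        rw [symPart_apply]
        simp only [Real.norm_eq_abs, sq_abs]
        nlinarith [sq_nonneg (M (p.1, p.2) - M (p.2, p.1))]
    _ = _ := by rw [← Finset.sum_div, Finset.sum_add_distrib, h1]; ring

theorem abs_coord_le (M : Mat n) (p : Fin n × Fin n) : |M p| ≤ ‖M‖ := by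
  simpa using PiLp.norm_apply_le M p

theorem abs_coord_le' (M : SymMat n) (p : Fin n × Fin n) : |(M : Mat n) p| ≤ ‖M‖ :=
  abs_coord_le (M : Mat n) p

theorem inner_symMat (P Q : SymMat n) :
    inner ℝ P Q = ∑ p, ∑ j, (P : Mat n) (p, j) * (Q : Mat n) (p, j) := by
  rw [Submodule.coe_inner, PiLp.inner_apply, Fintype.sum_prod_type]
  simp [mul_comm]

/-- Only the symmetric part matters in the scalar product with a symmetric matrix. -/
theorem sum_mul_symm (P : SymMat n) (h : Fin n → Fin n → ℝ) :
    ∑ p, ∑ j, (P : Mat n) (p, j) * ((h p j + h j p) / 2) = ∑ p, ∑ j, (P : Mat n) (p, j) * h p j := by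
  have h1 : ∑ p, ∑ j, (P : Mat n) (p, j) * h j p = ∑ p, ∑ j, (P : Mat n) (p, j) * h p j := by
    rw [Finset.sum_comm]
    refine Finset.sum_congr rfl fun p _ => Finset.sum_congr rfl fun j _ => ?_
    rw [P.2 j p]
  have h2 : ∀ p j, (P : Mat n) (p, j) * ((h p j + h j p) / 2) =
      ((P : Mat n) (p, j) * h p j + (P : Mat n) (p, j) * h j p) / 2 := fun p j => by ring
  simp_rw [h2, ← Finset.sum_div, Finset.sum_add_distrib]
  rw [h1]; ring

/-- Four times the product of the two terms on the right equals C d φ (M X)², which dominates the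
square of the left side. The fraction ν/4 allows two applications while half of the ellipticity is
kept. -/
theorem mul_le_young {D d φ C ν M X : ℝ} (hν : 0 < ν) (hC : 0 ≤ C) (hd : 0 ≤ d)
    (hφ : 0 ≤ φ) (h : D ^ 2 ≤ C * (d * φ)) :
    D * M * X ≤ ν / 4 * (d * X ^ 2) + C * M ^ 2 * φ / ν := by
  refine le_of_abs_le (abs_le_of_sq_le_sq ?_ (by positivity))
  have h1 : (D * M * X) ^ 2 ≤ C * (d * φ) * (M * X) ^ 2 := by
    have := mul_le_mul_of_nonneg_right h (sq_nonneg (M * X))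
    calc _ = D ^ 2 * (M * X) ^ 2 := by ring
      _ ≤ _ := this
  have h2 : C * (d * φ) * (M * X) ^ 2 = 4 * (ν / 4 * (d * X ^ 2)) * (C * M ^ 2 * φ / ν) := by
    field_simp
  nlinarith [sq_nonneg (ν / 4 * (d * X ^ 2) - C * M ^ 2 * φ / ν)]

/-- At a fixed point, a stands for A(x, ℰw), E for ℰw, b q and e q for their derivatives in
direction q, d for Dw, f for the gradient of the right-hand side, h p q j for ∂ⱼ∂_q w_p, and ζ₁, ζ₂
for the derivatives of η^{2k}. Terms linear in ‖e q‖ are absorbed through φ'(|E|)² ≤ C φ''(2|E|)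
φ(|d|). The others need only φ'(|E|)|d| ≤ s φ(|d|) and the inequality of Young and Fenchel. -/
theorem pointwise_estimate {φ : ℝ → ℝ} {ν L₂ K i s : ℝ} (hφ : IsRegularYoung φ i s) (hν : 0 < ν)
    (hL₂ : 0 < L₂) {k : ℕ} (hk : 1 ≤ k) {a E : SymMat n} {b e : Fin n → SymMat n}
    {d f : Mat n} {h : Fin n → Fin n → Fin n → ℝ} {η Z₁ Z₂ : ℝ} {ζ₁ : Fin n → ℝ}
    {ζ₂ : Fin n → Fin n → ℝ} (hη0 : 0 ≤ η) (hη1 : η ≤ 1) (hZ₁ : 0 ≤ Z₁) (hZ₂ : 0 ≤ Z₂)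
    (hb : ∀ q, ν * d2 φ (2 * ‖E‖) * ‖e q‖ ^ 2 - K * d1 φ ‖E‖ * ‖e q‖ ≤ inner ℝ (b q) (e q))
    (ha : ‖a‖ ≤ L₂ * d1 φ ‖E‖) (hE : ‖E‖ ≤ ‖d‖)
    (he : ∀ q p j, (e q : Mat n) (p, j) = (h p j q + h j p q) / 2)
    (hs : ∀ p q j, h p q j = h p j q)
    (hζ₁ : ∀ j, |ζ₁ j| ≤ Z₁ * η ^ (2 * k - 1)) (hζ₂ : ∀ q j, |ζ₂ q j| ≤ Z₂) :
    ν / 2 * (η ^ (2 * k) * (d2 φ (2 * ‖E‖) * ∑ q, ‖e q‖ ^ 2)) -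
        (n * (2 * s / (i - 1) * (K ^ 2 + (3 * n ^ 2 * L₂ * Z₁) ^ 2) / ν) + n ^ 3 * L₂ * Z₂ * s + 1) *
          φ ‖d‖ - conj φ ‖f‖ ≤
      (∑ p, ∑ q, ∑ j, (b q : Mat n) (p, j) * (η ^ (2 * k) * h p q j)) -
        (∑ p, ∑ q, ∑ j, (a : Mat n) (p, j) * (ζ₁ j * h p q q + ζ₂ q j * d (p, q))) -
        ∑ p, ∑ q, f (p, q) * (η ^ (2 * k) * d (p, q)) := by
  have hi := hφ.one_lt
  have hsi := hφ.i_le_s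
  have hC0 : 0 ≤ 2 * s / (i - 1) := div_nonneg (by linarith) (by linarith)
  have hE0 : 0 ≤ ‖E‖ := norm_nonneg E
  have hd0 : 0 ≤ ‖d‖ := norm_nonneg d
  have hD2 := hφ.d2_nonneg (2 * ‖E‖)
  have hD1 := hφ.d1_nonneg hE0
  have hφd := hφ.young.nonneg _ hd0
  have hφE := hφ.young.nonneg _ hE0
  have hφm : φ ‖E‖ ≤ φ ‖d‖ := hφ.monotoneOn hE0 hd0 hE
  have hsq : d1 φ ‖E‖ ^ 2 ≤ 2 * s / (i - 1) * (d2 φ (2 * ‖E‖) * φ ‖d‖) :=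
    (hφ.d1_sq_le hE0).trans (by gcongr)
  have hD1d : d1 φ ‖E‖ * ‖d‖ ≤ s * φ ‖d‖ := by
    have h1 := hφ.mul_d1_le_self hd0
    have h2 : d1 φ ‖E‖ ≤ d1 φ ‖d‖ := hφ.monotoneOn_d1 hE0 hd0 hE
    nlinarith
  -- the elliptic term
  have t1 : ∑ p, ∑ q, ∑ j, (b q : Mat n) (p, j) * (η ^ (2 * k) * h p q j) =
      η ^ (2 * k) * ∑ q, inner ℝ (b q) (e q) := by
    rw [Finset.sum_comm, Finset.mul_sum]
    refine Finset.sum_congr rfl fun q _ => ?_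
    rw [inner_symMat]
    simp_rw [he]
    rw [sum_mul_symm (b q) fun p j => h p j q, Finset.mul_sum]
    refine Finset.sum_congr rfl fun p _ => ?_
    rw [Finset.mul_sum]
    refine Finset.sum_congr rfl fun j _ => ?_
    rw [hs]; ring
  -- the second derivatives of the cutoff function
  have hsecond : ∀ p q, |h p q q| ≤ 2 * ‖e q‖ + ‖e p‖ := by
    intro p q
    have h1 := he q p q
    have h2 := he p q q
    -- Second derivatives of a vector field are combinations of first derivatives of its symmetric
    -- gradient; here ∂_q∂_q w_p = 2 ∂_q ℰ_{pq} - ∂_p ℰ_{qq}.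
    have h3 : h p q q = 2 * (e q : Mat n) (p, q) - (e p : Mat n) (q, q) := by
      rw [h1, h2, hs q p q]; ring
    rw [h3]
    have h4 := abs_coord_le' (e q) (p, q)
    have h5 := abs_coord_le' (e p) (q, q)
    calc _ ≤ |2 * (e q : Mat n) (p, q)| + |(e p : Mat n) (q, q)| := abs_sub _ _
      _ ≤ _ := by rw [abs_mul, abs_two]; linarith
  set Y := Z₁ * η ^ (2 * k - 1) with hY
  have hY0 : 0 ≤ Y := by positivity
  -- The factor 3 n² collects 2‖e q‖ + ‖e p‖ over the free indices.
  have t2 : ∑ p, ∑ q, ∑ j, (a : Mat n) (p, j) * (ζ₁ j * h p q q + ζ₂ q j * d (p, q)) ≤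
      (∑ q, 3 * n ^ 2 * (L₂ * d1 φ ‖E‖) * Y * ‖e q‖) + n ^ 3 * L₂ * Z₂ * (d1 φ ‖E‖ * ‖d‖) := by
    calc _ ≤ ∑ p, ∑ q, ∑ _j : Fin n, ((L₂ * d1 φ ‖E‖) * (Y * (2 * ‖e q‖ + ‖e p‖)) +
          (L₂ * d1 φ ‖E‖) * (Z₂ * ‖d‖)) := by
          refine Finset.sum_le_sum fun p _ => Finset.sum_le_sum fun q _ =>
            Finset.sum_le_sum fun j _ => ?_
          refine (le_abs_self _).trans ?_
          rw [abs_mul, ← mul_add]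
          refine mul_le_mul ((abs_coord_le' a (p, j)).trans ha) ((abs_add_le _ _).trans ?_)
            (abs_nonneg _) (by positivity)
          rw [abs_mul, abs_mul]
          exact add_le_add (mul_le_mul (hζ₁ j) (hsecond p q) (abs_nonneg _) hY0)
            (mul_le_mul (hζ₂ q j) (abs_coord_le d (p, q)) (abs_nonneg _) hZ₂)
      _ = _ := by
          simp only [Finset.sum_const, Finset.card_univ, Fintype.card_fin, nsmul_eq_mul,
            ← Finset.mul_sum, Finset.sum_add_distrib, mul_add]
          ring
  have t3 : ∀ q, 3 * n ^ 2 * (L₂ * d1 φ ‖E‖) * Y * ‖e q‖ + η ^ (2 * k) * (K * d1 φ ‖E‖ * ‖e q‖) ≤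
      ν / 2 * (η ^ (2 * k) * (d2 φ (2 * ‖E‖) * ‖e q‖ ^ 2)) +
        2 * s / (i - 1) * (K ^ 2 + (3 * n ^ 2 * L₂ * Z₁) ^ 2) / ν * φ ‖d‖ := by
    intro q
    -- The splitting η^{2k-1} = η^{k-1} η^k: the factor η^k goes with ‖e q‖ to be absorbed, the
    -- factor η^{k-1} is at most one.
    have h1 := mul_le_young (M := 3 * n ^ 2 * L₂ * Z₁ * η ^ (k - 1)) (X := η ^ k * ‖e q‖)
      hν hC0 hD2 hφd hsq
    have h2 := mul_le_young (M := K * η ^ k) (X := η ^ k * ‖e q‖) hν hC0 hD2 hφd hsq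
    have h3 : (3 * n ^ 2 * L₂ * Z₁ * η ^ (k - 1)) ^ 2 ≤ (3 * n ^ 2 * L₂ * Z₁) ^ 2 := by
      rw [mul_pow]
      exact mul_le_of_le_one_right (sq_nonneg _) (pow_le_one₀ (by positivity)
        (pow_le_one₀ hη0 hη1))
    have h4 : (K * η ^ k) ^ 2 ≤ K ^ 2 := by
      rw [mul_pow]
      exact mul_le_of_le_one_right (sq_nonneg _) (pow_le_one₀ (by positivity)
        (pow_le_one₀ hη0 hη1))
    have h5 : η ^ (2 * k - 1) = η ^ (k - 1) * η ^ k := by rw [← pow_add]; congr 1; omega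
    have h6 : η ^ (2 * k) = η ^ k * η ^ k := by rw [← pow_add]; congr 1; omega
    have h7 : 2 * s / (i - 1) * (3 * n ^ 2 * L₂ * Z₁ * η ^ (k - 1)) ^ 2 * φ ‖d‖ / ν ≤
        2 * s / (i - 1) * (3 * n ^ 2 * L₂ * Z₁) ^ 2 * φ ‖d‖ / ν := by gcongr
    have h8 : 2 * s / (i - 1) * (K * η ^ k) ^ 2 * φ ‖d‖ / ν ≤
        2 * s / (i - 1) * K ^ 2 * φ ‖d‖ / ν := by gcongr
    have h9 : 2 * s / (i - 1) * (K ^ 2 + (3 * n ^ 2 * L₂ * Z₁) ^ 2) / ν * φ ‖d‖ =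
        2 * s / (i - 1) * K ^ 2 * φ ‖d‖ / ν + 2 * s / (i - 1) * (3 * n ^ 2 * L₂ * Z₁) ^ 2 * φ ‖d‖ / ν := by
      ring
    rw [h9, hY, h5, h6]
    linarith
  -- the right hand side
  have t4 : ∑ p, ∑ q, f (p, q) * (η ^ (2 * k) * d (p, q)) ≤ conj φ ‖f‖ + φ ‖d‖ := by
    have h1 : ∑ p, ∑ q, f (p, q) * (η ^ (2 * k) * d (p, q)) = η ^ (2 * k) * inner ℝ f d := by
      rw [PiLp.inner_apply, Fintype.sum_prod_type, Finset.mul_sum]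
      refine Finset.sum_congr rfl fun p _ => ?_
      rw [Finset.mul_sum]
      refine Finset.sum_congr rfl fun q _ => ?_
      simp only [RCLike.inner_apply, conj_trivial]
      ring
    rw [h1]
    have h2 : inner ℝ f d ≤ ‖f‖ * ‖d‖ := real_inner_le_norm f d
    have h3 := hφ.mul_le_conj_add ‖f‖ hd0
    have h4 := hφ.conj_nonneg ‖f‖
    have h5 : η ^ (2 * k) ≤ 1 := pow_le_one₀ hη0 hη1
    have h6 : 0 ≤ η ^ (2 * k) := by positivity
    nlinarith
  have t5 := Finset.sum_le_sum fun q (_ : q ∈ (Finset.univ : Finset (Fin n))) => t3 q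
  rw [Finset.sum_add_distrib, Finset.sum_add_distrib, ← Finset.mul_sum, ← Finset.mul_sum,
    ← Finset.mul_sum, ← Finset.mul_sum, Finset.sum_const, Finset.card_univ, Fintype.card_fin,
    nsmul_eq_mul] at t5
  have t6 := Finset.sum_le_sum fun q (_ : q ∈ (Finset.univ : Finset (Fin n))) => hb q
  rw [Finset.sum_sub_distrib, ← Finset.mul_sum, ← Finset.mul_sum] at t6
  have t7 := mul_le_mul_of_nonneg_left t6 (by positivity : 0 ≤ η ^ (2 * k))
  have t8 := mul_le_mul_of_nonneg_left hD1d (by positivity : 0 ≤ n ^ 3 * L₂ * Z₂)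
  rw [t1]
  rw [← Finset.mul_sum] at t2
  simp only [← Finset.mul_sum] at t5 ⊢
  linarith

end Pointwise

end OrliczSym

namespace OrliczSym

open Filter Topology

/-! ### Scalar form of the equation and smoothness of the data -/

section Equation

variable {n : ℕ}

theorem isWeakDeriv_pd_of_contDiffOn {x₀ : Pt n} {R : ℝ} {f : Pt n → ℝ}
    (h : ContDiffOn ℝ 1 f (ball x₀ R)) (j : Fin n) :
    IsWeakDeriv (ball x₀ R) (fun _ : Fin 1 => j) f (pd j f) := by
  refine ((lipschitzOnSubballs_of_contDiffOn h).isWeakDeriv j).congr isOpen_ball (ae_eq_refl _) ?_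
  filter_upwards [ae_restrict_mem measurableSet_ball] with x hx
  exact (((h.differentiableOn (by simp)) x hx).differentiableAt
    (isOpen_ball.mem_nhds hx)).lineDeriv_eq_fderiv

theorem contDiffOn_pd {U : Set (Pt n)} (hU : IsOpen U) {f : Pt n → ℝ} {m : ℕ}
    (h : ContDiffOn ℝ (m + 1 : ℕ) f U) (j : Fin n) : ContDiffOn ℝ m (pd j f) U :=
  (h.fderiv_of_isOpen hU (by norm_cast)).clm_apply contDiffOn_const

theorem contDiff_mul_of_tsupport {U : Set (Pt n)} (hU : IsOpen U) {χ f : Pt n → ℝ} {m : ℕ}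
    (hχ : ContDiff ℝ m χ) (hs : tsupport χ ⊆ U) (hf : ContDiffOn ℝ m f U) :
    ContDiff ℝ m fun x => χ x * f x := by
  rw [contDiff_iff_contDiffAt]
  intro x
  by_cases hx : x ∈ U
  · exact hχ.contDiffAt.mul (hf.contDiffAt (hU.mem_nhds hx))
  · have h1 : χ =ᶠ[𝓝 x] 0 := notMem_tsupport_iff_eventuallyEq.1 fun h' => hx (hs h')
    refine contDiffAt_const (c := (0 : ℝ)) |>.congr_of_eventuallyEq ?_
    filter_upwards [h1] with z hz
    simp [hz]

theorem integrableOn_mul_of_tsupport {U : Set (Pt n)} {f χ : Pt n → ℝ}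
    (hf : LocallyIntegrableOn f U) (hχ : Continuous χ) (hc : HasCompactSupport χ)
    (hs : tsupport χ ⊆ U) : IntegrableOn (fun x => f x * χ x) U := by
  obtain ⟨C, hC⟩ := hc.exists_bound_of_continuous hχ
  have h1 : IntegrableOn (fun x => f x * χ x) (tsupport χ) :=
    Integrable.mul_bdd (hf.integrableOn_compact_subset hs hc) hχ.aestronglyMeasurable
      (Eventually.of_forall hC)
  refine Integrable.integrableOn ((integrableOn_iff_integrable_of_support_subset ?_).1 h1)
  exact (Function.support_mul_subset_right _ _).trans (subset_tsupport χ)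

theorem fderiv_coord {F : Pt n → SymMat n} {x : Pt n} (hF : DifferentiableAt ℝ F x) (e : Pt n)
    (q : Fin n × Fin n) :
    (fderiv ℝ F x e : Mat n) q = fderiv ℝ (fun z => (F z : Mat n) q) x e := by
  have := (((EuclideanSpace.proj q : Mat n →L[ℝ] ℝ).comp
    (SymMat n).subtypeL).hasFDerivAt.comp x hF.hasFDerivAt).fderiv
  exact (DFunLike.congr_fun this e).symm

/-- For x in the ball the kernel sees only a compact part D of Ω, so the integral is a convolution
of a smooth kernel with an integrable function. -/
theorem IsMollifier.exists_contDiff_mollify {η : Pt n → ℝ} (hη : IsMollifier η) {Ω : Set (Pt n)}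
    {x₀ : Pt n} {R ε : ℝ} (hε : 0 < ε) (hΩ : closedBall x₀ (R + ε) ⊆ Ω) {f : Pt n → Pt n}
    (hΩo : IsOpen Ω) (hf : ∀ p, LocallyIntegrableOn (fun x => f x p) Ω) (p : Fin n) :
    ∃ F : Pt n → ℝ, ContDiff ℝ ∞ F ∧ ∀ x ∈ ball x₀ R, mollify η Ω ε f x p = F x := by
  set D := closedBall x₀ (R + ε) with hD
  set ρ : Pt n → ℝ := fun z => (ε ^ n)⁻¹ * η (ε⁻¹ • z) with hρ
  have hρs : ContDiff ℝ ∞ ρ := contDiff_const.mul (hη.smooth.comp (contDiff_const_smul _))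
  have hρ0 : ∀ z ∉ ball (0 : Pt n) ε, ρ z = 0 := by
    intro z hz
    rw [mem_ball_zero_iff, not_lt] at hz
    simp only [hρ]
    rw [hη.supp, mul_zero]
    rw [norm_smul, Real.norm_of_nonneg (by positivity), inv_mul_eq_div, le_div_iff₀ hε, one_mul]
    exact hz
  have hρc : HasCompactSupport ρ := HasCompactSupport.intro (isCompact_closedBall 0 ε) fun x hx =>
    hρ0 x fun h' => hx (ball_subset_closedBall h')
  have hi : ∀ q, Integrable (D.indicator fun x => f x q) := fun q =>
    IntegrableOn.integrable_indicator
      ((hf q).integrableOn_compact_subset hΩ (isCompact_closedBall _ _)) measurableSet_closedBall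
  refine ⟨cv ρ (D.indicator fun x => f x p), contDiff_cv hρs hρc (hi p).locallyIntegrable,
    fun x hx => ?_⟩
  have hpt : ∀ q y, Ω.indicator (fun y => ρ (x - y) * f y q) y =
      ρ (x - y) * D.indicator (fun x => f x q) y := by
    intro q y
    by_cases hy : y ∈ D
    · rw [indicator_of_mem (hΩ hy), indicator_of_mem hy]
    · have h1 : ρ (x - y) = 0 := by
        refine hρ0 _ fun h' => hy ?_
        rw [mem_ball_zero_iff, ← dist_eq_norm, dist_comm] at h'
        have h2 : dist x x₀ < R := hx
        have := dist_triangle y x x₀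
        exact mem_closedBall.2 (by linarith)
      simp only [indicator]
      split_ifs <;> simp [h1]
  obtain ⟨C, hC⟩ := hρc.exists_bound_of_continuous hρs.continuous
  have hint : ∀ q, IntegrableOn (fun y => ρ (x - y) * f y q) Ω := by
    intro q
    rw [← integrable_indicator_iff hΩo.measurableSet]
    refine Integrable.congr ?_ (Eventually.of_forall fun y => (hpt q y).symm)
    exact (hi q).bdd_mul (hρs.continuous.comp (continuous_const.sub continuous_id)).aestronglyMeasurable
      (Eventually.of_forall fun y => hC (x - y))
  have h1 := eval_integral_piLp (μ := volume.restrict Ω) (f := fun y => ρ (x - y) • f y)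
    (fun q => hint q) p
  have h2 : mollify η Ω ε f x p = (∫ y in Ω, ρ (x - y) • f y) p := rfl
  rw [h2, h1]
  simp only [PiLp.smul_apply, smul_eq_mul]
  rw [← integral_indicator hΩo.measurableSet]
  exact integral_congr_ae (Eventually.of_forall fun y => hpt p y)

theorem isTest_single {U : Set (Pt n)} {ψ : Pt n → ℝ} (hψ : IsTest U ψ) (p : Fin n) :
    IsTest U fun x => ψ x • (EuclideanSpace.single p 1 : Pt n) := by
  have hs := tsupport_smul_subset_left ψ fun _ => (EuclideanSpace.single p 1 : Pt n)
  exact ⟨hψ.1.smul contDiff_const, hψ.2.1.of_isClosed_subset (isClosed_tsupport _) hs,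
    hs.trans hψ.2.2⟩

theorem weakDeriv_isTest {m : ℕ} {U : Set (Pt n)} (hU : IsOpen U) {ψ : Pt n → ℝ}
    (hψ : ContDiff ℝ ∞ ψ) (α : Fin m → Fin n) :
    weakDeriv U α ψ =ᵐ[volume.restrict U] partialDeriv α ψ :=
  (isWeakDeriv_of_contDiff hψ α).ae_eq hU

/-- The equation tested with a scalar function in one component. -/
theorem IsApproxSolution.scalar_equation {A : Pt n → SymMat n → SymMat n} {B : Set (Pt n)} {k : ℕ}
    {τ : ℝ} {b g w : Pt n → Pt n} (h : IsApproxSolution A B k τ b g w) (hB : IsOpen B)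
    {E : Pt n → SymMat n} (hE : symGrad B w =ᵐ[volume.restrict B] E)
    (hA : ContinuousOn (fun x => A x (E x)) B) (p : Fin n) {ψ : Pt n → ℝ} (hψ : IsTest B ψ) :
    τ * ∑ α : Fin k → Fin n, ∫ x in B, weakDeriv B α (fun y => w y p) x * partialDeriv α ψ x =
      -(∑ j, ∫ x in B, (A x (E x) : Mat n) (p, j) * pd j ψ x) + ∫ x in B, g x p * ψ x := by
  have h0 := h.equation _ ((isTest_single hψ p).memSobolevZero hB k)
  set Ψ : Pt n → Pt n := fun x => ψ x • (EuclideanSpace.single p 1 : Pt n) with hΨ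
  have hΨp : (fun y => Ψ y p) = ψ := by ext y; simp [hΨ]
  have hΨq : ∀ q, q ≠ p → (fun y => Ψ y q) = 0 := by
    intro q hq; ext y; simp [hΨ, hq]
  have hz : ∀ {m : ℕ} (α : Fin m → Fin n), partialDeriv α (0 : Pt n → ℝ) = 0 := by
    intro m α; ext x
    simp [partialDeriv]
  have hw0 : ∀ {m : ℕ} (α : Fin m → Fin n), weakDeriv B α (0 : Pt n → ℝ) =ᵐ[volume.restrict B] 0 := by
    intro m α
    have := weakDeriv_isTest hB (contDiff_const (c := (0 : ℝ)) : ContDiff ℝ ∞ fun _ : Pt n => (0 : ℝ)) α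
    rwa [show (fun _ : Pt n => (0 : ℝ)) = 0 from rfl, hz] at this
  have hL : (fun x => derivInner B k w Ψ x) =ᵐ[volume.restrict B]
      fun x => ∑ α : Fin k → Fin n, weakDeriv B α (fun y => w y p) x * partialDeriv α ψ x := by
    have h1 : ∀ᵐ x ∂volume.restrict B, ∀ α : Fin k → Fin n, weakDeriv B α ψ x = partialDeriv α ψ x :=
      ae_all_iff.2 fun α => weakDeriv_isTest hB hψ.1 α
    have h2 : ∀ᵐ x ∂volume.restrict B, ∀ α : Fin k → Fin n, weakDeriv B α (0 : Pt n → ℝ) x = 0 :=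
      ae_all_iff.2 fun α => hw0 α
    filter_upwards [h1, h2] with x hx1 hx2
    unfold derivInner
    rw [Finset.sum_eq_single p]
    · rw [hΨp]
      exact Finset.sum_congr rfl fun α _ => by rw [hx1]
    · intro q _ hq
      rw [hΨq q hq]
      exact Finset.sum_eq_zero fun α _ => by rw [hx2, mul_zero]
    · simp
  have hM : (fun x => inner ℝ (A x (symGrad B w x)) (symGrad B Ψ x)) =ᵐ[volume.restrict B]
      fun x => ∑ j, (A x (E x) : Mat n) (p, j) * pd j ψ x := by
    have h1 : ∀ᵐ x ∂volume.restrict B, ∀ j : Fin n, weakDeriv B (fun _ : Fin 1 => j) ψ x = pd j ψ x := by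
      refine ae_all_iff.2 fun j => ?_
      have := weakDeriv_isTest hB hψ.1 (fun _ : Fin 1 => j)
      rwa [partialDeriv_one hψ.1] at this
    have h2 : ∀ᵐ x ∂volume.restrict B, ∀ j : Fin n,
        weakDeriv B (fun _ : Fin 1 => j) (0 : Pt n → ℝ) x = 0 := ae_all_iff.2 fun α => hw0 _
    filter_upwards [h1, h2, hE] with x hx1 hx2 hx3
    rw [hx3, inner_symMat]
    have h3 : ∀ q j, (symGrad B Ψ x : Mat n) (q, j) =
        (weakGrad B Ψ x (q, j) + weakGrad B Ψ x (j, q)) / 2 := fun q j => rfl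
    simp_rw [h3]
    -- The values of A are symmetric, so the full gradient of the test function may be used, and
    -- only its row p is nonzero.
    rw [sum_mul_symm (A x (E x)) fun q j => weakGrad B Ψ x (q, j), Finset.sum_eq_single p]
    · refine Finset.sum_congr rfl fun j _ => ?_
      simp only [weakGrad]
      rw [hΨp, hx1]
    · intro q _ hq
      refine Finset.sum_eq_zero fun j _ => ?_
      simp only [weakGrad]
      rw [hΨq q hq, hx2, mul_zero]
    · simp
  have hR : ∀ x, inner ℝ (g x) (Ψ x) = g x p * ψ x := by
    intro x
    rw [hΨ, real_inner_smul_right, EuclideanSpace.inner_single_right]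
    simp [mul_comm]
  rw [integral_congr_ae hL, integral_congr_ae hM, integral_finsetSum, integral_finsetSum] at h0
  · refine h0.trans ?_
    congr 1
    exact integral_congr_ae (Eventually.of_forall hR)
  · intro j _
    have hc : ContinuousOn (fun x => (A x (E x) : Mat n) (p, j)) B :=
      (((EuclideanSpace.proj (p, j) : Mat n →L[ℝ] ℝ).comp (SymMat n).subtypeL).continuous.comp_continuousOn hA)
    have ht := isTest_pd hψ j
    exact integrableOn_mul_of_tsupport (hc.locallyIntegrableOn hB.measurableSet) ht.1.continuous
      ht.2.1 ht.2.2
  · intro α _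
    obtain ⟨g, hg, -⟩ := h.mem p k le_rfl α
    have ht := isTest_partialDeriv hψ α
    exact integrableOn_mul_of_tsupport (isWeakDeriv_weakDeriv hg).2.1 ht.1.continuous ht.2.1 ht.2.2

end Equation

end OrliczSym

namespace OrliczSym

open Filter Topology

/-! ### Summation over components and directions -/

section Summation

variable {n : ℕ}

theorem LipschitzOnSubballs.coord {x₀ : Pt n} {R : ℝ} {a : Pt n → SymMat n}
    (h : LipschitzOnSubballs x₀ R a) (z : Fin n × Fin n) :
    LipschitzOnSubballs x₀ R fun x => (a x : Mat n) z := by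
  have h1 : LipschitzOnSubballs x₀ R fun x => (a x : Mat n) := fun R' hR => by
    obtain ⟨C, hC⟩ := h R' hR
    exact ⟨C, fun x hx y hy => hC hx hy⟩
  exact h1.apply z

theorem LipschitzOnSubballs.lineDeriv_coord_ae_eq {x₀ : Pt n} {R : ℝ} {a : Pt n → SymMat n}
    (h : LipschitzOnSubballs x₀ R a) (z : Fin n × Fin n) (e : Pt n) :
    (fun x => lineDeriv ℝ (fun x => (a x : Mat n) z) x e) =ᵐ[volume.restrict (ball x₀ R)]
      fun x => (fderiv ℝ a x e : Mat n) z := by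
  filter_upwards [h.ae_differentiableAt] with x hx
  rw [fderiv_coord hx]
  have h1 : DifferentiableAt ℝ (fun x => (a x : Mat n) z) x :=
    ((EuclideanSpace.proj z : Mat n →L[ℝ] ℝ).comp (SymMat n).subtypeL).differentiableAt.comp x hx
  exact h1.lineDeriv_eq_fderiv

theorem LipschitzOnSubballs.isWeakDeriv_coord {x₀ : Pt n} {R : ℝ} {a : Pt n → SymMat n}
    (h : LipschitzOnSubballs x₀ R a) (z : Fin n × Fin n) (q : Fin n) :
    IsWeakDeriv (ball x₀ R) (fun _ : Fin 1 => q) (fun x => (a x : Mat n) z)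
      fun x => (fderiv ℝ a x (EuclideanSpace.single q 1) : Mat n) z :=
  ((h.coord z).isWeakDeriv q).congr isOpen_ball (ae_eq_refl _) (h.lineDeriv_coord_ae_eq z _)

theorem LipschitzOnSubballs.integral_fderiv_coord_mul {x₀ : Pt n} {R : ℝ} {a : Pt n → SymMat n}
    (h : LipschitzOnSubballs x₀ R a) {χ : Pt n → ℝ} (hχ : ContDiff ℝ 1 χ)
    (hc : HasCompactSupport χ) (hs : tsupport χ ⊆ ball x₀ R) (z : Fin n × Fin n) (q : Fin n) :
    ∫ x in ball x₀ R, (fderiv ℝ a x (EuclideanSpace.single q 1) : Mat n) z * χ x =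
      -∫ x in ball x₀ R, (a x : Mat n) z * pd q χ x := by
  rw [← (h.coord z).integral_lineDeriv_mul hχ hc hs q]
  refine integral_congr_ae ?_
  filter_upwards [h.lineDeriv_coord_ae_eq z (EuclideanSpace.single q 1)] with x hx
  rw [hx]

theorem integrableOn_ball_mul {x₀ y : Pt n} {R r : ℝ} (hyr : closedBall y r ⊆ ball x₀ R)
    {f g : Pt n → ℝ} (hf : LocallyIntegrableOn f (ball x₀ R)) (hg : ContinuousOn g (ball x₀ R)) :
    IntegrableOn (fun x => f x * g x) (ball y r) :=
  ((hf.integrableOn_compact_subset hyr (isCompact_closedBall y r)).mul_continuousOn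
    (hg.mono hyr) (isCompact_closedBall y r)).mono_set ball_subset_closedBall

theorem pd_pow {η : Pt n → ℝ} (hη : ContDiff ℝ ∞ η) (m : ℕ) (j : Fin n) (x : Pt n) :
    pd j (fun z => η z ^ (m + 1)) x = (m + 1) * η x ^ m * pd j η x := by
  have := ((hη.differentiable (by simp) x).hasFDerivAt.pow (m + 1)).fderiv
  simp only [pd]
  rw [this]
  simp

theorem pd_pd_pow {η : Pt n → ℝ} (hη : ContDiff ℝ ∞ η) (m : ℕ) (q j : Fin n) (x : Pt n) :
    pd q (pd j fun z => η z ^ (m + 2)) x = (m + 2) * (m + 1) * η x ^ m * pd q η x * pd j η x +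
      (m + 2) * η x ^ (m + 1) * pd q (pd j η) x := by
  have h1 : (pd j fun z => η z ^ (m + 2)) = fun z => (m + 2 : ℝ) * (η z ^ (m + 1) * pd j η z) := by
    ext z
    rw [pd_pow hη (m + 1)]
    push_cast
    ring
  have hp := contDiff_pd hη j
  have h2 : pd q (fun _ : Pt n => (m + 2 : ℝ)) x = 0 := by simp [pd]
  rw [h1, pd_mul (differentiableAt_const _) (((hη.pow _).mul hp).differentiable (by simp) x),
    pd_mul ((hη.pow _).differentiable (by simp) x) (hp.differentiable (by simp) x), pd_pow hη, h2]
  ring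

/-- The quantity whose integral is estimated by the term of order `k`. -/
noncomputable def energyDensity (ζ : Pt n → ℝ) (U F : Fin n → Pt n → ℝ) (a : Pt n → SymMat n)
    (x : Pt n) : ℝ :=
  (∑ p, ∑ q, ∑ j, (fderiv ℝ a x (EuclideanSpace.single q 1) : Mat n) (p, j) *
      (ζ x * pd j (pd q (U p)) x)) -
    (∑ p, ∑ q, ∑ j, (a x : Mat n) (p, j) *
      (pd j ζ x * pd q (pd q (U p)) x + pd q (pd j ζ) x * pd q (U p) x)) -
    ∑ p, ∑ q, pd q (F p) x * (ζ x * pd q (U p) x)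

theorem exists_summed_inequality (n : ℕ) (c : ℕ → ℝ) {k : ℕ} (hk : 2 ≤ k) :
    ∃ C : ℝ, 0 < C ∧ ∀ (x₀ : Pt n) (R τ : ℝ) (v U F : Fin n → Pt n → ℝ) (a : Pt n → SymMat n),
      0 < τ → (∀ p, SqWeakDerivs k (ball x₀ R) (v p)) →
      (∀ p, ContDiffOn ℝ 2 (U p) (ball x₀ R)) →
      (∀ p, v p =ᵐ[volume.restrict (ball x₀ R)] U p) →
      (∀ p, ContDiff ℝ ∞ (F p)) → LipschitzOnSubballs x₀ R a →
      (∀ (p : Fin n) (ψ : Pt n → ℝ), IsTest (ball x₀ R) ψ →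
        τ * ∑ α : Fin k → Fin n, ∫ x in ball x₀ R,
          weakDeriv (ball x₀ R) α (v p) x * partialDeriv α ψ x =
        -(∑ j, ∫ x in ball x₀ R, (a x : Mat n) (p, j) * pd j ψ x) +
          ∫ x in ball x₀ R, F p x * ψ x) →
      ∀ (η : Pt n → ℝ) (L r : ℝ) (y : Pt n), 0 < L → 0 < r → IsCutoff c L η →
        (∀ x ∉ ball y r, η x = 0) → closedBall y r ⊆ ball x₀ R →
        IntegrableOn (energyDensity (fun x => η x ^ (2 * k)) U F a) (ball y r) ∧
        ∫ x in ball y r, energyDensity (fun x => η x ^ (2 * k)) U F a x ≤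
          τ * (C / L ^ (2 * k) * ∫ x in ball y r, ∑ p, ∑ q, pd q (U p) x ^ 2) := by
  obtain ⟨C, hC0, hC⟩ := exists_differentiated_inequality n c hk
  refine ⟨C, hC0, ?_⟩
  intro x₀ R τ v U F a hτ hv hU hvU hF ha heq η L r y hL hr hη hη0 hyr
  set B := ball x₀ R with hB
  set ζ : Pt n → ℝ := fun x => η x ^ (2 * k) with hζ
  have hζs : ContDiff ℝ ∞ ζ := hη.smooth.pow _
  have hζ0 : ∀ x ∉ ball y r, ζ x = 0 := fun x hx => by
    simp only [hζ]; rw [hη0 x hx, zero_pow (by omega)]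
  have hζ1 : ∀ j, ∀ x ∉ ball y r, pd j ζ x = 0 := fun j x hx =>
    pd_eq_zero_of_nonneg (fun z => pow_nonneg (hη.nonneg z) _) (hζ0 x hx) j
  have hζ1s : ∀ j, tsupport (pd j ζ) ⊆ closedBall y r := fun j =>
    closure_minimal (fun x hx => by
      by_contra hx'
      exact hx (hζ1 j x fun h' => hx' (ball_subset_closedBall h'))) isClosed_closedBall
  have hrB : ball y r ⊆ B := ball_subset_closedBall.trans hyr
  have hd : ∀ p q, ContDiffOn ℝ 1 (pd q (U p)) B := fun p q =>
    contDiffOn_pd (m := 1) isOpen_ball (hU p) q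
  have hh : ∀ p q j, ContinuousOn (pd j (pd q (U p))) B := fun p q j =>
    (contDiffOn_pd (m := 0) isOpen_ball (hd p q) j).continuousOn
  have hac : ∀ z, LocallyIntegrableOn (fun x => (a x : Mat n) z) B := fun z =>
    (ha.coord z).continuousOn.locallyIntegrableOn measurableSet_ball
  have hFc : ∀ p q, LocallyIntegrableOn (pd q (F p)) B := fun p q =>
    (contDiff_pd (hF p) q).continuous.locallyIntegrable.locallyIntegrableOn _
  have hb := fun z q => ha.isWeakDeriv_coord z q
  have i1 : ∀ p q j, IntegrableOn (fun x => (fderiv ℝ a x (EuclideanSpace.single q 1) : Mat n) (p, j) *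
      (ζ x * pd j (pd q (U p)) x)) (ball y r) := fun p q j =>
    integrableOn_ball_mul hyr (hb (p, j) q).2.1 (hζs.continuous.continuousOn.mul (hh p q j))
  have i1' : ∀ p q j, IntegrableOn (fun x => (fderiv ℝ a x (EuclideanSpace.single q 1) : Mat n) (p, j) *
      (pd j ζ x * pd q (U p) x)) (ball y r) := fun p q j =>
    integrableOn_ball_mul hyr (hb (p, j) q).2.1
      ((contDiff_pd hζs j).continuous.continuousOn.mul (hd p q).continuousOn)
  have i2 : ∀ p q j, IntegrableOn (fun x => (a x : Mat n) (p, j) *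
      (pd j ζ x * pd q (pd q (U p)) x + pd q (pd j ζ) x * pd q (U p) x)) (ball y r) := fun p q j =>
    integrableOn_ball_mul hyr (hac (p, j))
      (((contDiff_pd hζs j).continuous.continuousOn.mul (hh p q q)).add
        ((contDiff_pd (contDiff_pd hζs j) q).continuous.continuousOn.mul (hd p q).continuousOn))
  have i3 : ∀ p q, IntegrableOn (fun x => pd q (F p) x * (ζ x * pd q (U p) x)) (ball y r) :=
    fun p q => integrableOn_ball_mul hyr (hFc p q)
      (hζs.continuous.continuousOn.mul (hd p q).continuousOn)
  have i4 : ∀ p q, IntegrableOn (fun x => pd q (U p) x ^ 2) (ball y r) := fun p q =>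
    ((((hd p q).continuousOn.pow 2).mono hyr).integrableOn_compact
      (isCompact_closedBall y r)).mono_set ball_subset_closedBall
  -- The derivative is taken off a wherever the cutoff is differentiated, so that afterwards only
  -- the growth bound on A is needed. Otherwise φ''(2|ℰw|)|Dw|² would arise, which φ(|Dw|) does not
  -- control in general.
  have ibp : ∀ p q j, ∫ x in ball y r, (fderiv ℝ a x (EuclideanSpace.single q 1) : Mat n) (p, j) *
      (pd j ζ x * pd q (U p) x) = -∫ x in ball y r, (a x : Mat n) (p, j) *
      (pd j ζ x * pd q (pd q (U p)) x + pd q (pd j ζ) x * pd q (U p) x) := by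
    intro p q j
    have hχ : ContDiff ℝ 1 fun x => pd j ζ x * pd q (U p) x :=
      contDiff_mul_of_tsupport (m := 1) isOpen_ball (contDiff_infty.1 (contDiff_pd hζs j) 1)
        ((hζ1s j).trans hyr) (hd p q)
    have hs : tsupport (fun x => pd j ζ x * pd q (U p) x) ⊆ closedBall y r :=
      (tsupport_mul_subset_left (f := pd j ζ) (g := pd q (U p))).trans (hζ1s j)
    have key := ha.integral_fderiv_coord_mul hχ ((isCompact_closedBall y r).of_isClosed_subset
      (isClosed_tsupport _) hs) (hs.trans hyr) (p, j) q
    rw [← setIntegral_eq_of_subset_of_forall_sdiff_eq_zero measurableSet_ball hrB fun x hx => by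
      rw [hζ1 j x hx.2]; ring, key]
    congr 1
    -- This includes the sphere: two derivatives of η^{2k} still leave a positive power of η, as k ≥
    -- 2.
    have hz : ∀ x ∉ ball y r, pd j ζ x = 0 ∧ pd q (pd j ζ) x = 0 := by
      intro x hx
      refine ⟨hζ1 j x hx, ?_⟩
      have h2 := pd_pd_pow hη.smooth (2 * k - 2) q j x
      rw [show 2 * k - 2 + 2 = 2 * k by omega, hη0 x hx, zero_pow (by omega),
        zero_pow (by omega)] at h2
      rw [hζ, h2]
      ring
    have e1 : ∀ x ∈ B, pd q (fun x => pd j ζ x * pd q (U p) x) x =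
        pd j ζ x * pd q (pd q (U p)) x + pd q (pd j ζ) x * pd q (U p) x := fun x hx =>
      pd_mul ((contDiff_pd hζs j).differentiable (by simp) x)
        (((hd p q).differentiableOn (by simp) x hx).differentiableAt (isOpen_ball.mem_nhds hx)) q
    have e2 : ∫ x in B, (a x : Mat n) (p, j) * pd q (fun x => pd j ζ x * pd q (U p) x) x =
        ∫ x in B, (a x : Mat n) (p, j) *
          (pd j ζ x * pd q (pd q (U p)) x + pd q (pd j ζ) x * pd q (U p) x) :=
      setIntegral_congr_fun measurableSet_ball fun x hx => by simp only [e1 x hx]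
    rw [e2]
    exact setIntegral_eq_of_subset_of_forall_sdiff_eq_zero measurableSet_ball hrB fun x hx => by
      rw [(hz x hx.2).1, (hz x hx.2).2]; ring
  have main : ∀ p q,
      (∑ j, ∫ x in ball y r, (fderiv ℝ a x (EuclideanSpace.single q 1) : Mat n) (p, j) *
        (ζ x * pd j (pd q (U p)) x)) - (∑ j, ∫ x in ball y r, (a x : Mat n) (p, j) *
          (pd j ζ x * pd q (pd q (U p)) x + pd q (pd j ζ) x * pd q (U p) x)) -
        ∫ x in ball y r, pd q (F p) x * (ζ x * pd q (U p) x) ≤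
      τ * (C / L ^ (2 * k) * ∫ x in ball y r, pd q (U p) x ^ 2) := by
    intro p q
    have h1 := hC x₀ R τ (v p) (F p) (fun j x => (a x : Mat n) (p, j)) q (pd q (U p)) (pd q (F p))
      (fun j => pd j (pd q (U p)))
      (fun j x => (fderiv ℝ a x (EuclideanSpace.single q 1) : Mat n) (p, j)) hτ (hv p) (heq p)
      ((isWeakDeriv_pd_of_contDiffOn ((hU p).of_le (by norm_num)) q).congr isOpen_ball
        (hvU p).symm (ae_eq_refl _)) (hd p q).continuousOn
      (fun j => isWeakDeriv_pd_of_contDiffOn (hd p q) j) (fun j => hh p q j)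
      (fun j => hb (p, j) q)
      (by
        have := isWeakDeriv_of_contDiff (U := ball x₀ R) (hF p) (fun _ : Fin 1 => q)
        rwa [partialDeriv_one (hF p)] at this) η L r y hL hr hη hη0 hyr
    have h2 : ∀ j, ∫ x in ball y r, (fderiv ℝ a x (EuclideanSpace.single q 1) : Mat n) (p, j) *
        (ζ x * pd j (pd q (U p)) x + pd j ζ x * pd q (U p) x) =
        (∫ x in ball y r, (fderiv ℝ a x (EuclideanSpace.single q 1) : Mat n) (p, j) *
          (ζ x * pd j (pd q (U p)) x)) - ∫ x in ball y r, (a x : Mat n) (p, j) *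
          (pd j ζ x * pd q (pd q (U p)) x + pd q (pd j ζ) x * pd q (U p) x) := by
      intro j
      rw [sub_eq_add_neg, ← ibp, ← integral_add (i1 p q j) (i1' p q j)]
      refine integral_congr_ae (Eventually.of_forall fun x => ?_)
      ring
    have h3 := (Finset.sum_congr rfl fun j _ => h2 j).symm.trans_le h1
    rw [Finset.sum_sub_distrib] at h3
    linarith
  have j1 : ∀ p q, IntegrableOn (fun x => ∑ j, (fderiv ℝ a x (EuclideanSpace.single q 1) : Mat n)
      (p, j) * (ζ x * pd j (pd q (U p)) x)) (ball y r) := fun p q =>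
    integrable_finsetSum _ fun j _ => i1 p q j
  have j2 : ∀ p q, IntegrableOn (fun x => ∑ j, (a x : Mat n) (p, j) *
      (pd j ζ x * pd q (pd q (U p)) x + pd q (pd j ζ) x * pd q (U p) x)) (ball y r) := fun p q =>
    integrable_finsetSum _ fun j _ => i2 p q j
  have k1 := integrable_finsetSum Finset.univ fun p (_ : p ∈ Finset.univ) =>
    integrable_finsetSum Finset.univ fun q (_ : q ∈ Finset.univ) => j1 p q
  have k2 := integrable_finsetSum Finset.univ fun p (_ : p ∈ Finset.univ) =>
    integrable_finsetSum Finset.univ fun q (_ : q ∈ Finset.univ) => j2 p q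
  have k3 := integrable_finsetSum Finset.univ fun p (_ : p ∈ Finset.univ) =>
    integrable_finsetSum Finset.univ fun q (_ : q ∈ Finset.univ) => i3 p q
  have k12 := Integrable.sub' k1 k2
  refine ⟨k12.sub k3, ?_⟩
  unfold energyDensity
  rw [integral_sub k12 k3, integral_sub k1 k2]
  have s1 : ∀ {f : Fin n → Fin n → Pt n → ℝ}, (∀ p q, IntegrableOn (f p q) (ball y r)) →
      ∫ x in ball y r, ∑ p, ∑ q, f p q x = ∑ p, ∑ q, ∫ x in ball y r, f p q x := fun hf => by
    rw [integral_finsetSum _ fun p _ => integrable_finsetSum _ fun q _ => hf p q]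
    exact Finset.sum_congr rfl fun p _ => integral_finsetSum _ fun q _ => hf p q
  rw [s1 j1, s1 j2, s1 i3, s1 i4, ← Finset.sum_sub_distrib, ← Finset.sum_sub_distrib,
    Finset.mul_sum, Finset.mul_sum]
  refine Finset.sum_le_sum fun p _ => ?_
  rw [← Finset.sum_sub_distrib, ← Finset.sum_sub_distrib, Finset.mul_sum, Finset.mul_sum]
  refine Finset.sum_le_sum fun q _ => ?_
  rw [integral_finsetSum _ fun j _ => i1 p q j, integral_finsetSum _ fun j _ => i2 p q j]
  exact main p q

end Summation

end OrliczSym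

namespace OrliczSym

open Filter Topology

/-! ### The local energy estimate -/

section Energy

variable {n : ℕ}

/-- The classical gradient matrix. -/
noncomputable def gradMat (U : Fin n → Pt n → ℝ) (x : Pt n) : Mat n :=
  WithLp.toLp 2 fun z => pd z.2 (U z.1) x

theorem norm_gradMat_sq (U : Fin n → Pt n → ℝ) (x : Pt n) :
    ‖gradMat U x‖ ^ 2 = ∑ p, ∑ q, pd q (U p) x ^ 2 := by
  rw [EuclideanSpace.norm_sq_eq, Fintype.sum_prod_type]
  simp [gradMat]

theorem contDiffOn_gradMat {x₀ : Pt n} {R : ℝ} {U : Fin n → Pt n → ℝ} {m : ℕ}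
    (hU : ∀ p, ContDiffOn ℝ (m + 1 : ℕ) (U p) (ball x₀ R)) :
    ContDiffOn ℝ m (gradMat U) (ball x₀ R) :=
  contDiffOn_euclidean.2 fun z => contDiffOn_pd isOpen_ball (hU z.1) z.2

theorem contDiffOn_symPart_gradMat {x₀ : Pt n} {R : ℝ} {U : Fin n → Pt n → ℝ} {m : ℕ}
    (hU : ∀ p, ContDiffOn ℝ (m + 1 : ℕ) (U p) (ball x₀ R)) :
    ContDiffOn ℝ m (fun x => symPart (gradMat U x)) (ball x₀ R) :=
  (LinearMap.toContinuousLinearMap (symPart (n := n))).contDiff.comp_contDiffOn (contDiffOn_gradMat hU)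

theorem fderiv_symPart_gradMat {x₀ : Pt n} {R : ℝ} {U : Fin n → Pt n → ℝ}
    (hU : ∀ p, ContDiffOn ℝ 2 (U p) (ball x₀ R)) {x : Pt n} (hx : x ∈ ball x₀ R) (q p j : Fin n) :
    (fderiv ℝ (fun x => symPart (gradMat U x)) x (EuclideanSpace.single q 1) : Mat n) (p, j) =
      (pd q (pd j (U p)) x + pd q (pd p (U j)) x) / 2 := by
  have hE : DifferentiableAt ℝ (fun x => symPart (gradMat U x)) x :=
    ((contDiffOn_symPart_gradMat (m := 1) hU).differentiableOn (by simp) x hx).differentiableAt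
      (isOpen_ball.mem_nhds hx)
  have hd : ∀ p q, DifferentiableAt ℝ (pd q (U p)) x := fun p q =>
    ((contDiffOn_pd (m := 1) isOpen_ball (hU p) q).differentiableOn (by simp) x hx).differentiableAt
      (isOpen_ball.mem_nhds hx)
  rw [fderiv_coord hE]
  have h1 : (fun z => (symPart (gradMat U z) : Mat n) (p, j)) =
      fun z => (1 / 2 : ℝ) * (pd j (U p) z + pd p (U j) z) := by
    ext z
    rw [symPart_apply]
    simp only [gradMat]
    ring
  rw [h1, fderiv_const_mul ((hd p j).fun_add (hd j p)), fderiv_fun_add (hd p j) (hd j p)]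
  simp only [pd, smul_apply, add_apply, smul_eq_mul]
  ring

theorem integrableOn_ball_of_continuousOn {x₀ y : Pt n} {R r : ℝ} {f : Pt n → ℝ}
    (hf : ContinuousOn f (ball x₀ R)) (hyr : closedBall y r ⊆ ball x₀ R) :
    IntegrableOn f (ball y r) :=
  ((hf.mono hyr).integrableOn_compact (isCompact_closedBall y r)).mono_set ball_subset_closedBall

/-- Monotonicity of `conj φ` gives both measurability and boundedness of the composition; no
continuity of the conjugate is needed. -/
theorem IsRegularYoung.integrableOn_conj {φ : ℝ → ℝ} {i s : ℝ} (h : IsRegularYoung φ i s)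
    {x₀ y : Pt n} {R r : ℝ} {f : Pt n → ℝ} (hf : ContinuousOn f (ball x₀ R))
    (hyr : closedBall y r ⊆ ball x₀ R) : IntegrableOn (fun x => conj φ (f x)) (ball y r) := by
  have hfr := hf.mono (ball_subset_closedBall.trans hyr)
  obtain ⟨M, hM⟩ := (isCompact_closedBall y r).exists_bound_of_continuousOn (hf.mono hyr)
  have hm : AEStronglyMeasurable (fun x => conj φ (f x)) (volume.restrict (ball y r)) :=
    (h.monotone_conj.measurable.comp_aemeasurable
      (hfr.aestronglyMeasurable measurableSet_ball).aemeasurable).aestronglyMeasurable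
  have : IsFiniteMeasure (volume.restrict (ball y r)) := ⟨by simpa using measure_ball_lt_top⟩
  refine Integrable.of_bound hm (conj φ M) ?_
  filter_upwards [ae_restrict_mem measurableSet_ball] with x hx
  rw [Real.norm_of_nonneg (h.conj_nonneg _)]
  exact h.monotone_conj ((le_abs_self _).trans (hM x (ball_subset_closedBall hx)))

theorem IsCutoff.abs_pd_pow_le {c : ℕ → ℝ} {L : ℝ} {η : Pt n → ℝ} (h : IsCutoff c L η) {k : ℕ}
    (hk : 1 ≤ k) (j : Fin n) (x : Pt n) :
    |pd j (fun z => η z ^ (2 * k)) x| ≤ 2 * k * (c 1 / L) * η x ^ (2 * k - 1) := by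
  have h1 := pd_pow h.smooth (2 * k - 1) j x
  rw [show 2 * k - 1 + 1 = 2 * k by omega, Nat.cast_sub (by omega)] at h1
  push_cast at h1
  have h0 := h.nonneg x
  rw [h1, abs_mul, abs_of_nonneg (by
    rw [sub_add_cancel]
    positivity)]
  have := mul_le_mul_of_nonneg_left (h.abs_pd_le j x) (by positivity : 0 ≤ 2 * k * η x ^ (2 * k - 1))
  calc _ = 2 * k * η x ^ (2 * k - 1) * |pd j η x| := by ring
    _ ≤ _ := this
    _ = _ := by ring

/-- Two derivatives of the power 2k produce a factor of order k². The numbers c 1 and c 2 do not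
involve k, so the dependence on k is explicit. -/
theorem IsCutoff.abs_pd_pd_pow_le {c : ℕ → ℝ} {L : ℝ} (hL : 0 < L) {η : Pt n → ℝ}
    (h : IsCutoff c L η) {k : ℕ} (hk : 1 ≤ k) (q j : Fin n) (x : Pt n) :
    |pd q (pd j fun z => η z ^ (2 * k)) x| ≤ (4 * c 1 ^ 2 + 2 * c 2) * (k ^ 2 / L ^ 2) := by
  have h1 := pd_pd_pow h.smooth (2 * k - 2) q j x
  rw [show 2 * k - 2 + 2 = 2 * k by omega, Nat.cast_sub (by omega)] at h1
  push_cast at h1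
  have h0 := h.nonneg x
  have hk' : (1 : ℝ) ≤ k := by exact_mod_cast hk
  have e1 : |η x ^ (2 * k - 2)| ≤ 1 := by
    rw [abs_of_nonneg (by positivity)]; exact pow_le_one₀ h0 (h.le_one x)
  have e2 : |η x ^ (2 * k - 2 + 1)| ≤ 1 := by
    rw [abs_of_nonneg (by positivity)]; exact pow_le_one₀ h0 (h.le_one x)
  have e3 : |pd q (pd j η) x| ≤ c 2 / L ^ 2 := by
    have h3 := abs_partialDeriv_le (Fin.cons q (fun _ : Fin 1 => j) : Fin 2 → Fin n) η x
    rw [partialDeriv_cons h.smooth, partialDeriv_one h.smooth] at h3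
    exact h3.trans (h.bound 2 x)
  have e4 := h.abs_pd_le q x
  have e5 := h.abs_pd_le j x
  have c1 : 0 ≤ c 1 / L := (abs_nonneg _).trans e4
  have c2 : 0 ≤ c 2 / L ^ 2 := (abs_nonneg _).trans e3
  rw [h1]
  refine (abs_add_le _ _).trans ?_
  simp only [abs_mul]
  have a1 : |2 * (k : ℝ) - 2 + 2| = 2 * k := by rw [sub_add_cancel, abs_of_nonneg (by positivity)]
  have a2 : |2 * (k : ℝ) - 2 + 1| ≤ 2 * k := by
    rw [abs_of_nonneg (by linarith)]; linarith
  rw [a1]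
  calc _ ≤ 2 * k * (2 * k) * 1 * (c 1 / L) * (c 1 / L) + 2 * k * 1 * (c 2 / L ^ 2) := by gcongr
    _ ≤ 2 * k * (2 * k) * 1 * (c 1 / L) * (c 1 / L) + 2 * (k * k) * 1 * (c 2 / L ^ 2) := by
        gcongr
        nlinarith
    _ = _ := by field_simp; ring

/-- The square of the first-order bound 2k c₁/L and the second-order bound are both multiples of
k²/L². Factoring out 1 + k²/L² leaves a constant free of k. -/
theorem young_constants_le {n k : ℕ} {ν L₂ K i s c₁ c₂ L : ℝ} (hν : 0 < ν) (hL₂ : 0 < L₂)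
    (hi : 1 < i) (hs : i ≤ s) (hc₂ : 0 ≤ c₂) :
    n * (2 * s / (i - 1) * (K ^ 2 + (3 * n ^ 2 * L₂ * (2 * k * (c₁ / L))) ^ 2) / ν) +
        n ^ 3 * L₂ * ((4 * c₁ ^ 2 + 2 * c₂) * (k ^ 2 / L ^ 2)) * s + 1 ≤
      (n * (2 * s / (i - 1) * (K ^ 2 + 36 * n ^ 4 * L₂ ^ 2 * c₁ ^ 2) / ν) +
        n ^ 3 * L₂ * (4 * c₁ ^ 2 + 2 * c₂) * s + 1) * (1 + k ^ 2 / L ^ 2) := by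
  have hi' : 0 < i - 1 := by linarith
  have hs' : 0 < s := by linarith
  set X : ℝ := k ^ 2 / L ^ 2 with hX
  have hX0 : 0 ≤ X := by positivity
  have e : (3 * n ^ 2 * L₂ * (2 * k * (c₁ / L))) ^ 2 = 36 * n ^ 4 * L₂ ^ 2 * c₁ ^ 2 * X := by
    rw [hX]; ring
  rw [e]
  have h1 : K ^ 2 + 36 * n ^ 4 * L₂ ^ 2 * c₁ ^ 2 * X ≤
      (K ^ 2 + 36 * n ^ 4 * L₂ ^ 2 * c₁ ^ 2) * (1 + X) := by
    have : 0 ≤ K ^ 2 * X + 36 * n ^ 4 * L₂ ^ 2 * c₁ ^ 2 := by positivity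
    linarith
  have h2 : n * (2 * s / (i - 1) * (K ^ 2 + 36 * n ^ 4 * L₂ ^ 2 * c₁ ^ 2 * X) / ν) ≤
      n * (2 * s / (i - 1) * ((K ^ 2 + 36 * n ^ 4 * L₂ ^ 2 * c₁ ^ 2) * (1 + X)) / ν) := by gcongr
  have h3 : n ^ 3 * L₂ * ((4 * c₁ ^ 2 + 2 * c₂) * X) * s ≤
      n ^ 3 * L₂ * (4 * c₁ ^ 2 + 2 * c₂) * s * (1 + X) := by
    have : 0 ≤ n ^ 3 * L₂ * (4 * c₁ ^ 2 + 2 * c₂) * s := by positivity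
    linarith
  have h4 : n * (2 * s / (i - 1) * ((K ^ 2 + 36 * n ^ 4 * L₂ ^ 2 * c₁ ^ 2) * (1 + X)) / ν) =
      n * (2 * s / (i - 1) * (K ^ 2 + 36 * n ^ 4 * L₂ ^ 2 * c₁ ^ 2) / ν) * (1 + X) := by ring
  linarith

theorem exists_energy_estimate (n : ℕ) {ν L₁ L₂ K i s : ℝ} (hν : 0 < ν) (hL₁ : 0 < L₁)
    (hL₂ : 0 < L₂) (hK : 0 < K) :
    ∃ c : ℝ, 0 < c ∧ ∀ k : ℕ, 2 ≤ k → ∃ c_k : ℝ, 0 < c_k ∧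
      ∀ (φ : ℝ → ℝ) (Ω : Set (Pt n)) (A : Pt n → SymMat n → SymMat n) (x₀ : Pt n) (R τ : ℝ)
        (v U F : Fin n → Pt n → ℝ), IsRegularYoung φ i s → IsOpen Ω →
        IsOrliczOperator Ω φ ν L₁ L₂ K A → ball x₀ R ⊆ Ω → 0 < τ →
        (∀ p, SqWeakDerivs k (ball x₀ R) (v p)) →
        (∀ p, ContDiffOn ℝ 2 (U p) (ball x₀ R)) →
        (∀ p, v p =ᵐ[volume.restrict (ball x₀ R)] U p) → (∀ p, ContDiff ℝ ∞ (F p)) →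
        (∀ (p : Fin n) (ψ : Pt n → ℝ), IsTest (ball x₀ R) ψ →
          τ * ∑ α : Fin k → Fin n, ∫ x in ball x₀ R,
            weakDeriv (ball x₀ R) α (v p) x * partialDeriv α ψ x =
          -(∑ j, ∫ x in ball x₀ R, (A x (symPart (gradMat U x)) : Mat n) (p, j) * pd j ψ x) +
            ∫ x in ball x₀ R, F p x * ψ x) →
        ∀ (y : Pt n) (ρ r : ℝ), 0 < ρ → ρ < r → closedBall y r ⊆ ball x₀ R →
          ∫ x in ball y ρ, ∑ q, ‖fderiv ℝ (fun x => V φ (symPart (gradMat U x))) x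
              (EuclideanSpace.single q 1)‖ ^ 2 ≤
            c * (1 + (k : ℝ) ^ 2 / (r - ρ) ^ 2) * (∫ x in ball y r, φ ‖gradMat U x‖) +
              c * (∫ x in ball y r, conj φ ‖gradMat F x‖) +
              c_k * τ / (r - ρ) ^ (2 * k) * ∫ x in ball y r, ‖gradMat U x‖ ^ 2 := by
  obtain ⟨c₀, hc₀⟩ := exists_isCutoff n
  set Q : ℝ := n * (2 * s / (i - 1) * (K ^ 2 + 36 * n ^ 4 * L₂ ^ 2 * c₀ 1 ^ 2) / ν) +
        n ^ 3 * L₂ * (4 * c₀ 1 ^ 2 + 2 * c₀ 2) * s + 1 with hQ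
  -- The first factor is the Lipschitz constant of V; the second inverts the half of the ellipticity
  -- that survives absorption.
  set CV : ℝ := 64 * (1 + s) ^ 2 / (i - 1) * (2 / ν) with hCV
  -- The numbers i and s are fixed before any φ relates them, so CV * Q need not be positive at this
  -- point; the maximum with 1 is.
  refine ⟨max 1 (CV * Q), by positivity, fun k hk => ?_⟩
  obtain ⟨C, hC0, hC⟩ := exists_summed_inequality n c₀ hk
  refine ⟨max 1 (CV * C), by positivity, ?_⟩
  intro φ Ω A x₀ R τ v U F hφ hΩ hA hBΩ hτ hv hU hvU hF heq y ρ r hρ hρr hyr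
  set B := ball x₀ R with hB
  have hL : 0 < r - ρ := sub_pos.2 hρr
  have hr : 0 < r := hρ.trans hρr
  have hi := hφ.one_lt
  have hs := hφ.i_le_s
  obtain ⟨η, hη, hη1, hη0⟩ := hc₀ y ρ r hρ hρr
  set L := r - ρ with hLdef
  set E : Pt n → SymMat n := fun x => symPart (gradMat U x) with hE
  have hrB : ball y r ⊆ B := ball_subset_closedBall.trans hyr
  have hEs : ContDiffOn ℝ 1 E B := contDiffOn_symPart_gradMat (m := 1) hU
  have hEl := lipschitzOnSubballs_of_contDiffOn hEs
  have hal := hA.lipschitzOnSubballs hφ hΩ hL₁ hK hBΩ hEl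
  have hVl := hφ.lipschitzOnSubballs_V hEl
  obtain ⟨hI, hIle⟩ := hC x₀ R τ v U F (fun x => A x (E x)) hτ hv hU hvU hF hal heq η L r y hL hr hη
    hη0 hyr
  have hgc : ContinuousOn (gradMat U) B := (contDiffOn_gradMat (m := 1) hU).continuousOn
  have hEc : ContinuousOn E B := hEs.continuousOn
  have hd1 : ∀ q : Fin n, ContinuousOn (fun x => ‖fderiv ℝ E x (EuclideanSpace.single q 1)‖) B :=
    fun q => ((hEs.continuousOn_fderiv_of_isOpen isOpen_ball le_rfl).clm_apply continuousOn_const).norm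
  have hDc : ContinuousOn (fun x => d2 φ (2 * ‖E x‖) *
      ∑ q : Fin n, ‖fderiv ℝ E x (EuclideanSpace.single q 1)‖ ^ 2) B :=
    (hφ.continuousOn_d2.comp (continuousOn_const.mul hEc.norm) fun x _ =>
      mem_Ici.2 (mul_nonneg zero_le_two (norm_nonneg (E x)))).mul (continuousOn_finsetSum _ fun q _ => (hd1 q).pow 2)
  have hζDi : IntegrableOn (fun x => η x ^ (2 * k) * (d2 φ (2 * ‖E x‖) *
      ∑ q, ‖fderiv ℝ E x (EuclideanSpace.single q 1)‖ ^ 2)) (ball y r) :=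
    integrableOn_ball_of_continuousOn ((hη.smooth.continuous.pow (2 * k)).continuousOn.mul hDc) hyr
  have hφi : IntegrableOn (fun x => φ ‖gradMat U x‖) (ball y r) :=
    integrableOn_ball_of_continuousOn (hφ.continuousOn.comp hgc.norm fun x _ => norm_nonneg _) hyr
  have hFc : ContinuousOn (gradMat F) B :=
    (contDiffOn_gradMat (m := 0) fun p => (contDiff_infty.1 (hF p) 1).contDiffOn).continuousOn
  have hci : IntegrableOn (fun x => conj φ ‖gradMat F x‖) (ball y r) :=
    hφ.integrableOn_conj hFc.norm hyr
  set IΦ := ∫ x in ball y r, φ ‖gradMat U x‖ with hIΦ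
  set IC := ∫ x in ball y r, conj φ ‖gradMat F x‖ with hIC
  set IG := ∫ x in ball y r, ‖gradMat U x‖ ^ 2 with hIG
  have hIΦ0 : 0 ≤ IΦ := integral_nonneg fun x => hφ.young.nonneg _ (norm_nonneg _)
  have hIC0 : 0 ≤ IC := integral_nonneg fun x => hφ.conj_nonneg _
  have hIG0 : 0 ≤ IG := integral_nonneg fun x => by positivity
  have hc1 : 0 ≤ c₀ 1 / L := by
    have := hη.bound 1 y
    rw [pow_one] at this
    exact (norm_nonneg _).trans this
  have hc2 : 0 ≤ c₀ 2 := by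
    have := (norm_nonneg _).trans (hη.bound 2 y)
    rwa [le_div_iff₀ (by positivity), zero_mul] at this
  have hEn : ∀ x, ‖E x‖ ≤ ‖gradMat U x‖ := fun x => norm_symPart_le _
  -- the pointwise lower bound
  have hpt : ∀ᵐ x ∂volume.restrict (ball y r),
      ν / 2 * (η x ^ (2 * k) * (d2 φ (2 * ‖E x‖) *
        ∑ q, ‖fderiv ℝ E x (EuclideanSpace.single q 1)‖ ^ 2)) -
        Q * (1 + k ^ 2 / L ^ 2) * φ ‖gradMat U x‖ - conj φ ‖gradMat F x‖ ≤
      energyDensity (fun x => η x ^ (2 * k)) U F (fun x => A x (E x)) x := by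
    filter_upwards [ae_restrict_mem measurableSet_ball,
      ae_restrict_of_ae_restrict_of_subset hrB hal.ae_differentiableAt] with x hx hax
    have hxB := hrB hx
    have hEd : DifferentiableAt ℝ E x :=
      (hEs.differentiableOn (by simp) x hxB).differentiableAt (isOpen_ball.mem_nhds hxB)
    have h1 := pointwise_estimate (K := K) hφ hν hL₂ (k := k) (by omega) (a := A x (E x)) (E := E x)
      (b := fun q => fderiv ℝ (fun x => A x (E x)) x (EuclideanSpace.single q 1))
      (e := fun q => fderiv ℝ E x (EuclideanSpace.single q 1)) (d := gradMat U x)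
      (f := gradMat F x) (h := fun p q j => pd j (pd q (U p)) x) (η := η x)
      (Z₁ := 2 * k * (c₀ 1 / L)) (Z₂ := (4 * c₀ 1 ^ 2 + 2 * c₀ 2) * (k ^ 2 / L ^ 2))
      (ζ₁ := fun j => pd j (fun z => η z ^ (2 * k)) x)
      (ζ₂ := fun q j => pd q (pd j fun z => η z ^ (2 * k)) x)
      (hη.nonneg x) (hη.le_one x) (by positivity) (by positivity)
      (fun q => hA.inner_fderiv_ge hφ hΩ (hBΩ hxB) (by simp) hEd hax)
      (hA.growth_of_mem hΩ (hBΩ hxB) _) (hEn x)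
      (fun q p j => fderiv_symPart_gradMat hU hxB q p j)
      (fun p q j => pd_comm ((hU p).contDiffAt (isOpen_ball.mem_nhds hxB)) j q)
      (fun j => hη.abs_pd_pow_le (by omega) j x)
      (fun q j => hη.abs_pd_pd_pow_le hL (by omega) q j x)
    refine le_trans ?_ h1
    have h2 := mul_le_mul_of_nonneg_right (young_constants_le (n := n) (k := k) (K := K) (L := L)
      (c₁ := c₀ 1) hν hL₂ hi hs hc2) (hφ.young.nonneg _ (norm_nonneg (gradMat U x)))
    linarith
  have hζint : ν / 2 * (∫ x in ball y r, η x ^ (2 * k) * (d2 φ (2 * ‖E x‖) *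
        ∑ q, ‖fderiv ℝ E x (EuclideanSpace.single q 1)‖ ^ 2)) ≤
      Q * (1 + k ^ 2 / L ^ 2) * IΦ + IC + τ * (C / L ^ (2 * k) * IG) := by
    have h1 := integral_mono_ae (((hζDi.const_mul (ν / 2)).sub'
      (hφi.const_mul (Q * (1 + k ^ 2 / L ^ 2)))).sub' hci) hI hpt
    rw [integral_sub ((hζDi.const_mul (ν / 2)).sub' (hφi.const_mul (Q * (1 + k ^ 2 / L ^ 2)))) hci,
      integral_sub (hζDi.const_mul (ν / 2)) (hφi.const_mul (Q * (1 + k ^ 2 / L ^ 2))),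
      integral_const_mul, integral_const_mul] at h1
    simp_rw [← norm_gradMat_sq] at hIle
    linarith
  have hVint : ∫ x in ball y ρ, ∑ q, ‖fderiv ℝ (fun x => V φ (E x)) x
      (EuclideanSpace.single q 1)‖ ^ 2 ≤ 64 * (1 + s) ^ 2 / (i - 1) *
      ∫ x in ball y r, η x ^ (2 * k) * (d2 φ (2 * ‖E x‖) *
        ∑ q, ‖fderiv ℝ E x (EuclideanSpace.single q 1)‖ ^ 2) := by
    have hsub : ball y ρ ⊆ ball y r := ball_subset_ball hρr.le
    have hc : 0 ≤ 64 * (1 + s) ^ 2 / (i - 1) := div_nonneg (by positivity) (by linarith)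
    rw [← integral_const_mul]
    refine le_trans ?_ (setIntegral_mono_set (hζDi.const_mul (64 * (1 + s) ^ 2 / (i - 1)))
      (Eventually.of_forall fun x => ?_) (Eventually.of_forall hsub))
    · refine integral_mono_of_nonneg (Eventually.of_forall fun x => by
        simp only [Pi.zero_apply]; positivity)
        (IntegrableOn.mono_set (hζDi.const_mul _) hsub) ?_
      filter_upwards [ae_restrict_mem measurableSet_ball,
        ae_restrict_of_ae_restrict_of_subset (hsub.trans hrB) hVl.ae_differentiableAt] with x hx hVx
      have hxB := hrB (hsub hx)
      have hEd : DifferentiableAt ℝ E x :=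
        (hEs.differentiableOn (by simp) x hxB).differentiableAt (isOpen_ball.mem_nhds hxB)
      rw [hη1 x hx, one_pow, one_mul, Finset.mul_sum, Finset.mul_sum]
      exact Finset.sum_le_sum fun q _ => hφ.norm_fderiv_V_sq_le _ hEd hVx
    · have h1 := hη.nonneg x
      have h2 := hφ.d2_nonneg (2 * ‖E x‖)
      simp only [Pi.zero_apply]
      positivity
  have hCV0 : 0 ≤ CV := mul_nonneg (div_nonneg (by positivity) (by linarith)) (by positivity)
  have hQ1 : 1 ≤ Q := by
    have h1 : 0 ≤ 2 * s / (i - 1) := div_nonneg (by linarith) (by linarith)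
    have h2 : 0 ≤ s := by linarith
    have : 0 ≤ n * (2 * s / (i - 1) * (K ^ 2 + 36 * n ^ 4 * L₂ ^ 2 * c₀ 1 ^ 2) / ν) +
        n ^ 3 * L₂ * (4 * c₀ 1 ^ 2 + 2 * c₀ 2) * s := by positivity
    linarith
  have hVf : ∫ x in ball y ρ, ∑ q, ‖fderiv ℝ (fun x => V φ (E x)) x
      (EuclideanSpace.single q 1)‖ ^ 2 ≤
      CV * (Q * (1 + k ^ 2 / L ^ 2) * IΦ + IC + τ * (C / L ^ (2 * k) * IG)) := by
    refine hVint.trans ?_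
    have h1 := mul_le_mul_of_nonneg_left hζint hCV0
    refine le_trans (le_of_eq ?_) h1
    rw [hCV]
    field_simp
  refine hVf.trans ?_
  have g1 : CV * (Q * (1 + k ^ 2 / L ^ 2) * IΦ) ≤ max 1 (CV * Q) * (1 + k ^ 2 / L ^ 2) * IΦ := by
    calc _ = CV * Q * (1 + k ^ 2 / L ^ 2) * IΦ := by ring
      _ ≤ _ := by
        gcongr
        exact le_max_right _ _
  have g2 : CV * IC ≤ max 1 (CV * Q) * IC := by
    gcongr
    exact (le_mul_of_one_le_right hCV0 hQ1).trans (le_max_right _ _)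
  have g3 : CV * (τ * (C / L ^ (2 * k) * IG)) ≤ max 1 (CV * C) * τ / L ^ (2 * k) * IG := by
    calc _ = CV * C * τ / L ^ (2 * k) * IG := by ring
      _ ≤ _ := by
        gcongr
        exact le_max_right _ _
  linarith

end Energy

end OrliczSym

namespace OrliczSym

open Filter Topology

/-! ### Weak differentiability of V(ℰw) and integrability -/

section Final

variable {n : ℕ}

theorem derivSq_nonneg {ι : Type} [Fintype ι] (U : Set (Pt n)) (m : ℕ)
    (v : Pt n → EuclideanSpace ℝ ι) (x : Pt n) : 0 ≤ derivSq U m v x :=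
  Finset.sum_nonneg fun _ _ => Finset.sum_nonneg fun _ _ => mul_self_nonneg _

theorem derivSq_one {ι : Type} [Fintype ι] (U : Set (Pt n)) (v : Pt n → EuclideanSpace ℝ ι)
    (x : Pt n) : derivSq U 1 v x =
      ∑ p, ∑ q, weakDeriv U (fun _ : Fin 1 => q) (fun y => v y p) x ^ 2 := by
  unfold derivSq derivInner
  refine Finset.sum_congr rfl fun p _ => ?_
  rw [← (Equiv.funUnique (Fin 1) (Fin n)).symm.sum_comp]
  exact Finset.sum_congr rfl fun q _ => (sq _).symm

theorem integrableOn_derivSq {ι : Type} [Fintype ι] {k m : ℕ} {U : Set (Pt n)} (hU : IsOpen U)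
    {v : Pt n → EuclideanSpace ℝ ι} (h : MemSobolev k U v) (hm : m ≤ k) :
    IntegrableOn (derivSq U m v) U := by
  refine integrable_finsetSum _ fun p _ => integrable_finsetSum _ fun α _ => ?_
  obtain ⟨g, hg, hg2⟩ := h p m hm α
  have := (hg2.ae_eq (hg.ae_eq hU).symm).integrable_sq
  exact this.congr (Eventually.of_forall fun x => sq _)

theorem LipschitzOnSubballs.memLp_fderiv_coord {x₀ : Pt n} {R : ℝ} {a : Pt n → SymMat n}
    (h : LipschitzOnSubballs x₀ R a) (z : Fin n × Fin n) (q : Fin n) {C : Set (Pt n)}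
    (hC : IsCompact C) (hCB : C ⊆ ball x₀ R) :
    MemLp (fun x => (fderiv ℝ a x (EuclideanSpace.single q 1) : Mat n) z) 2 (volume.restrict C) := by
  have : IsFiniteMeasure (volume.restrict C) := ⟨by simpa using hC.measure_lt_top⟩
  obtain ⟨R', hR', hCR⟩ := exists_subball_of_isCompact hC hCB
  obtain ⟨M, hM⟩ := (h.coord z).abs_lineDeriv_le hR' q
  refine MemLp.of_bound
    ((h.isWeakDeriv_coord z q).2.1.integrableOn_compact_subset hCB hC).aestronglyMeasurable M ?_
  filter_upwards [ae_restrict_mem hC.measurableSet,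
    ae_restrict_of_ae_restrict_of_subset hCB (h.lineDeriv_coord_ae_eq z (EuclideanSpace.single q 1))]
    with x hx hx'
  rw [← hx']
  exact hM x (hCR hx)

theorem LipschitzOnSubballs.isWeakDeriv_of_ae_eq {x₀ : Pt n} {R : ℝ} {a : Pt n → SymMat n}
    (h : LipschitzOnSubballs x₀ R a) {b : Pt n → SymMat n}
    (hab : b =ᵐ[volume.restrict (ball x₀ R)] a) (z : Fin n × Fin n) (q : Fin n) :
    IsWeakDeriv (ball x₀ R) (fun _ : Fin 1 => q) (fun x => (b x : Mat n) z)
      fun x => (fderiv ℝ a x (EuclideanSpace.single q 1) : Mat n) z :=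
  (h.isWeakDeriv_coord z q).congr isOpen_ball (hab.symm.fun_comp fun P => (P : Mat n) z) (ae_eq_refl _)

theorem LipschitzOnSubballs.memSobolevLoc {x₀ : Pt n} {R : ℝ} {a b : Pt n → SymMat n}
    (h : LipschitzOnSubballs x₀ R a) (hab : b =ᵐ[volume.restrict (ball x₀ R)] a) :
    MemSobolevLoc 1 (ball x₀ R) fun x => (b x : Mat n) := by
  intro z m hm α
  interval_cases m
  · have hc := (h.coord z).continuousOn
    have he : (fun x => (b x : Mat n) z) =ᵐ[volume.restrict (ball x₀ R)] fun x => (a x : Mat n) z :=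
      hab.fun_comp fun P => (P : Mat n) z
    refine ⟨fun x => (a x : Mat n) z, (isWeakDeriv_zero_self
      (hc.locallyIntegrableOn measurableSet_ball) α).congr isOpen_ball he.symm (ae_eq_refl _),
      fun C hC hCB => ?_⟩
    have : IsFiniteMeasure (volume.restrict C) := ⟨by simpa using hC.measure_lt_top⟩
    obtain ⟨M, hM⟩ := hC.exists_bound_of_continuousOn (hc.mono hCB)
    refine MemLp.of_bound ((hc.mono hCB).aestronglyMeasurable hC.measurableSet) M ?_
    filter_upwards [ae_restrict_mem hC.measurableSet] with x hx using hM x hx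
  · have hα : α = fun _ => α 0 := funext fun i => by rw [Subsingleton.elim i 0]
    rw [hα]
    exact ⟨_, h.isWeakDeriv_of_ae_eq hab z (α 0), fun C hC hCB => h.memLp_fderiv_coord z _ hC hCB⟩

theorem LipschitzOnSubballs.derivSq_ae_eq {x₀ : Pt n} {R : ℝ} {a b : Pt n → SymMat n}
    (h : LipschitzOnSubballs x₀ R a) (hab : b =ᵐ[volume.restrict (ball x₀ R)] a) :
    derivSq (ball x₀ R) 1 (fun x => (b x : Mat n)) =ᵐ[volume.restrict (ball x₀ R)]
      fun x => ∑ q, ‖fderiv ℝ a x (EuclideanSpace.single q 1)‖ ^ 2 := by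
  have h1 : ∀ᵐ x ∂volume.restrict (ball x₀ R), ∀ (z : Fin n × Fin n) (q : Fin n),
      weakDeriv (ball x₀ R) (fun _ : Fin 1 => q) (fun x => (b x : Mat n) z) x =
        (fderiv ℝ a x (EuclideanSpace.single q 1) : Mat n) z :=
    ae_all_iff.2 fun z => ae_all_iff.2 fun q => (h.isWeakDeriv_of_ae_eq hab z q).ae_eq isOpen_ball
  filter_upwards [h1] with x hx
  rw [derivSq_one, Finset.sum_comm]
  refine Finset.sum_congr rfl fun q _ => ?_
  change _ = ‖(fderiv ℝ a x (EuclideanSpace.single q 1) : Mat n)‖ ^ 2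
  rw [EuclideanSpace.norm_sq_eq]
  exact Finset.sum_congr rfl fun z _ => by rw [hx, Real.norm_eq_abs, sq_abs]

theorem LipschitzOnSubballs.integrableOn_sum_fderiv_sq {x₀ : Pt n} {R : ℝ} {a : Pt n → SymMat n}
    (h : LipschitzOnSubballs x₀ R a) {C : Set (Pt n)} (hC : IsCompact C) (hCB : C ⊆ ball x₀ R) :
    IntegrableOn (fun x => ∑ q, ‖fderiv ℝ a x (EuclideanSpace.single q 1)‖ ^ 2) C := by
  refine integrable_finsetSum _ fun q _ => ?_
  have h1 : Integrable (fun x => ∑ z, (fderiv ℝ a x (EuclideanSpace.single q 1) : Mat n) z ^ 2)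
      (volume.restrict C) :=
    integrable_finsetSum _ fun z _ => (h.memLp_fderiv_coord z q hC hCB).integrable_sq
  refine h1.congr (Eventually.of_forall fun x => ?_)
  change _ = ‖(fderiv ℝ a x (EuclideanSpace.single q 1) : Mat n)‖ ^ 2
  simp [EuclideanSpace.norm_sq_eq]

theorem weakGrad_ae_eq_gradMat {B : Set (Pt n)} (hB : IsOpen B) {w : Pt n → Pt n}
    {U : Fin n → Pt n → ℝ}
    (h : ∀ p q, IsWeakDeriv B (fun _ : Fin 1 => q) (fun x => w x p) (pd q (U p))) :
    weakGrad B w =ᵐ[volume.restrict B] gradMat U := by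
  have h1 : ∀ᵐ x ∂volume.restrict B, ∀ z : Fin n × Fin n,
      weakDeriv B (fun _ : Fin 1 => z.2) (fun x => w x z.1) x = pd z.2 (U z.1) x :=
    ae_all_iff.2 fun z => (h z.1 z.2).ae_eq hB
  filter_upwards [h1] with x hx
  ext z
  exact hx z

end Final

end OrliczSym

open OrliczSym
theorem theorem3p1 (n : ℕ) (hn : 2 ≤ n) (ν L₁ L₂ K i s : ℝ)
    (hν : 0 < ν) (hL₁ : 0 < L₁) (hL₂ : 0 < L₂) (hK : 0 < K) :
    ∃ c : ℝ, 0 < c ∧ ∀ k : ℕ, n + 4 < 2 * k → ∃ c_k : ℝ, 0 < c_k ∧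
      ∀ (φ : ℝ → ℝ) (Ω : Set (Pt n)) (A : Pt n → SymMat n → SymMat n) (f u : Pt n → Pt n),
        IsRegularYoung φ i s →
        IsOpen Ω → IsConnected Ω → Bornology.IsBounded Ω →
        IsOrliczOperator Ω φ ν L₁ L₂ K A →
        MemOrliczSobolevLoc (conj φ) Ω f →
        MemOrliczSobolev φ Ω u →
      ∀ (η : Pt n → ℝ) (x₀ : Pt n) (R ε τ : ℝ) (w : Pt n → Pt n),
        IsMollifier η →
        0 < R → 0 < ε → closedBall x₀ (R + ε) ⊆ Ω → 0 < τ →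
        IsApproxSolution A (ball x₀ R) k τ (mollify η Ω ε u) (mollify η Ω ε f) w →
        MemSobolevLoc 1 (ball x₀ R) (fun x => (V φ (symGrad (ball x₀ R) w x) : Mat n)) ∧
        ∀ (y : Pt n) (ρ r : ℝ), 0 < ρ → ρ < r → closedBall y r ⊆ ball x₀ R →
          IntegrableOn
            (derivSq (ball x₀ R) 1 (fun x => (V φ (symGrad (ball x₀ R) w x) : Mat n)))
            (ball y ρ) ∧
          IntegrableOn (fun x => φ ‖weakGrad (ball x₀ R) w x‖) (ball y r) ∧
          IntegrableOn (fun x => conj φ ‖weakGrad (ball x₀ R) (mollify η Ω ε f) x‖) (ball y r) ∧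
          IntegrableOn (fun x => ∑ m ∈ Finset.range k, derivSq (ball x₀ R) (m + 1) w x)
            (ball y r) ∧
          ∫ x in ball y ρ,
              derivSq (ball x₀ R) 1 (fun z => (V φ (symGrad (ball x₀ R) w z) : Mat n)) x
            ≤ c * (1 + (k : ℝ) ^ 2 / (r - ρ) ^ 2) *
                (∫ x in ball y r, φ ‖weakGrad (ball x₀ R) w x‖)
              + c * (∫ x in ball y r, conj φ ‖weakGrad (ball x₀ R) (mollify η Ω ε f) x‖)
              + c_k * τ / (r - ρ) ^ (2 * k) *
                (∫ x in ball y r,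
                  ∑ m ∈ Finset.range k, derivSq (ball x₀ R) (m + 1) w x) := by
  obtain ⟨c, hc0, hc⟩ := exists_energy_estimate n (i := i) (s := s) hν hL₁ hL₂ hK
  refine ⟨c, hc0, fun k hk => ?_⟩
  obtain ⟨c_k, hck0, hck⟩ := hc k (by omega)
  refine ⟨c_k, hck0, ?_⟩
  intro φ Ω A f u hφ hΩ _ _ hA hf _ η x₀ R ε τ w hη _ hε hΩB hτ hw
  set B := ball x₀ R with hB
  have hBΩ : B ⊆ Ω := (ball_subset_closedBall.trans
    (closedBall_subset_closedBall (by linarith))).trans hΩB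
  have hv : ∀ p, SqWeakDerivs k B fun x => w x p := fun p l hl α => hw.mem p l hl α
  have hU' : ∀ p, ∃ U, ContDiffOn ℝ 2 U B ∧ (fun x => w x p) =ᵐ[volume.restrict B] U := by
    intro p
    have h1 := hv p
    -- Two orders are spent on class C², and the remaining k - 2 satisfy n < 2(k - 2).
    rw [show k = k - 2 + 2 by omega] at h1
    exact h1.exists_contDiffOn (by omega) 2
  choose U hU hvU using hU'
  choose F hF hgF using hη.exists_contDiff_mollify (R := R) hε hΩB hΩ fun p => by
    -- Only the local integrability of the component is extracted, so the direction of
    -- differentiation is irrelevant.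
    obtain ⟨g, hg⟩ := hf.1 p p
    exact hg.1
  set E : Pt n → SymMat n := fun x => symPart (gradMat U x) with hE
  have hgU : weakGrad B w =ᵐ[volume.restrict B] gradMat U :=
    weakGrad_ae_eq_gradMat isOpen_ball fun p q =>
      (isWeakDeriv_pd_of_contDiffOn ((hU p).of_le (by norm_num)) q).congr isOpen_ball
        (hvU p).symm (Filter.EventuallyEq.refl _ _)
  have hgF' : weakGrad B (mollify η Ω ε f) =ᵐ[volume.restrict B] gradMat F :=
    weakGrad_ae_eq_gradMat isOpen_ball fun p q =>
      (isWeakDeriv_pd_of_contDiffOn (contDiff_infty.1 (hF p) 1).contDiffOn q).congr isOpen_ball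
        (by
          filter_upwards [ae_restrict_mem measurableSet_ball] with x hx using (hgF p x hx).symm)
        (Filter.EventuallyEq.refl _ _)
  -- By definition `symGrad` is `symPart` applied to `weakGrad`.
  have hgE : symGrad B w =ᵐ[volume.restrict B] E := hgU.fun_comp symPart
  have hVE : (fun x => V φ (symGrad B w x)) =ᵐ[volume.restrict B] fun x => V φ (E x) :=
    hgE.fun_comp (V φ)
  have hEl : LipschitzOnSubballs x₀ R E :=
    lipschitzOnSubballs_of_contDiffOn (contDiffOn_symPart_gradMat (m := 1) hU)
  have hal := hA.lipschitzOnSubballs hφ hΩ hL₁ hK hBΩ hEl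
  have hVl := hφ.lipschitzOnSubballs_V hEl
  refine ⟨hVl.memSobolevLoc hVE, fun y ρ r hρ hρr hyr => ?_⟩
  have hrB : ball y r ⊆ B := ball_subset_closedBall.trans hyr
  have hρB : closedBall y ρ ⊆ B := (closedBall_subset_closedBall hρr.le).trans hyr
  have e1 : derivSq B 1 (fun x => (V φ (symGrad B w x) : Mat n)) =ᵐ[volume.restrict (ball y ρ)]
      fun x => ∑ q, ‖fderiv ℝ (fun x => V φ (E x)) x (EuclideanSpace.single q 1)‖ ^ 2 :=
    ae_restrict_of_ae_restrict_of_subset (ball_subset_closedBall.trans hρB)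
    (hVl.derivSq_ae_eq hVE)
  have e2 : (fun x => φ ‖weakGrad B w x‖) =ᵐ[volume.restrict (ball y r)]
      fun x => φ ‖gradMat U x‖ :=
    (ae_restrict_of_ae_restrict_of_subset hrB hgU).mono fun x hx => by
      dsimp only; rw [hx]
  have e3 : (fun x => conj φ ‖weakGrad B (mollify η Ω ε f) x‖) =ᵐ[volume.restrict (ball y r)]
      fun x => conj φ ‖gradMat F x‖ :=
    (ae_restrict_of_ae_restrict_of_subset hrB hgF').mono fun x hx => by
      dsimp only; rw [hx]
  have e4 : ∀ᵐ x ∂volume.restrict (ball y r), ‖gradMat U x‖ ^ 2 = derivSq B 1 w x :=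
    (ae_restrict_of_ae_restrict_of_subset hrB hgU).mono fun x hx => by
      rw [derivSq_one, ← hx, EuclideanSpace.norm_sq_eq, Fintype.sum_prod_type]
      simp [weakGrad]
  have i4 : IntegrableOn (fun x => ∑ m ∈ Finset.range k, derivSq B (m + 1) w x) (ball y r) :=
    integrable_finsetSum _ fun m hm => IntegrableOn.mono_set (integrableOn_derivSq isOpen_ball
      hw.mem (Finset.mem_range.1 hm)) hrB
  refine ⟨?_, ?_, ?_, i4, ?_⟩
  · exact (IntegrableOn.mono_set (hVl.integrableOn_sum_fderiv_sq (isCompact_closedBall y ρ) hρB)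
      ball_subset_closedBall).congr_fun_ae e1.symm
  · exact (integrableOn_ball_of_continuousOn (hφ.continuousOn.comp
      (contDiffOn_gradMat (m := 1) hU).continuousOn.norm fun x _ => norm_nonneg _)
      hyr).congr_fun_ae e2.symm
  · exact (hφ.integrableOn_conj (contDiffOn_gradMat (m := 0) fun p =>
      (contDiff_infty.1 (hF p) 1).contDiffOn).continuousOn.norm hyr).congr_fun_ae e3.symm
  · rw [integral_congr_ae e1, integral_congr_ae e2, integral_congr_ae e3]
    refine (hck φ Ω A x₀ R τ (fun p x => w x p) U F hφ hΩ hA hBΩ hτ hv hU hvU hF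
      (fun p ψ hψ => ?_) y ρ r hρ hρr hyr).trans ?_
    · rw [hw.scalar_equation isOpen_ball hgE hal.continuousOn p hψ]
      congr 1
      exact setIntegral_congr_fun measurableSet_ball fun x hx => by
        simp only [hgF p x hx]
    · have hL : 0 < r - ρ := sub_pos.2 hρr
      refine add_le_add le_rfl (mul_le_mul_of_nonneg_left ?_ (by positivity))
      refine integral_mono_of_nonneg (Filter.Eventually.of_forall fun x => by
        simp only [Pi.zero_apply]; positivity) i4 ?_
      filter_upwards [e4] with x hx
      rw [hx]
      -- Of the whole sum only the term of index 0, which is |Dw|², is used.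
      exact Finset.single_le_sum (f := fun m => derivSq B (m + 1) w x)
        (fun m _ => derivSq_nonneg B (m + 1) w x) (Finset.mem_range.2 (by omega : 0 < k))
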